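/- **Setting.** Let $\mathbb K$ be $\mathbb R$ or $\mathbb C$, $M$ a smooth manifold, $R=C^\infty(M,\mathbb K)$. A Lie algebroid over $M$ is a finite-rank $\mathbb K$-vector bundle $E\to M$ with a $\mathbb K$-Lie bracket on $\Gamma(E)$ and an $R$-linear anchor $\rho_E:\Gamma(E)\to\Gamma(T_M\otimes\mathbb K)=\mathrm{Der}_{\mathbb K}(R)$, a morphism of Lie algebras, such that $[u,fv]=\rho_E(u)(f)v+f[u,v]$. A *Lie pair* $(L,A)$ is an injective morphism of vector bundles $i:A\hookrightarrow L$ between Lie algebroids over $M$ that is compatible with brackets and anchors. Put $B=L/A$, fix a splitting $j:B\to L$ of $0\to A\to L\to B\to 0$, and let $\mathrm{pr}_A,\mathrm{pr}_B$ be the two projections of $L=i(A)\oplus j(B)$. An inner derivation of $L$ is an operator $\mathrm{ad}_u=[u,-]$ on $\Gamma(L)$, $u\in\Gamma(L)$; they form the Lie algebra $\mathrm{IDer}(L)$. Let $\Omega_A^p(B)=\Gamma(\Lambda^pA^*\otimes B)$. Let $\mathbf{Art}$ be the category of local Artinian $\mathbb K$-algebras $\mathsf v$ with maximal ideal $\mathfrak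 m$ and residue field $\mathsf v/\mathfrak m=\mathbb K$, with $\mathbb K$-algebra homomorphisms, and let $\mathrm{ev}:\mathsf v\to\mathbb K$ be the projection. **The functor $\mathrm{sDef}_{(L,A)}$.** A $\mathsf v$-ringed Lie algebroid structure on $E_{\mathsf v}$ consists of a $\mathsf v$-bilinear Lie bracket on $\Gamma(E)\otimes\mathsf v$ and an $(R\otimes\mathsf v)$-linear anchor $\Gamma(E)\otimes\mathsf v\to\mathrm{Der}_{\mathbb K}(R)\otimes\mathsf v$ satisfying the Leibniz rule over $R\otimes\mathsf v$. Its center is the structure on $E$ obtained by applying $\mathrm{ev}$; the $\mathsf v$-linear extension of a Lie algebroid structure on $E$ is its Cartesian extension $E^0_{\mathsf v}$. A morphism $(\Pi,\lambda)$ from $F_{\mathsf v}$ to $E_{\mathsf v}$ consists of a $\mathsf v$-linear map $\Pi:\Gamma(F)\otimes\mathsf v\to\Gamma(E)\otimes\mathsf v$ that preserves brackets and a $\mathsf v$-algebra endomorphism $\lambda$ of $R\otimes\mathsf v$ that reduces to $\mathrm{id}_R$ under $\mathrm{ev}$, with $\Pi(fs)=\lambda(f)\Pi(s)$ and $\lambda(\rho_F(s)f)=\rho_E(\Pi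 s)(\lambda f)$; its center is the map $\Gamma(F)\to\Gamma(E)$ obtained by applying $\mathrm{ev}$. An *infinitesimal deformation* of $(L,A)$ parameterized by $\mathsf v$ is a $\mathsf v$-ringed Lie algebroid structure on $A_{\mathsf v}$ with center the Lie algebroid $A$, together with a morphism $(I,\lambda)$ from it to $L^0_{\mathsf v}$ with center $i$. Two infinitesimal deformations $(I,\lambda)$, $(I',\lambda')$ are *semistrict isomorphic* if there are $\Delta=\mathrm{ad}_u$ with $u\in\Gamma(L)\otimes\mathfrak m$ and a morphism $(\Pi,\mu)$ from the $\mathsf v$-ringed Lie algebroid $A_{\mathsf v}$ of $(I',\lambda')$ to that of $(I,\lambda)$ such that $$\bigl(\exp(\Delta),\exp(\rho_L(u))\bigr)\circ(I',\lambda')=(I,\lambda)\circ(\Pi,\mu).$$ The functor $\mathrm{sDef}_{(L,A)}:\mathbf{Art}\to\mathbf{Set}$ sends $\mathsf v$ to the set of infinitesimal deformations parameterized by $\mathsf v$ modulo the equivalence relation generated by semistrict isomorphism, and a morphism to base change along it. **The cubic $L_\infty$-algebra $\mathfrak h_0$.** $\mathfrak h_0=\mathrm{IDer}(L)\oplus\Omega_A^\bullet(B)$,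 with $\mathrm{IDer}(L)$ in degree $0$ and $\Omega_A^p(B)$ in degree $p$. Its brackets are graded skew-symmetric, and for $\delta,\varepsilon\in\mathrm{IDer}(L)$ and $X,Y,Z$ in $\Omega_A^p(B),\Omega_A^q(B),\Omega_A^r(B)$ they are as follows; $\mathrm{Sh}$ is the signed sum over all shuffles of the arguments from $\Gamma(A)$, and $i,j$ are omitted in front of arguments. - $[\delta]_1(a)=-\mathrm{pr}_B\,\delta(a)$, and $[X]_1=dX$ is the Chevalley–Eilenberg differential of the Bott connection $\nabla_ab=\mathrm{pr}_B[a,b]$. - $[\delta,\varepsilon]_2=\delta\varepsilon-\varepsilon\delta$, and $[\delta,X]_2(a_1,\dots,a_p)=\mathrm{pr}_B\,\delta X(a_1,\dots,a_p)-\sum_kX(\dots,\mathrm{pr}_A\delta(a_k),\dots)$. - $[X,Y]_2=\mathrm{Sh}\bigl(\mathrm{pr}_B[X(x),Y(y)]-\sum_kY(\dots,\mathrm{pr}_A[X(x),y_k],\dots)+\sum_kX(\dots,\mathrm{pr}_A[Y(y),x_k],\dots)\bigr)$, where $x$ consists of $p$ and $y$ of $q$ arguments. - For an $A$-valued form $\varphi$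 let $\varphi\lrcorner Z=\mathrm{Sh}\,Z(\varphi(x),z)$ (and $0$ if $r=0$), and let $\beta(X,Y)=\mathrm{Sh}\,\mathrm{pr}_A[X(x),Y(y)]$. Then $$[\delta,X,Y]_3=(-1)^{p+1}(\mathrm{pr}_A\delta X)\lrcorner Y+(-1)^{q(p+1)}(\mathrm{pr}_A\delta Y)\lrcorner X,$$ $$[X,Y,Z]_3=(-1)^{p+q+1}\beta(X,Y)\lrcorner Z+(-1)^{qr+p+r}\beta(X,Z)\lrcorner Y+(-1)^{p(q+r)+q+r+1}\beta(Y,Z)\lrcorner X.$$ - All other components vanish. **The functor $\mathrm{Def}_{\mathfrak h_0}$.** For $\mathsf v\in\mathbf{Art}$ extend the brackets to $\mathfrak h_0\otimes\mathfrak m$ multilinearly by the multiplication of $\mathfrak m$. A Maurer–Cartan element is a $\xi\in\mathfrak h_0^1\otimes\mathfrak m$ with $[\xi]_1+\frac12[\xi,\xi]_2+\frac16[\xi,\xi,\xi]_3=0$. For $b\in\mathfrak h_0^0\otimes\mathfrak m$ put $$e^b*\xi=\xi-\sum_{k\ge1}\frac1{k!}e^k_\xi(b),\qquad e^{k+1}_\xi(b)=\sum_{n\ge0}\frac1{n!}\sum_{\substack{k_1+\dots+k_n=k\\k_\ell\ge1}}\frac{k!}{k_1!\cdots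 k_n!}\,[b,e^{k_1}_\xi(b),\dots,e^{k_n}_\xi(b)]^\xi_{n+1}\quad(k\ge 0),$$ where $[x_1,\dots,x_n]^\xi_n=\sum_{m\ge0}\frac1{m!}[\xi,\dots,\xi,x_1,\dots,x_n]_{m+n}$ ($m$ copies of $\xi$). The functor $\mathrm{Def}_{\mathfrak h_0}:\mathbf{Art}\to\mathbf{Set}$ sends $\mathsf v$ to the set of Maurer–Cartan elements of $\mathfrak h_0\otimes\mathfrak m$ modulo the equivalence relation generated by $\xi\sim e^b*\xi$, and a morphism to the map that it induces. **Theorem.** For every Lie pair $(L,A)$ and every splitting $j$, the functors $\mathrm{Def}_{\mathfrak h_0}$ and $\mathrm{sDef}_{(L,A)}$ from $\mathbf{Art}$ to $\mathbf{Set}$ are naturally isomorphic. -/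

import Mathlib

open CategoryTheory Bundle
open scoped TensorProduct Manifold ContDiff

set_option linter.unusedSectionVars false

universe w u

noncomputable section

namespace LiePairDef

/-! ### Local Artinian algebras -/

/-- A local Artinian `K`-algebra with residue field `K`. -/
structure ArtAlg (K : Type w) [Field K] where
  /-- the underlying ring -/
  carrier : Type u
  [commRing : CommRing carrier]
  [algebra : Algebra K carrier]
  [isLocalRing : IsLocalRing carrier]
  [isArtinianRing : IsArtinianRing carrier]
  residue : Function.Surjective (algebraMap K (IsLocalRing.ResidueField carrier))

namespace ArtAlg

variable {K : Type w} [Field K]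

instance : CoeSort (ArtAlg.{w, u} K) (Type u) := ⟨ArtAlg.carrier⟩

attribute [instance] ArtAlg.commRing ArtAlg.algebra ArtAlg.isLocalRing ArtAlg.isArtinianRing

/-- The category of local Artinian `K`-algebras; morphisms are all `K`-algebra homomorphisms
(they are automatically local). -/
instance : Category (ArtAlg.{w, u} K) where
  Hom v v' := v →ₐ[K] v'
  id v := AlgHom.id K v
  comp f g := AlgHom.comp g f

/-- A morphism of `ArtAlg`, as a homomorphism of algebras. -/
def hom {v v' : ArtAlg.{w, u} K} (f : v ⟶ v') : v →ₐ[K] v' := f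

@[simp] lemma hom_id (v : ArtAlg.{w, u} K) (x : v) : hom (𝟙 v) x = x := rfl

@[simp] lemma hom_comp {v v' v'' : ArtAlg.{w, u} K} (f : v ⟶ v') (g : v' ⟶ v'') (x : v) :
    hom (f ≫ g) x = hom g (hom f x) := rfl

/-- The evaluation `v → v / 𝔪 = K` at the maximal ideal. -/
def ev (v : ArtAlg.{w, u} K) : v →ₐ[K] K :=
  ((AlgEquiv.ofBijective (Algebra.ofId K (IsLocalRing.ResidueField v))
    ⟨(algebraMap K (IsLocalRing.ResidueField v)).injective, v.residue⟩).symm : _ →ₐ[K] K).comp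
    (IsScalarTower.toAlgHom K v (IsLocalRing.ResidueField v))

/-- The maximal ideal of `v`, as a `K`-subspace. -/
def maxIdeal (v : ArtAlg.{w, u} K) : Submodule K v :=
  (IsLocalRing.maximalIdeal v).restrictScalars K

lemma isNilpotent_of_mem (v : ArtAlg.{w, u} K) {x : v} (hx : x ∈ v.maxIdeal) : IsNilpotent x := by
  have h : x ∈ IsLocalRing.maximalIdeal (v : Type u) := hx
  have h2 := IsArtinianRing.isNilpotent_jacobson_bot (R := (v : Type u))
  rw [IsLocalRing.jacobson_eq_maximalIdeal ⊥ bot_ne_top] at h2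
  obtain ⟨n, hn⟩ := h2
  refine ⟨n, ?_⟩
  have := Ideal.pow_mem_pow h n
  rw [hn] at this
  simpa using this

lemma mem_of_isNilpotent (v : ArtAlg.{w, u} K) {x : v} (hx : IsNilpotent x) : x ∈ v.maxIdeal := by
  change x ∈ IsLocalRing.maximalIdeal (v : Type u)
  rw [IsLocalRing.mem_maximalIdeal, mem_nonunits_iff]
  exact hx.not_isUnit

lemma hom_mem {v v' : ArtAlg.{w, u} K} (f : v ⟶ v') {x : v} (hx : x ∈ v.maxIdeal) :
    hom f x ∈ v'.maxIdeal :=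
  v'.mem_of_isNilpotent ((v.isNilpotent_of_mem hx).map (hom f))

lemma ev_eq_zero_iff (v : ArtAlg.{w, u} K) (x : v) : v.ev x = 0 ↔ x ∈ v.maxIdeal := by
  simp only [ev, AlgHom.comp_apply]
  rw [← map_zero ((AlgEquiv.ofBijective (Algebra.ofId K (IsLocalRing.ResidueField v))
    ⟨(algebraMap K (IsLocalRing.ResidueField v)).injective, v.residue⟩).symm)]
  constructor
  · intro h
    have := (AlgEquiv.injective _) h
    exact (IsLocalRing.residue_eq_zero_iff x).1 this
  · intro h
    have : IsLocalRing.residue v x = 0 := (IsLocalRing.residue_eq_zero_iff x).2 h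
    exact congrArg _ this

lemma ev_hom {v v' : ArtAlg.{w, u} K} (f : v ⟶ v') (x : v) : v'.ev (hom f x) = v.ev x := by
  have h : x - algebraMap K v (v.ev x) ∈ v.maxIdeal := by
    rw [← ev_eq_zero_iff]; simp
  have h2 := (ev_eq_zero_iff _ _).2 (hom_mem f h)
  rw [map_sub, map_sub, AlgHom.commutes, AlgHom.commutes, sub_eq_zero] at h2
  simpa using h2

/-- The map induced by a morphism on maximal ideals. -/
def mapMax {v v' : ArtAlg.{w, u} K} (f : v ⟶ v') : v.maxIdeal →ₗ[K] v'.maxIdeal :=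
  (hom f).toLinearMap.restrict fun _ hx => hom_mem f hx

@[simp] lemma coe_mapMax {v v' : ArtAlg.{w, u} K} (f : v ⟶ v') (x : v.maxIdeal) :
    (mapMax f x : v') = hom f x := rfl

/-- Multiplication of the maximal ideal. -/
def mulMax (v : ArtAlg.{w, u} K) : v.maxIdeal →ₗ[K] v.maxIdeal →ₗ[K] v.maxIdeal :=
  LinearMap.mk₂ K (fun x y => ⟨x * y, (IsLocalRing.maximalIdeal v).mul_mem_left _ y.2⟩)
    (fun _ _ _ => Subtype.ext (add_mul _ _ _)) (fun _ _ _ => Subtype.ext (smul_mul_assoc _ _ _))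
    (fun _ _ _ => Subtype.ext (mul_add _ _ _)) (fun _ _ _ => Subtype.ext (mul_smul_comm _ _ _))

@[simp] lemma coe_mulMax (v : ArtAlg.{w, u} K) (x y : v.maxIdeal) :
    (v.mulMax x y : v) = x * y := rfl

end ArtAlg

/-! ### Cubic `L∞`-algebras and their deformation functors -/

/-- The structure maps of a cubic `L∞`-algebra concentrated in nonnegative degrees: a graded vector
space with brackets `[-]₁`, `[-,-]₂`, `[-,-,-]₃` of degrees `1`, `0`, `-1`.  (The output degree `s`
is an argument of its own, in order to avoid transports.) -/
structure CubicBrackets (K : Type w) [Field K] where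
  /-- the components of the graded vector space -/
  V : ℕ → Type u
  [addCommGroup : ∀ p, AddCommGroup (V p)]
  [module : ∀ p, Module K (V p)]
  b1 : ∀ p s : ℕ, s = p + 1 → V p →ₗ[K] V s
  b2 : ∀ p q s : ℕ, s = p + q → V p →ₗ[K] V q →ₗ[K] V s
  b3 : ∀ p q r s : ℕ, s + 1 = p + q + r → V p →ₗ[K] V q →ₗ[K] V r →ₗ[K] V s

namespace CubicBrackets

attribute [instance] CubicBrackets.addCommGroup CubicBrackets.module

variable {K : Type w} [Field K]

/-- The cubic `L∞`-algebra `𝔤 ⊗ 𝔪`, for the maximal ideal `𝔪` of a local Artinian algebra: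
`[x₁ ⊗ v₁, …, xₖ ⊗ vₖ]ₖ = [x₁, …, xₖ]ₖ ⊗ v₁ ⋯ vₖ`. -/
def tensor (g : CubicBrackets.{w, u} K) (v : ArtAlg.{w, u} K) : CubicBrackets.{w, u} K where
  V p := g.V p ⊗[K] v.maxIdeal
  b1 p s h := (g.b1 p s h).rTensor v.maxIdeal
  b2 p q s h := TensorProduct.homTensorHomMap (.id K) _ _ _ _ ∘ₗ
    TensorProduct.map (g.b2 p q s h) v.mulMax
  b3 p q r s h := LinearMap.compr₂ (TensorProduct.homTensorHomMap (.id K) _ _ _ _ ∘ₗ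
    TensorProduct.map (g.b3 p q r s h)
      (LinearMap.compr₂ v.mulMax v.mulMax)) (TensorProduct.homTensorHomMap (.id K) _ _ _ _)

lemma tensor_b1_tmul (g : CubicBrackets.{w, u} K) (v : ArtAlg.{w, u} K) (p s : ℕ) (h : s = p + 1)
    (x : g.V p) (a : v.maxIdeal) :
    (g.tensor v).b1 p s h (x ⊗ₜ a) = g.b1 p s h x ⊗ₜ[K] a := rfl

lemma tensor_b2_tmul (g : CubicBrackets.{w, u} K) (v : ArtAlg.{w, u} K) (p q s : ℕ)
    (h : s = p + q) (x : g.V p) (y : g.V q) (a b : v.maxIdeal) :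
    (g.tensor v).b2 p q s h (x ⊗ₜ a) (y ⊗ₜ b) = g.b2 p q s h x y ⊗ₜ[K] v.mulMax a b := rfl

lemma tensor_b3_tmul (g : CubicBrackets.{w, u} K) (v : ArtAlg.{w, u} K) (p q r s : ℕ)
    (h : s + 1 = p + q + r) (x : g.V p) (y : g.V q) (z : g.V r) (a b c : v.maxIdeal) :
    (g.tensor v).b3 p q r s h (x ⊗ₜ a) (y ⊗ₜ b) (z ⊗ₜ c) =
      g.b3 p q r s h x y z ⊗ₜ[K] v.mulMax (v.mulMax a b) c := rfl

variable (g : CubicBrackets.{w, u} K)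

/-- The Maurer-Cartan equation `[ξ]₁ + 1/2! [ξ,ξ]₂ + 1/3! [ξ,ξ,ξ]₃ = 0` for `ξ` of degree `1`. -/
def IsMC (ξ : g.V 1) : Prop :=
  g.b1 1 2 rfl ξ + (2 : K)⁻¹ • g.b2 1 1 2 rfl ξ ξ + (6 : K)⁻¹ • g.b3 1 1 1 2 rfl ξ ξ ξ = 0

/-- The `ξ`-bracket `[b]₁^ξ` for `b` of degree `0`. -/
def twist1 (ξ : g.V 1) (b : g.V 0) : g.V 1 :=
  g.b1 0 1 rfl b + g.b2 1 0 1 rfl ξ b + (2 : K)⁻¹ • g.b3 1 1 0 1 rfl ξ ξ b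

/-- The `ξ`-bracket `[b, x]₂^ξ` for `b` of degree `0` and `x` of degree `1`. -/
def twist2 (ξ : g.V 1) (b : g.V 0) (x : g.V 1) : g.V 1 :=
  g.b2 0 1 1 rfl b x + g.b3 1 0 1 1 rfl ξ b x

/-- The `ξ`-bracket `[b, x, y]₃^ξ` for `b` of degree `0` and `x`, `y` of degree `1`. -/
def twist3 (_ξ : g.V 1) (b : g.V 0) (x y : g.V 1) : g.V 1 :=
  g.b3 0 1 1 1 rfl b x y

/-- The terms `e^k_ξ(b)` of the `L∞`-exponential:
`e^{k+1} = ∑ₙ 1/n! ∑_{k₁+⋯+kₙ=k, kᵢ≥1} k!/(k₁!⋯kₙ!) [b, e^{k₁}, …, e^{kₙ}]^ξ_{n+1}`,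
where only `n = 0, 1, 2` contribute, and `n = 0` only for `k = 0`.  With the convention `e⁰ = 0`
the restriction `kᵢ ≥ 1` can be dropped. -/
def expTerm (ξ : g.V 1) (b : g.V 0) : ℕ → g.V 1
  | 0 => 0
  | k + 1 =>
      (if k = 0 then g.twist1 ξ b else 0) + g.twist2 ξ b (expTerm ξ b k) +
        (2 : K)⁻¹ • ∑ i : Fin (k + 1), (k.choose i : K) •
          g.twist3 ξ b (expTerm ξ b i) (expTerm ξ b (k - i))
  termination_by k => k
  decreasing_by all_goals omega

/-- Gauge equivalence: `η = e^b * ξ = ξ - ∑_{k ≥ 1} 1/k! e^k_ξ(b)` for some `b` of degree `0`, the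
series being a finite sum. -/
def GaugeEquiv (ξ η : g.V 1) : Prop :=
  ∃ (b : g.V 0) (N : ℕ), (∀ k, N ≤ k → g.expTerm ξ b k = 0) ∧
    η = ξ - ∑ k ∈ Finset.range N, (k.factorial : K)⁻¹ • g.expTerm ξ b k

/-- The set of Maurer-Cartan elements. -/
def MC : Type u := {ξ : g.V 1 // g.IsMC ξ}

/-- A degree preserving family of linear maps that commutes with all brackets. -/
structure IsStrictMor {g g' : CubicBrackets.{w, u} K} (f : ∀ p, g.V p →ₗ[K] g'.V p) : Prop where
  map_b1 : ∀ p s h x, f s (g.b1 p s h x) = g'.b1 p s h (f p x)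
  map_b2 : ∀ p q s h x y, f s (g.b2 p q s h x y) = g'.b2 p q s h (f p x) (f q y)
  map_b3 : ∀ p q r s h x y z,
    f s (g.b3 p q r s h x y z) = g'.b3 p q r s h (f p x) (f q y) (f r z)

namespace IsStrictMor

variable {g} {g' : CubicBrackets.{w, u} K} {f : ∀ p, g.V p →ₗ[K] g'.V p}

lemma isMC (hf : IsStrictMor f) {ξ : g.V 1} (h : g.IsMC ξ) : g'.IsMC (f 1 ξ) := by
  have := congrArg (f 2) h
  simpa only [IsMC, map_add, map_smul, hf.map_b1, hf.map_b2, hf.map_b3, map_zero] using this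

lemma expTerm (hf : IsStrictMor f) (ξ : g.V 1) (b : g.V 0) (k : ℕ) :
    f 1 (g.expTerm ξ b k) = g'.expTerm (f 1 ξ) (f 0 b) k := by
  induction k using Nat.strong_induction_on with
  | _ k ih =>
    cases k with
    | zero => simp [CubicBrackets.expTerm]
    | succ k =>
      rw [CubicBrackets.expTerm, CubicBrackets.expTerm]
      simp only [map_add, map_smul, map_sum]
      congr 1
      · congr 1
        · split_ifs
          · simp only [twist1, map_add, map_smul, hf.map_b1, hf.map_b2, hf.map_b3]
          · simp
        · simp only [twist2, map_add, hf.map_b2, hf.map_b3, ih k (Nat.lt_succ_self k)]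
      · congr 1
        refine Finset.sum_congr rfl fun i _ => ?_
        simp only [twist3, hf.map_b3]
        rw [ih i i.2, ih (k - i) (by omega)]

lemma gaugeEquiv (hf : IsStrictMor f) {ξ η : g.V 1} (h : g.GaugeEquiv ξ η) :
    g'.GaugeEquiv (f 1 ξ) (f 1 η) := by
  obtain ⟨b, N, hN, rfl⟩ := h
  refine ⟨f 0 b, N, fun k hk => ?_, ?_⟩
  · rw [← hf.expTerm, hN k hk, map_zero]
  · simp only [map_sub, map_sum, map_smul, hf.expTerm]

end IsStrictMor

/-- The map `id ⊗ ϑ : 𝔤 ⊗ 𝔪 → 𝔤 ⊗ 𝔪'` induced by `ϑ : v → v'`. -/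
def tensorMap {v v' : ArtAlg.{w, u} K} (ϑ : v ⟶ v') (p : ℕ) :
    (g.tensor v).V p →ₗ[K] (g.tensor v').V p :=
  (ArtAlg.mapMax ϑ).lTensor (g.V p)

lemma tensorMap_tmul {v v' : ArtAlg.{w, u} K} (ϑ : v ⟶ v') (p : ℕ) (x : g.V p) (a : v.maxIdeal) :
    g.tensorMap ϑ p (x ⊗ₜ a) = x ⊗ₜ[K] ArtAlg.mapMax ϑ a := rfl

lemma tensor_induction {v : ArtAlg.{w, u} K} {p : ℕ} {C : (g.tensor v).V p → Prop} (zero : C 0)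
    (tmul : ∀ (x : g.V p) (a : v.maxIdeal), C (x ⊗ₜ[K] a))
    (add : ∀ x y, C x → C y → C (x + y)) (x : (g.tensor v).V p) : C x :=
  TensorProduct.induction_on x zero tmul add

lemma isStrictMor_tensorMap {v v' : ArtAlg.{w, u} K} (ϑ : v ⟶ v') :
    IsStrictMor (g.tensorMap ϑ) where
  map_b1 p s h x := by
    induction x using g.tensor_induction with
    | zero => simp only [map_zero]
    | add x y hx hy => simp only [map_add, hx, hy]
    | tmul x a => rfl
  map_b2 p q s h x y := by
    induction x using g.tensor_induction with
    | zero => simp only [map_zero, LinearMap.zero_apply]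
    | add x y hx hy => simp only [map_add, LinearMap.add_apply, hx, hy]
    | tmul x a =>
      induction y using g.tensor_induction with
      | zero => simp only [map_zero]
      | add x y hx hy => simp only [map_add, hx, hy]
      | tmul y b =>
        rw [tensor_b2_tmul, tensorMap_tmul, tensorMap_tmul, tensorMap_tmul, tensor_b2_tmul]
        congr 1
        exact Subtype.ext (map_mul (ArtAlg.hom ϑ) _ _)
  map_b3 p q r s h x y z := by
    induction x using g.tensor_induction with
    | zero => simp only [map_zero, LinearMap.zero_apply]
    | add x y hx hy => simp only [map_add, LinearMap.add_apply, hx, hy]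
    | tmul x a =>
      induction y using g.tensor_induction with
      | zero => simp only [map_zero, LinearMap.zero_apply]
      | add x y hx hy => simp only [map_add, LinearMap.add_apply, hx, hy]
      | tmul y b =>
        induction z using g.tensor_induction with
        | zero => simp only [map_zero]
        | add x y hx hy => simp only [map_add, hx, hy]
        | tmul z c =>
          rw [tensor_b3_tmul, tensorMap_tmul, tensorMap_tmul, tensorMap_tmul, tensorMap_tmul,
            tensor_b3_tmul]
          congr 1
          refine Subtype.ext ?_
          simp only [ArtAlg.coe_mapMax, ArtAlg.coe_mulMax, map_mul]

/-- The algebraic deformation functor of a cubic `L∞`-algebra: it sends `v` to the set of gauge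
equivalence classes of Maurer-Cartan elements of `𝔤 ⊗ 𝔪`, and `ϑ` to `[ξ] ↦ [(id ⊗ ϑ) ξ]`. -/
def defFunctor : ArtAlg.{w, u} K ⥤ Type u where
  obj v := Quot fun ξ η : (g.tensor v).MC => (g.tensor v).GaugeEquiv ξ.1 η.1
  map {_ _} ϑ := ↾(Quot.map
    (fun ξ => ⟨g.tensorMap ϑ 1 ξ.1, (g.isStrictMor_tensorMap ϑ).isMC ξ.2⟩)
    fun _ _ h => (g.isStrictMor_tensorMap ϑ).gaugeEquiv h)
  map_id v := by
    ext x
    obtain ⟨ξ, rfl⟩ := Quot.exists_rep x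
    refine congrArg (Quot.mk _) (Subtype.ext ?_)
    exact LinearMap.congr_fun (LinearMap.lTensor_id (g.V 1) v.maxIdeal) ξ.1
  map_comp {v v' v''} f h := by
    ext x
    obtain ⟨ξ, rfl⟩ := Quot.exists_rep x
    refine congrArg (Quot.mk _) (Subtype.ext ?_)
    exact LinearMap.congr_fun (LinearMap.lTensor_comp (g.V 1) (ArtAlg.mapMax h)
      (ArtAlg.mapMax f)) ξ.1

end CubicBrackets

/-! ### Lie algebroids and Lie pairs on the level of section modules -/

section Algebraic

variable (K : Type w) [Field K] (R : Type u) [CommRing R] [Algebra K R]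

/-- A Lie algebroid structure on a vector bundle `E`, in terms of the `K`-algebra `R` of smooth
functions on the base and the `R`-module `E` of sections.  The anchor takes values in
`Derivation K R R`, the `R`-module of (`K`-valued) vector fields on the base. -/
@[ext]
structure LieAlgebroidStr (E : Type u) [AddCommGroup E] [Module K E] [Module R E] where
  bracket : E →ₗ[K] E →ₗ[K] E
  anchor : E →ₗ[R] Derivation K R R
  skew : ∀ x y, bracket x y = -bracket y x
  jacobi : ∀ x y z, bracket x (bracket y z) = bracket (bracket x y) z + bracket y (bracket x z)
  leibniz : ∀ x (f : R) y, bracket x (f • y) = anchor x f • y + f • bracket x y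
  anchor_bracket : ∀ x y, anchor (bracket x y) = ⁅anchor x, anchor y⁆

/-- An inclusion `A ↪ L` of Lie algebroids over the same base, in terms of section modules. -/
structure LiePair (A L : Type u) [AddCommGroup A] [Module K A] [Module R A]
    [AddCommGroup L] [Module K L] [Module R L] where
  algA : LieAlgebroidStr K R A
  algL : LieAlgebroidStr K R L
  incl : A →ₗ[R] L
  incl_injective : Function.Injective incl
  incl_bracket : ∀ a b, incl (algA.bracket a b) = algL.bracket (incl a) (incl b)
  anchor_incl : ∀ a, algL.anchor (incl a) = algA.anchor a

end Algebraic

/-! ### `v`-ringed objects -/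

section Ringed

variable {K : Type w} [Field K]

section Tensor

variable {E F G : Type u} [AddCommGroup E] [Module K E] [AddCommGroup F] [Module K F]
  [AddCommGroup G] [Module K G]

/-- The `v`-bilinear extension of a `K`-bilinear map. -/
def ext₂ (v : ArtAlg.{w, u} K) (β : E →ₗ[K] F →ₗ[K] G) :
    v ⊗[K] E →ₗ[v] v ⊗[K] F →ₗ[v] v ⊗[K] G :=
  LinearMap.liftBaseChange v (LinearMap.baseChangeHom K v F G ∘ₗ β)

@[simp] lemma ext₂_tmul (v : ArtAlg.{w, u} K) (β : E →ₗ[K] F →ₗ[K] G) (a b : v) (x : E) (y : F) :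
    ext₂ v β (a ⊗ₜ x) (b ⊗ₜ y) = (a * b) ⊗ₜ[K] β x y := by
  simp [ext₂, TensorProduct.smul_tmul']

/-- The evaluation map `E ⊗ v → E` at the maximal ideal of `v`. -/
def evT (v : ArtAlg.{w, u} K) (E : Type u) [AddCommGroup E] [Module K E] : v ⊗[K] E →ₗ[K] E :=
  (TensorProduct.lid K E).toLinearMap ∘ₗ v.ev.toLinearMap.rTensor E

@[simp] lemma evT_tmul (v : ArtAlg.{w, u} K) (a : v) (x : E) :
    evT v E (a ⊗ₜ x) = v.ev a • x := rfl

/-- The map `E ⊗ v → E ⊗ v'` induced by `ϑ : v → v'`. -/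
def pushT {v v' : ArtAlg.{w, u} K} (ϑ : v ⟶ v') (E : Type u) [AddCommGroup E] [Module K E] :
    v ⊗[K] E →ₗ[K] v' ⊗[K] E :=
  (ArtAlg.hom ϑ).toLinearMap.rTensor E

@[simp] lemma pushT_tmul {v v' : ArtAlg.{w, u} K} (ϑ : v ⟶ v') (a : v) (x : E) :
    pushT ϑ E (a ⊗ₜ x) = ArtAlg.hom ϑ a ⊗ₜ[K] x := rfl

lemma pushT_smul {v v' : ArtAlg.{w, u} K} (ϑ : v ⟶ v') (a : v) (x : v ⊗[K] E) :
    pushT ϑ E (a • x) = ArtAlg.hom ϑ a • pushT ϑ E x := by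
  induction x using TensorProduct.induction_on with
  | zero => simp
  | add x y hx hy => simp only [smul_add, map_add, hx, hy]
  | tmul b x => simp [TensorProduct.smul_tmul']

lemma evT_pushT {v v' : ArtAlg.{w, u} K} (ϑ : v ⟶ v') (x : v ⊗[K] E) :
    evT v' E (pushT ϑ E x) = evT v E x := by
  induction x using TensorProduct.induction_on with
  | zero => simp
  | add x y hx hy => simp only [map_add, hx, hy]
  | tmul b x => simp [ArtAlg.ev_hom]

lemma pushT_ext₂ {v v' : ArtAlg.{w, u} K} (ϑ : v ⟶ v') (β : E →ₗ[K] F →ₗ[K] G)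
    (x : v ⊗[K] E) (y : v ⊗[K] F) :
    pushT ϑ G (ext₂ v β x y) = ext₂ v' β (pushT ϑ E x) (pushT ϑ F y) := by
  induction x using TensorProduct.induction_on with
  | zero => simp
  | add x y hx hy => simp only [map_add, LinearMap.add_apply, hx, hy]
  | tmul a x =>
    induction y using TensorProduct.induction_on with
    | zero => simp
    | add x y hx hy => simp only [map_add, hx, hy]
    | tmul b y => simp

@[simp] lemma pushT_id (v : ArtAlg.{w, u} K) (x : v ⊗[K] E) : pushT (𝟙 v) E x = x :=
  LinearMap.congr_fun (LinearMap.rTensor_id E v) x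

@[simp] lemma pushT_comp {v v' v'' : ArtAlg.{w, u} K} (ϑ : v ⟶ v') (ϑ' : v' ⟶ v'')
    (x : v ⊗[K] E) : pushT (ϑ ≫ ϑ') E x = pushT ϑ' E (pushT ϑ E x) :=
  LinearMap.congr_fun (LinearMap.rTensor_comp E (ArtAlg.hom ϑ').toLinearMap
    (ArtAlg.hom ϑ).toLinearMap) x

/-- Induction principle: `v ⊗ E` is generated by `1 ⊗ E` as a `v`-module. -/
lemma tind {v : ArtAlg.{w, u} K} {C : v ⊗[K] E → Prop} (x : v ⊗[K] E)
    (one : ∀ e, C (1 ⊗ₜ e)) (add : ∀ x y, C x → C y → C (x + y))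
    (smul : ∀ (a : v) x, C x → C (a • x)) : C x := by
  induction x using TensorProduct.induction_on with
  | zero => simpa using smul 0 _ (one 0)
  | add x y hx hy => exact add _ _ hx hy
  | tmul a x => simpa [TensorProduct.smul_tmul'] using smul a _ (one x)

/-- The base change along `ϑ : v → v'` of a `v`-linear map. -/
def pushHom {v v' : ArtAlg.{w, u} K} (ϑ : v ⟶ v') (f : v ⊗[K] E →ₗ[v] v ⊗[K] F) :
    v' ⊗[K] E →ₗ[v'] v' ⊗[K] F :=
  LinearMap.liftBaseChange v' (pushT ϑ F ∘ₗ f.restrictScalars K ∘ₗ TensorProduct.mk K v E 1)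

lemma pushHom_one {v v' : ArtAlg.{w, u} K} (ϑ : v ⟶ v') (f : v ⊗[K] E →ₗ[v] v ⊗[K] F) (x : E) :
    pushHom ϑ f (1 ⊗ₜ x) = pushT ϑ F (f (1 ⊗ₜ x)) := by
  simp [pushHom]

@[simp] lemma pushHom_pushT {v v' : ArtAlg.{w, u} K} (ϑ : v ⟶ v')
    (f : v ⊗[K] E →ₗ[v] v ⊗[K] F) (x : v ⊗[K] E) :
    pushHom ϑ f (pushT ϑ E x) = pushT ϑ F (f x) := by
  induction x using tind with
  | one e => simpa using pushHom_one ϑ f e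
  | add x y hx hy => simp only [map_add, hx, hy]
  | smul a x hx => simp only [pushT_smul, map_smul, hx]

/-- The base change along `ϑ : v → v'` of a `v`-bilinear map. -/
def pushHom₂ {v v' : ArtAlg.{w, u} K} (ϑ : v ⟶ v')
    (f : v ⊗[K] E →ₗ[v] v ⊗[K] F →ₗ[v] v ⊗[K] G) :
    v' ⊗[K] E →ₗ[v'] v' ⊗[K] F →ₗ[v'] v' ⊗[K] G :=
  LinearMap.liftBaseChange v'
    { toFun := fun x => pushHom ϑ (f (1 ⊗ₜ x))
      map_add' := fun x y => by
        refine LinearMap.ext fun z => ?_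
        induction z using tind with
        | one e => simp [pushHom_one, TensorProduct.tmul_add]
        | add x y hx hy => simp only [map_add, hx, hy]
        | smul a x hx => simp only [map_smul, hx]
      map_smul' := fun c x => by
        refine LinearMap.ext fun z => ?_
        induction z using tind with
        | one e =>
          have : f ((1 : v) ⊗ₜ[K] (c • x)) (1 ⊗ₜ e) = c • f ((1 : v) ⊗ₜ[K] x) (1 ⊗ₜ e) := by
            rw [TensorProduct.tmul_smul, ← algebraMap_smul v c ((1 : v) ⊗ₜ[K] x), map_smul,
              LinearMap.smul_apply, algebraMap_smul]
          simp only [pushHom_one, LinearMap.smul_apply, this, map_smul, RingHom.id_apply]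
        | add x y hx hy => simp only [map_add, hx, hy]
        | smul a x hx => simp only [map_smul, hx] }

lemma pushHom₂_one {v v' : ArtAlg.{w, u} K} (ϑ : v ⟶ v')
    (f : v ⊗[K] E →ₗ[v] v ⊗[K] F →ₗ[v] v ⊗[K] G) (x : E) (y : F) :
    pushHom₂ ϑ f (1 ⊗ₜ x) (1 ⊗ₜ y) = pushT ϑ G (f (1 ⊗ₜ x) (1 ⊗ₜ y)) := by
  simp [pushHom₂, pushHom_one]

@[simp] lemma pushHom₂_pushT {v v' : ArtAlg.{w, u} K} (ϑ : v ⟶ v')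
    (f : v ⊗[K] E →ₗ[v] v ⊗[K] F →ₗ[v] v ⊗[K] G) (x : v ⊗[K] E) (y : v ⊗[K] F) :
    pushHom₂ ϑ f (pushT ϑ E x) (pushT ϑ F y) = pushT ϑ G (f x y) := by
  induction x using tind with
  | one e => simp [pushHom₂]
  | add x y hx hy => simp only [map_add, LinearMap.add_apply, hx, hy]
  | smul a x hx => simp only [pushT_smul, map_smul, LinearMap.smul_apply, hx]

/-- Induction principle: `v' ⊗ E` is generated by the image of `v ⊗ E` as a `v'`-module. -/
lemma pind {v v' : ArtAlg.{w, u} K} (ϑ : v ⟶ v') {C : v' ⊗[K] E → Prop} (x : v' ⊗[K] E)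
    (push : ∀ e, C (pushT ϑ E e)) (add : ∀ x y, C x → C y → C (x + y))
    (smul : ∀ (a : v') x, C x → C (a • x)) : C x :=
  tind x (fun e => by simpa using push (1 ⊗ₜ e)) add smul

lemma pushHom_id (v : ArtAlg.{w, u} K) (f : v ⊗[K] E →ₗ[v] v ⊗[K] F) :
    pushHom (𝟙 v) f = f :=
  LinearMap.ext fun x => by simpa using pushHom_pushT (𝟙 v) f x

lemma pushHom_comp {v v' v'' : ArtAlg.{w, u} K} (ϑ : v ⟶ v') (ϑ' : v' ⟶ v'')
    (f : v ⊗[K] E →ₗ[v] v ⊗[K] F) : pushHom (ϑ ≫ ϑ') f = pushHom ϑ' (pushHom ϑ f) := by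
  refine LinearMap.ext fun x => ?_
  induction x using pind (ϑ ≫ ϑ') with
  | push e => rw [pushHom_pushT]; simp
  | add x y hx hy => simp only [map_add, hx, hy]
  | smul a x hx => simp only [map_smul, hx]

lemma pushHom₂_id (v : ArtAlg.{w, u} K) (f : v ⊗[K] E →ₗ[v] v ⊗[K] F →ₗ[v] v ⊗[K] G) :
    pushHom₂ (𝟙 v) f = f :=
  LinearMap.ext fun x => LinearMap.ext fun y => by simpa using pushHom₂_pushT (𝟙 v) f x y

lemma pushHom₂_comp {v v' v'' : ArtAlg.{w, u} K} (ϑ : v ⟶ v') (ϑ' : v' ⟶ v'')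
    (f : v ⊗[K] E →ₗ[v] v ⊗[K] F →ₗ[v] v ⊗[K] G) :
    pushHom₂ (ϑ ≫ ϑ') f = pushHom₂ ϑ' (pushHom₂ ϑ f) := by
  refine LinearMap.ext fun x => LinearMap.ext fun y => ?_
  induction x using pind (ϑ ≫ ϑ') with
  | push e =>
    induction y using pind (ϑ ≫ ϑ') with
    | push e => rw [pushHom₂_pushT]; simp
    | add x y hx hy => simp only [map_add, hx, hy]
    | smul a x hx => simp only [map_smul, hx]
  | add x y hx hy => simp only [map_add, LinearMap.add_apply, hx, hy]
  | smul a x hx => simp only [map_smul, LinearMap.smul_apply, hx]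

end Tensor

variable (R : Type u) [CommRing R] [Algebra K R]

/-- The action of `C^∞(M_v) = v ⊗ R` on `Γ(E_v) = v ⊗ E`. -/
def smulT (v : ArtAlg.{w, u} K) (E : Type u) [AddCommGroup E] [Module K E] [Module R E]
    [IsScalarTower K R E] : v ⊗[K] R →ₗ[v] v ⊗[K] E →ₗ[v] v ⊗[K] E :=
  ext₂ v (Algebra.lsmul K K E).toLinearMap

/-- The pairing `⟨D, f⟩` of `D ∈ Γ(T_v) = v ⊗ Γ(T)` and `f ∈ C^∞(M_v) = v ⊗ R`. -/
def pair (v : ArtAlg.{w, u} K) :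
    v ⊗[K] Derivation K R R →ₗ[v] v ⊗[K] R →ₗ[v] v ⊗[K] R :=
  ext₂ v
    { toFun := fun D => (D : R →ₗ[K] R)
      map_add' := fun _ _ => rfl
      map_smul' := fun _ _ => rfl }

variable {E F : Type u} [AddCommGroup E] [Module K E] [Module R E] [IsScalarTower K R E]
  [AddCommGroup F] [Module K F] [Module R F] [IsScalarTower K R F]

/-- The structure of a `v`-ringed Lie algebroid on the `v`-ringed vector bundle `E_v`. -/
@[ext]
structure RingedStr (v : ArtAlg.{w, u} K) (E : Type u) [AddCommGroup E] [Module K E] [Module R E]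
    [IsScalarTower K R E] where
  bracket : v ⊗[K] E →ₗ[v] v ⊗[K] E →ₗ[v] v ⊗[K] E
  anchor : v ⊗[K] E →ₗ[v] v ⊗[K] Derivation K R R
  anchor_smul : ∀ (f : v ⊗[K] R) x,
    anchor (smulT R v E f x) = smulT R v (Derivation K R R) f (anchor x)
  skew : ∀ x y, bracket x y = -bracket y x
  jacobi : ∀ x y z, bracket x (bracket y z) = bracket (bracket x y) z + bracket y (bracket x z)
  leibniz : ∀ x (f : v ⊗[K] R) y, bracket x (smulT R v E f y) =
    smulT R v E (pair R v (anchor x) f) y + smulT R v E f (bracket x y)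

variable {R}

/-- The `v`-Cartesian extension of a Lie algebroid. -/
def LieAlgebroidStr.cartesian (S : LieAlgebroidStr K R E) (v : ArtAlg.{w, u} K) :
    RingedStr R v E where
  bracket := ext₂ v S.bracket
  anchor := (S.anchor.restrictScalars K).baseChange v
  anchor_smul f x := by
    induction f using tind with
    | one f =>
      induction x using tind with
      | one x => simp [smulT]
      | add x y hx hy => simp only [map_add, hx, hy]
      | smul a x hx => simp only [map_smul, hx]
    | add x y hx hy => simp only [map_add, LinearMap.add_apply, hx, hy]
    | smul a x hx => simp only [map_smul, LinearMap.smul_apply, hx]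
  skew x y := by
    induction x using tind with
    | one x =>
      induction y using tind with
      | one y => simp [S.skew x y, TensorProduct.tmul_neg]
      | add x y hx hy => simp only [map_add, LinearMap.add_apply, hx, hy, neg_add]
      | smul a x hx => simp only [map_smul, LinearMap.smul_apply, hx, smul_neg]
    | add x y hx hy => simp only [map_add, LinearMap.add_apply, hx, hy, neg_add]
    | smul a x hx => simp only [map_smul, LinearMap.smul_apply, hx, smul_neg]
  jacobi x y z := by
    induction x using tind with
    | one x =>
      induction y using tind with
      | one y =>
        induction z using tind with
        | one z => simp [S.jacobi x y z, TensorProduct.tmul_add]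
        | add x y hx hy => simp only [map_add, hx, hy]; abel
        | smul a x hx => simp only [map_smul, hx, smul_add]
      | add x y hx hy => simp only [map_add, LinearMap.add_apply, hx, hy]; abel
      | smul a x hx => simp only [map_smul, LinearMap.smul_apply, hx, smul_add]
    | add x y hx hy => simp only [map_add, LinearMap.add_apply, hx, hy]; abel
    | smul a x hx => simp only [map_smul, LinearMap.smul_apply, hx, smul_add]
  leibniz x f y := by
    induction x using tind with
    | one x =>
      induction f using tind with
      | one f =>
        induction y using tind with
        | one y => simp [smulT, pair, S.leibniz, TensorProduct.tmul_add]
        | add x y hx hy => simp only [map_add, hx, hy]; abel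
        | smul a x hx => simp only [map_smul, hx, smul_add]
      | add x y hx hy => simp only [map_add, LinearMap.add_apply, hx, hy]; abel
      | smul a x hx => simp only [map_smul, LinearMap.smul_apply, hx, smul_add]
    | add x y hx hy => simp only [map_add, LinearMap.add_apply, hx, hy]; abel
    | smul a x hx => simp only [map_smul, LinearMap.smul_apply, hx, smul_add]

/-- The base change along `ϑ : v → v'` of a `v`-ringed Lie algebroid structure. -/
def RingedStr.push {v v' : ArtAlg.{w, u} K} (ϑ : v ⟶ v') (S : RingedStr R v E) :
    RingedStr R v' E where
  bracket := pushHom₂ ϑ S.bracket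
  anchor := pushHom ϑ S.anchor
  anchor_smul f x := by
    induction f using pind (E := R) ϑ with
    | push f =>
      induction x using pind ϑ with
      | push x =>
        have h := congrArg (pushT ϑ _) (S.anchor_smul f x)
        simpa only [smulT, ← pushT_ext₂, pushHom_pushT] using h
      | add x y hx hy => simp only [map_add, hx, hy]
      | smul a x hx => simp only [map_smul, hx]
    | add x y hx hy => simp only [map_add, LinearMap.add_apply, hx, hy]
    | smul a x hx => simp only [map_smul, LinearMap.smul_apply, hx]
  skew x y := by
    induction x using pind ϑ with
    | push x =>
      induction y using pind ϑ with
      | push y => rw [pushHom₂_pushT, pushHom₂_pushT, S.skew x y, map_neg]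
      | add x y hx hy => simp only [map_add, LinearMap.add_apply, hx, hy, neg_add]
      | smul a x hx => simp only [map_smul, LinearMap.smul_apply, hx, smul_neg]
    | add x y hx hy => simp only [map_add, LinearMap.add_apply, hx, hy, neg_add]
    | smul a x hx => simp only [map_smul, LinearMap.smul_apply, hx, smul_neg]
  jacobi x y z := by
    induction x using pind ϑ with
    | push x =>
      induction y using pind ϑ with
      | push y =>
        induction z using pind ϑ with
        | push z => simp only [pushHom₂_pushT, ← map_add, S.jacobi x y z]
        | add x y hx hy => simp only [map_add, hx, hy]; abel
        | smul a x hx => simp only [map_smul, hx, smul_add]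
      | add x y hx hy => simp only [map_add, LinearMap.add_apply, hx, hy]; abel
      | smul a x hx => simp only [map_smul, LinearMap.smul_apply, hx, smul_add]
    | add x y hx hy => simp only [map_add, LinearMap.add_apply, hx, hy]; abel
    | smul a x hx => simp only [map_smul, LinearMap.smul_apply, hx, smul_add]
  leibniz x f y := by
    induction x using pind ϑ with
    | push x =>
      induction f using pind (E := R) ϑ with
      | push f =>
        induction y using pind ϑ with
        | push y =>
          have h := congrArg (pushT ϑ _) (S.leibniz x f y)
          simpa only [smulT, pair, map_add, ← pushT_ext₂, pushHom_pushT, pushHom₂_pushT] using h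
        | add x y hx hy => simp only [map_add, hx, hy]; abel
        | smul a x hx => simp only [map_smul, hx, smul_add]
      | add x y hx hy => simp only [map_add, LinearMap.add_apply, hx, hy]; abel
      | smul a x hx => simp only [map_smul, LinearMap.smul_apply, hx, smul_add]
    | add x y hx hy => simp only [map_add, LinearMap.add_apply, hx, hy]; abel
    | smul a x hx => simp only [map_smul, LinearMap.smul_apply, hx, smul_add]

lemma cartesian_push {v v' : ArtAlg.{w, u} K} (ϑ : v ⟶ v') (S : LieAlgebroidStr K R E) :
    (S.cartesian v).push ϑ = S.cartesian v' := by
  ext x y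
  · simp [RingedStr.push, LieAlgebroidStr.cartesian, pushHom₂_one]
  · simp [RingedStr.push, LieAlgebroidStr.cartesian, pushHom_one]

/-- `(Π, λ)` is a morphism of `v`-ringed Lie algebroids from `F_v` to `E_v`, over the same
`v`-ringed manifold.  (The center of `Π` is `R`-linear by the second and third conditions, so that it
is a morphism of vector bundles.) -/
structure IsRingedMor {v : ArtAlg.{w, u} K} (S : RingedStr R v F) (T : RingedStr R v E)
    (φ : v ⊗[K] F →ₗ[v] v ⊗[K] E) (lam : v ⊗[K] R →ₐ[v] v ⊗[K] R) : Prop where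
  map_bracket : ∀ x y, φ (S.bracket x y) = T.bracket (φ x) (φ y)
  base_small : ∀ f : R, evT v R (lam (1 ⊗ₜ f)) = f
  map_smul : ∀ f x, φ (smulT R v F f x) = smulT R v E (lam f) (φ x)
  map_anchor : ∀ x f, lam (pair R v (S.anchor x) f) = pair R v (T.anchor (φ x)) (lam f)

/-- The base change along `ϑ : v → v'` of an endomorphism of the `v`-algebra `C^∞(M_v)`. -/
def pushAlg {v v' : ArtAlg.{w, u} K} (ϑ : v ⟶ v') (lam : v ⊗[K] R →ₐ[v] v ⊗[K] R) :
    v' ⊗[K] R →ₐ[v'] v' ⊗[K] R :=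
  AlgHom.ofLinearMap (pushHom ϑ lam.toLinearMap)
    (by
      rw [Algebra.TensorProduct.one_def, pushHom_one, ← Algebra.TensorProduct.one_def,
        AlgHom.toLinearMap_apply, map_one]
      simp [Algebra.TensorProduct.one_def])
    (fun f g => by
      have key : ∀ (x y : v ⊗[K] R), pushT ϑ R (x * y) = pushT ϑ R x * pushT ϑ R y :=
        fun x y => map_mul (Algebra.TensorProduct.map (ArtAlg.hom ϑ) (AlgHom.id K R)) x y
      induction f using pind (E := R) ϑ with
      | push f =>
        induction g using pind (E := R) ϑ with
        | push g =>
          simp only [← key, pushHom_pushT, AlgHom.toLinearMap_apply, map_mul]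
        | add x y hx hy => simp only [mul_add, map_add, hx, hy]
        | smul a x hx => simp only [mul_smul_comm, map_smul, hx]
      | add x y hx hy => simp only [add_mul, map_add, hx, hy]
      | smul a x hx => simp only [smul_mul_assoc, map_smul, hx])

@[simp] lemma pushAlg_pushT {v v' : ArtAlg.{w, u} K} (ϑ : v ⟶ v')
    (lam : v ⊗[K] R →ₐ[v] v ⊗[K] R) (f : v ⊗[K] R) :
    pushAlg ϑ lam (pushT ϑ R f) = pushT ϑ R (lam f) :=
  pushHom_pushT ϑ lam.toLinearMap f

lemma pushAlg_one {v v' : ArtAlg.{w, u} K} (ϑ : v ⟶ v')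
    (lam : v ⊗[K] R →ₐ[v] v ⊗[K] R) (f : R) :
    pushAlg ϑ lam (1 ⊗ₜ f) = pushT ϑ R (lam (1 ⊗ₜ f)) :=
  pushHom_one ϑ lam.toLinearMap f

lemma IsRingedMor.push {v v' : ArtAlg.{w, u} K} (ϑ : v ⟶ v') {S : RingedStr R v F}
    {T : RingedStr R v E} {φ : v ⊗[K] F →ₗ[v] v ⊗[K] E} {lam : v ⊗[K] R →ₐ[v] v ⊗[K] R}
    (h : IsRingedMor S T φ lam) :
    IsRingedMor (S.push ϑ) (T.push ϑ) (pushHom ϑ φ) (pushAlg ϑ lam) where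
  map_bracket x y := by
    induction x using pind ϑ with
    | push x =>
      induction y using pind ϑ with
      | push y => simp only [RingedStr.push, pushHom₂_pushT, pushHom_pushT, h.map_bracket]
      | add x y hx hy => simp only [map_add, hx, hy]
      | smul a x hx => simp only [_root_.map_smul, hx]
    | add x y hx hy => simp only [map_add, LinearMap.add_apply, hx, hy]
    | smul a x hx => simp only [_root_.map_smul, LinearMap.smul_apply, hx]
  base_small f := by rw [pushAlg_one, evT_pushT, h.base_small]
  map_smul f x := by
    induction f using pind (E := R) ϑ with
    | push f =>
      induction x using pind ϑ with
      | push x =>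
        have h := congrArg (pushT ϑ _) (h.map_smul f x)
        simpa only [smulT, ← pushT_ext₂, pushHom_pushT, pushAlg_pushT] using h
      | add x y hx hy => simp only [map_add, hx, hy]
      | smul a x hx => simp only [_root_.map_smul, hx]
    | add x y hx hy => simp only [map_add, LinearMap.add_apply, hx, hy]
    | smul a x hx => simp only [_root_.map_smul, LinearMap.smul_apply, hx]
  map_anchor x f := by
    induction x using pind ϑ with
    | push x =>
      induction f using pind (E := R) ϑ with
      | push f =>
        have h := congrArg (pushT ϑ _) (h.map_anchor x f)
        simpa only [pair, RingedStr.push, ← pushT_ext₂, pushHom_pushT, pushAlg_pushT] using h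
      | add x y hx hy => simp only [map_add, hx, hy]
      | smul a x hx => simp only [_root_.map_smul, hx]
    | add x y hx hy => simp only [map_add, LinearMap.add_apply, hx, hy]
    | smul a x hx => simp only [_root_.map_smul, LinearMap.smul_apply, hx]

end Ringed

/-! ### Infinitesimal deformations and the semistrict deformation functor -/

section Deformations

variable {K : Type w} [Field K] {R : Type u} [CommRing R] [Algebra K R]
  {A L : Type u} [AddCommGroup A] [Module K A] [Module R A] [IsScalarTower K R A]
  [AddCommGroup L] [Module K L] [Module R L] [IsScalarTower K R L]

/-- An infinitesimal deformation of a Lie pair `(L, A)` parameterized by `v`: a `v`-ringed Lie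
algebroid structure on `A_v` with center `A`, and a morphism `(I, λ)` from it to the `v`-Cartesian
extension of `L`, with center the inclusion `A ↪ L`. -/
@[ext]
structure InfDef (P : LiePair K R A L) (v : ArtAlg.{w, u} K) where
  str : RingedStr R v A
  I : v ⊗[K] A →ₗ[v] v ⊗[K] L
  lam : v ⊗[K] R →ₐ[v] v ⊗[K] R
  center_bracket : ∀ a b : A, evT v A (str.bracket (1 ⊗ₜ a) (1 ⊗ₜ b)) = P.algA.bracket a b
  center_anchor : ∀ a : A, evT v (Derivation K R R) (str.anchor (1 ⊗ₜ a)) = P.algA.anchor a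
  isMor : IsRingedMor str (P.algL.cartesian v) I lam
  center_I : ∀ a : A, evT v L (I (1 ⊗ₜ a)) = P.incl a

/-- The partial sum `∑_{k < N} T^k / k!`, which is `exp T` as soon as `T ^ N = 0`. -/
def expSum {v : ArtAlg.{w, u} K} {E : Type u} [AddCommGroup E] [Module K E]
    (T : Module.End v (v ⊗[K] E)) (N : ℕ) : Module.End v (v ⊗[K] E) :=
  ∑ k ∈ Finset.range N, algebraMap K v (k.factorial : K)⁻¹ • T ^ k

/-- The inclusion `𝔪 ⊗ E → v ⊗ E`. -/
def inclMax (v : ArtAlg.{w, u} K) (E : Type u) [AddCommGroup E] [Module K E] :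
    v.maxIdeal ⊗[K] E →ₗ[K] v ⊗[K] E :=
  v.maxIdeal.subtype.rTensor E

/-- `(Φ, φ)` is a small inner automorphism of the Cartesian extension `L_v`: one has `Φ = exp(Δ)`
and `φ = exp(σ(Δ))` for the nilpotent inner derivation `Δ = [u, -]`, with symbol `σ(Δ) = ρ(u)`, of
some `u ∈ Γ(L) ⊗ 𝔪`. -/
def IsSmallInnerAut (P : LiePair K R A L) (v : ArtAlg.{w, u} K)
    (Φ : Module.End v (v ⊗[K] L)) (φ : Module.End v (v ⊗[K] R)) : Prop :=
  ∃ (u : v.maxIdeal ⊗[K] L) (N : ℕ),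
    (P.algL.cartesian v).bracket (inclMax v L u) ^ N = 0 ∧
    pair R v ((P.algL.cartesian v).anchor (inclMax v L u)) ^ N = 0 ∧
    Φ = expSum ((P.algL.cartesian v).bracket (inclMax v L u)) N ∧
    φ = expSum (pair R v ((P.algL.cartesian v).anchor (inclMax v L u))) N

/-- Two infinitesimal deformations `D = (I, λ)` and `D' = (I', λ')` are semistrict isomorphic if
`(Φ, φ) ∘ (I', λ') = (I, λ) ∘ (Π, μ)` for a small inner automorphism `(Φ, φ)` of `L_v` and a
morphism `(Π, μ)` of `v`-ringed Lie algebroids from `A_v` with the structure of `D'` to `A_v` with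
the structure of `D`. -/
def SemistrictIso {P : LiePair K R A L} {v : ArtAlg.{w, u} K} (D D' : InfDef P v) : Prop :=
  ∃ (Φ : Module.End v (v ⊗[K] L)) (φ : Module.End v (v ⊗[K] R))
    (Pi : v ⊗[K] A →ₗ[v] v ⊗[K] A) (mu : v ⊗[K] R →ₐ[v] v ⊗[K] R),
    IsSmallInnerAut P v Φ φ ∧ IsRingedMor D'.str D.str Pi mu ∧
    (∀ a, Φ (D'.I a) = D.I (Pi a)) ∧ (∀ f, φ (D'.lam f) = D.lam (mu f))

variable {P : LiePair K R A L}

/-- The base change of an infinitesimal deformation along `ϑ : v → v'`. -/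
def InfDef.push {v v' : ArtAlg.{w, u} K} (ϑ : v ⟶ v') (D : InfDef P v) : InfDef P v' where
  str := D.str.push ϑ
  I := pushHom ϑ D.I
  lam := pushAlg ϑ D.lam
  center_bracket a b := by
    rw [RingedStr.push, pushHom₂_one, evT_pushT, D.center_bracket]
  center_anchor a := by
    rw [RingedStr.push, pushHom_one, evT_pushT, D.center_anchor]
  isMor := by
    have h := D.isMor.push ϑ
    rwa [cartesian_push] at h
  center_I a := by rw [pushHom_one, evT_pushT, D.center_I]

lemma pushHom_pow {v v' : ArtAlg.{w, u} K} (ϑ : v ⟶ v') {E : Type u} [AddCommGroup E] [Module K E]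
    (T : Module.End v (v ⊗[K] E)) (k : ℕ) (x : v ⊗[K] E) :
    (pushHom ϑ T ^ k : Module.End v' (v' ⊗[K] E)) (pushT ϑ E x) = pushT ϑ E ((T ^ k) x) := by
  induction k generalizing x with
  | zero => simp
  | succ k ih => rw [pow_succ, pow_succ, Module.End.mul_apply, Module.End.mul_apply,
      pushHom_pushT, ih]

lemma pushHom_pow_eq_zero {v v' : ArtAlg.{w, u} K} (ϑ : v ⟶ v') {E : Type u} [AddCommGroup E]
    [Module K E] (T : Module.End v (v ⊗[K] E)) (k : ℕ) (h : T ^ k = 0) :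
    (pushHom ϑ T ^ k : Module.End v' (v' ⊗[K] E)) = 0 := by
  refine LinearMap.ext fun x => ?_
  induction x using pind ϑ with
  | push e => rw [pushHom_pow, h]; simp
  | add x y hx hy => simp only [map_add, hx, hy]
  | smul a x hx => simp only [map_smul, hx]

lemma pushHom_expSum {v v' : ArtAlg.{w, u} K} (ϑ : v ⟶ v') {E : Type u} [AddCommGroup E]
    [Module K E] (T : Module.End v (v ⊗[K] E)) (N : ℕ) :
    pushHom ϑ (expSum T N) = expSum (pushHom ϑ T) N := by
  refine LinearMap.ext fun x => ?_
  induction x using pind ϑ with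
  | push e =>
    simp only [pushHom_pushT, expSum, LinearMap.sum_apply, LinearMap.smul_apply, map_sum,
      pushT_smul, pushHom_pow, AlgHom.commutes]
  | add x y hx hy => simp only [map_add, hx, hy]
  | smul a x hx => simp only [map_smul, hx]

lemma pushT_inclMax {v v' : ArtAlg.{w, u} K} (ϑ : v ⟶ v') {E : Type u} [AddCommGroup E]
    [Module K E] (x : v.maxIdeal ⊗[K] E) :
    pushT ϑ E (inclMax v E x) = inclMax v' E ((ArtAlg.mapMax ϑ).rTensor E x) := by
  induction x using TensorProduct.induction_on with
  | zero => simp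
  | add x y hx hy => simp only [map_add, hx, hy]
  | tmul b x => simp [inclMax]

lemma IsSmallInnerAut.push {v v' : ArtAlg.{w, u} K} (ϑ : v ⟶ v')
    {Φ : Module.End v (v ⊗[K] L)} {φ : Module.End v (v ⊗[K] R)} (h : IsSmallInnerAut P v Φ φ) :
    IsSmallInnerAut P v' (pushHom ϑ Φ) (pushHom ϑ φ) := by
  obtain ⟨u, N, h1, h2, rfl, rfl⟩ := h
  have e1 : (P.algL.cartesian v').bracket (inclMax v' L ((ArtAlg.mapMax ϑ).rTensor L u)) =
      pushHom ϑ ((P.algL.cartesian v).bracket (inclMax v L u)) := by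
    rw [← cartesian_push ϑ, ← pushT_inclMax]
    refine LinearMap.ext fun x => ?_
    induction x using pind ϑ with
    | push e => rw [RingedStr.push, pushHom₂_pushT, pushHom_pushT]
    | add x y hx hy => simp only [map_add, hx, hy]
    | smul a x hx => simp only [map_smul, hx]
  have e2 : pair R v' ((P.algL.cartesian v').anchor
      (inclMax v' L ((ArtAlg.mapMax ϑ).rTensor L u))) =
      pushHom ϑ (pair R v ((P.algL.cartesian v).anchor (inclMax v L u))) := by
    rw [← cartesian_push ϑ, ← pushT_inclMax]
    refine LinearMap.ext fun x => ?_
    induction x using pind (E := R) ϑ with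
    | push e => rw [RingedStr.push, pushHom_pushT, pushHom_pushT, pair, pair, ← pushT_ext₂]
    | add x y hx hy => simp only [map_add, hx, hy]
    | smul a x hx => simp only [map_smul, hx]
  refine ⟨(ArtAlg.mapMax ϑ).rTensor L u, N, ?_, ?_, ?_, ?_⟩
  · rw [e1]; exact pushHom_pow_eq_zero ϑ _ _ h1
  · rw [e2]; exact pushHom_pow_eq_zero ϑ _ _ h2
  · rw [e1, pushHom_expSum]
  · rw [e2, pushHom_expSum]

lemma SemistrictIso.push {v v' : ArtAlg.{w, u} K} (ϑ : v ⟶ v') {D D' : InfDef P v}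
    (h : SemistrictIso D D') : SemistrictIso (D.push ϑ) (D'.push ϑ) := by
  obtain ⟨Φ, φ, Pi, mu, h1, h2, h3, h4⟩ := h
  refine ⟨pushHom ϑ Φ, pushHom ϑ φ, pushHom ϑ Pi, pushAlg ϑ mu, h1.push ϑ, h2.push ϑ,
    fun a => ?_, fun f => ?_⟩
  · induction a using pind ϑ with
    | push e => simp only [InfDef.push, pushHom_pushT, h3]
    | add x y hx hy => simp only [map_add, hx, hy]
    | smul a x hx => simp only [map_smul, hx]
  · induction f using pind (E := R) ϑ with
    | push e => simp only [InfDef.push, pushHom_pushT, pushAlg_pushT, h4]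
    | add x y hx hy => simp only [map_add, hx, hy]
    | smul a x hx => simp only [map_smul, hx]

lemma InfDef.push_id {v : ArtAlg.{w, u} K} (D : InfDef P v) : D.push (𝟙 v) = D := by
  refine InfDef.ext (RingedStr.ext ?_ ?_) ?_ ?_
  · exact pushHom₂_id v _
  · exact pushHom_id v _
  · exact pushHom_id v _
  · exact AlgHom.ext fun f => LinearMap.congr_fun (pushHom_id v D.lam.toLinearMap) f

lemma InfDef.push_comp {v v' v'' : ArtAlg.{w, u} K} (ϑ : v ⟶ v') (ϑ' : v' ⟶ v'')
    (D : InfDef P v) : D.push (ϑ ≫ ϑ') = (D.push ϑ).push ϑ' := by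
  refine InfDef.ext (RingedStr.ext ?_ ?_) ?_ ?_
  · exact pushHom₂_comp ϑ ϑ' _
  · exact pushHom_comp ϑ ϑ' _
  · exact pushHom_comp ϑ ϑ' _
  · exact AlgHom.ext fun f => LinearMap.congr_fun (pushHom_comp ϑ ϑ' D.lam.toLinearMap) f

/-- The semistrict deformation functor of a Lie pair: it sends `v` to the set of semistrict
isomorphism classes of infinitesimal deformations parameterized by `v`, and `ϑ : v → v'` to the map
induced by the base change along `ϑ`. -/
def sDef (P : LiePair K R A L) : ArtAlg.{w, u} K ⥤ Type u where
  obj v := Quot (SemistrictIso (P := P) (v := v))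
  map {_ _} ϑ := ↾(Quot.map (InfDef.push ϑ) fun _ _ h => h.push ϑ)
  map_id v := by
    ext x
    obtain ⟨D, rfl⟩ := Quot.exists_rep x
    exact congrArg (Quot.mk _) D.push_id
  map_comp f h := by
    ext x
    obtain ⟨D, rfl⟩ := Quot.exists_rep x
    exact congrArg (Quot.mk _) (D.push_comp f h)

end Deformations

/-! ### The cubic `L∞`-algebra `𝔥₀` -/

section Brackets

variable {K : Type w} [Field K] {R : Type u} [CommRing R] [Algebra K R]
  {A L : Type u} [AddCommGroup A] [Module K A] [Module R A] [IsScalarTower K R A]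
  [AddCommGroup L] [Module K L] [Module R L] [IsScalarTower K R L]

/-- The module of sections of the quotient bundle `B = L / A`. -/
abbrev LiePair.B (P : LiePair K R A L) : Type u := L ⧸ LinearMap.range P.incl

/-- A splitting of the short exact sequence `0 → A → L → B → 0` of vector bundles. -/
structure Splitting (P : LiePair K R A L) where
  j : P.B →ₗ[R] L
  mkQ_j : ∀ b, (LinearMap.range P.incl).mkQ (j b) = b

/-- `Ω_A^p(B) = Γ(Λ^p A^* ⊗ B)`: alternating `R`-multilinear maps on sections. -/
abbrev Form (P : LiePair K R A L) (p : ℕ) : Type u := A [⋀^Fin p]→ₗ[R] P.B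

variable (P : LiePair K R A L)

/-- The projection `pr_B : L → B`. -/
def prB : L →ₗ[R] P.B := (LinearMap.range P.incl).mkQ

variable {P} (j : Splitting P)

lemma sub_j_mem (l : L) : l - j.j (prB P l) ∈ LinearMap.range P.incl :=
  (Submodule.Quotient.mk_eq_zero _).1 (by
    rw [← Submodule.mkQ_apply, map_sub, j.mkQ_j]; exact sub_self _)

/-- The projection `pr_A : L → A` determined by the splitting: `l = i (pr_A l) + j (pr_B l)`. -/
def prA : L →ₗ[R] A :=
  (LinearEquiv.ofInjective P.incl P.incl_injective).symm.toLinearMap ∘ₗ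
    LinearMap.codRestrict (LinearMap.range P.incl) (LinearMap.id - j.j ∘ₗ prB P)
      (sub_j_mem j)

lemma incl_prA (l : L) : P.incl (prA j l) = l - j.j (prB P l) := by
  have := LinearEquiv.apply_symm_apply (LinearEquiv.ofInjective P.incl P.incl_injective)
    (LinearMap.codRestrict (LinearMap.range P.incl) (LinearMap.id - j.j ∘ₗ prB P)
      (sub_j_mem j) l)
  exact congrArg Subtype.val this

@[simp] lemma prB_j (b : P.B) : prB P (j.j b) = b := j.mkQ_j b

@[simp] lemma prB_incl (a : A) : prB P (P.incl a) = 0 := by simp [prB]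

@[simp] lemma prA_j (b : P.B) : prA j (j.j b) = 0 :=
  P.incl_injective (by simp [incl_prA])

@[simp] lemma prA_incl (a : A) : prA j (P.incl a) = a :=
  P.incl_injective (by simp [incl_prA])

variable (P)

/-- The space of derivations of the Lie algebroid `L`: the `K`-linear operators `δ` on `Γ(L)` that
have a symbol `σ`. -/
def der : Submodule K (Module.End K L) where
  carrier := {δ | (∃ σ : Derivation K R R, (∀ (f : R) x, δ (f • x) = σ f • x + f • δ x) ∧
      ∀ x, ⁅σ, P.algL.anchor x⁆ = P.algL.anchor (δ x)) ∧
    ∀ x y, δ (P.algL.bracket x y) = P.algL.bracket (δ x) y + P.algL.bracket x (δ y)}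
  add_mem' := by
    rintro δ δ' ⟨⟨σ, h1, h2⟩, h3⟩ ⟨⟨σ', h1', h2'⟩, h3'⟩
    refine ⟨⟨σ + σ', fun f x => ?_, fun x => ?_⟩, fun x y => ?_⟩
    · simp only [LinearMap.add_apply, h1, h1', Derivation.add_apply, add_smul, smul_add]; abel
    · simp only [add_lie, h2, h2', LinearMap.add_apply, map_add]
    · simp only [LinearMap.add_apply, h3, h3', map_add]; abel
  zero_mem' := ⟨⟨0, by simp, by simp⟩, by simp⟩
  smul_mem' := by
    rintro c δ ⟨⟨σ, h1, h2⟩, h3⟩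
    refine ⟨⟨c • σ, fun f x => ?_, fun x => ?_⟩, fun x y => ?_⟩
    · simp only [LinearMap.smul_apply, h1, Derivation.smul_apply, smul_add, smul_assoc]
      rw [smul_comm c f]
    · rw [smul_lie, h2, LinearMap.smul_apply, LinearMap.map_smul_of_tower]
    · simp only [LinearMap.smul_apply, h3, map_smul, smul_add]

/-- The space of inner derivations `ad_u = [u, -]` of `L`. -/
def ider : Submodule K (Module.End K L) := LinearMap.range P.algL.bracket

lemma ider_le_der : ider P ≤ der P := by
  rintro _ ⟨u, rfl⟩
  exact ⟨⟨P.algL.anchor u, fun f x => P.algL.leibniz u f x,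
    fun x => (P.algL.anchor_bracket u x).symm⟩, fun x y => P.algL.jacobi u x y⟩

/-- The inner derivation `ad_u`, as a derivation. -/
def ad : L →ₗ[K] der P :=
  LinearMap.codRestrict (der P) P.algL.bracket fun u => ider_le_der P ⟨u, rfl⟩

@[simp] lemma ad_apply (u x : L) : (ad P u : Module.End K L) x = P.algL.bracket u x := rfl

variable {P}

/-- `[δ]₁ ∈ Ω_A^1(B)`, `[δ]₁(a) = - pr_B (δ a)`. -/
def derB1 : der P →ₗ[K] Form P 1 where
  toFun δ := AlternatingMap.ofSubsingleton R A P.B (0 : Fin 1)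
    { toFun := fun a => -prB P ((δ : Module.End K L) (P.incl a))
      map_add' := fun a b => by simp only [map_add, neg_add]
      map_smul' := fun f a => by
        obtain ⟨σ, h, -⟩ := δ.2.1
        simp [h] }
  map_add' δ δ' := by
    refine AlternatingMap.ext fun a => ?_
    change -prB P ((δ : Module.End K L) (P.incl (a 0)) + (δ' : Module.End K L) (P.incl (a 0))) =
      -prB P ((δ : Module.End K L) (P.incl (a 0))) + -prB P ((δ' : Module.End K L) (P.incl (a 0)))
    rw [map_add, neg_add]
  map_smul' c δ := by
    refine AlternatingMap.ext fun a => ?_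
    change -prB P (c • (δ : Module.End K L) (P.incl (a 0))) =
      c • -prB P ((δ : Module.End K L) (P.incl (a 0)))
    rw [LinearMap.map_smul_of_tower, smul_neg]

/-- `X(a₁, …, φ aᵢ, …, aₚ)` summed over `i`, as a multilinear map. -/
def slotSum {p : ℕ} (φ : A →ₗ[K] A) (X : Form P p) :
    MultilinearMap K (fun _ : Fin p => A) P.B :=
  ∑ i, (X.toMultilinearMap.restrictScalars K).compLinearMap
    (Function.update (fun _ => LinearMap.id) i φ)

lemma slotSum_apply {p : ℕ} (φ : A →ₗ[K] A) (X : Form P p) (a : Fin p → A) :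
    slotSum φ X a = ∑ i, X (Function.update a i (φ (a i))) := by
  simp only [slotSum, sum_apply, MultilinearMap.compLinearMap_apply]
  refine Finset.sum_congr rfl fun i _ => congrArg X (funext fun k => ?_)
  by_cases h : k = i
  · subst h; simp
  · simp [Function.update_of_ne h]

lemma slotSum_eq_zero {p : ℕ} (φ : A →ₗ[K] A) (X : Form P p) (a : Fin p → A) {k l : Fin p}
    (hkl : a k = a l) (hne : k ≠ l) : slotSum φ X a = 0 := by
  rw [slotSum_apply, ← Finset.add_sum_erase _ _ (Finset.mem_univ k),
    ← Finset.add_sum_erase _ _ (Finset.mem_erase.2 ⟨hne.symm, Finset.mem_univ l⟩), ← add_assoc]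
  have h1 : ∑ x ∈ (Finset.univ.erase k).erase l, X (Function.update a x (φ (a x))) = 0 := by
    refine Finset.sum_eq_zero fun i hi => ?_
    simp only [Finset.mem_erase, Finset.mem_univ, and_true] at hi
    refine X.map_eq_zero_of_eq _ ?_ hne
    rw [Function.update_of_ne hi.2.symm, Function.update_of_ne hi.1.symm, hkl]
  have h2 : Function.update a l (φ (a l)) =
      Function.update a k (φ (a k)) ∘ Equiv.swap k l := by
    funext m
    simp only [Function.comp_apply]
    by_cases hk : m = k
    · subst hk
      rw [Equiv.swap_apply_left, Function.update_of_ne hne, Function.update_of_ne hne.symm, hkl]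
    · by_cases hl : m = l
      · subst hl
        rw [Equiv.swap_apply_right, Function.update_self, Function.update_self, hkl]
      · rw [Equiv.swap_apply_of_ne_of_ne hk hl, Function.update_of_ne hl, Function.update_of_ne hk]
  rw [h1, add_zero, h2, X.map_swap _ hne, add_neg_cancel]

lemma slotSum_update_smul {p : ℕ} (φ : A →ₗ[K] A) (X : Form P p) (a : Fin p → A) (k : Fin p)
    (f g : R) (x : A) (h : φ (f • x) = g • x + f • φ x) :
    slotSum φ X (Function.update a k (f • x)) =
      f • slotSum φ X (Function.update a k x) + g • X (Function.update a k x) := by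
  rw [slotSum_apply, slotSum_apply, ← Finset.add_sum_erase _ _ (Finset.mem_univ k),
    ← Finset.add_sum_erase Finset.univ (fun i => X (Function.update (Function.update a k x) i
      (φ (Function.update a k x i)))) (Finset.mem_univ k)]
  simp only [Function.update_self, Function.update_idem, h, X.map_update_add, X.map_update_smul]
  rw [smul_add, Finset.smul_sum]
  have : ∑ i ∈ Finset.univ.erase k, X (Function.update (Function.update a k (f • x)) i
        (φ (Function.update a k (f • x) i))) =
      ∑ i ∈ Finset.univ.erase k, f • X (Function.update (Function.update a k x) i
        (φ (Function.update a k x i))) := by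
    refine Finset.sum_congr rfl fun i hi => ?_
    have hi : i ≠ k := (Finset.mem_erase.1 hi).1
    rw [Function.update_of_ne hi, Function.update_of_ne hi, Function.update_comm hi.symm,
      Function.update_comm hi.symm, X.map_update_smul]
  rw [this]; abel

/-- The action of derivations of `L` on `Ω_A^p(B)`:
`[δ, X]₂(a₁, …, aₚ) = pr_B δ j X(a₁, …, aₚ) - ∑ᵢ X(a₁, …, pr_A δ aᵢ, …, aₚ)`. -/
def derAct (p : ℕ) : der P →ₗ[K] Form P p →ₗ[K] Form P p :=
  LinearMap.mk₂ K
    (fun δ X =>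
      { toFun := fun a => prB P ((δ : Module.End K L) (j.j (X a))) -
          ∑ i, X (Function.update a i (prA j ((δ : Module.End K L) (P.incl (a i)))))
        map_update_add' := fun {dec} a k x y => by
          have e : dec = instDecidableEqFin p := Subsingleton.elim _ _
          subst e
          have h := slotSum_apply ((prA j).restrictScalars K ∘ₗ (δ : Module.End K L) ∘ₗ
            P.incl.restrictScalars K) X
          simp only [LinearMap.comp_apply, LinearMap.restrictScalars_apply] at h
          simp only [← h, MultilinearMap.map_update_add, X.map_update_add, map_add]
          abel
        map_update_smul' := fun {dec} a k f x => by
          have e : dec = instDecidableEqFin p := Subsingleton.elim _ _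
          subst e
          have h := slotSum_apply ((prA j).restrictScalars K ∘ₗ (δ : Module.End K L) ∘ₗ
            P.incl.restrictScalars K) X
          simp only [LinearMap.comp_apply, LinearMap.restrictScalars_apply] at h
          obtain ⟨σ, hσ, -⟩ := δ.2.1
          simp only [← h]
          rw [slotSum_update_smul _ X a k f (σ f) x (by simp [hσ])]
          simp only [X.map_update_smul, map_smul, hσ, map_add, prB_j, smul_sub]
          abel
        map_eq_zero_of_eq' := fun a k l hkl hne => by
          have h := slotSum_apply ((prA j).restrictScalars K ∘ₗ (δ : Module.End K L) ∘ₗ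
            P.incl.restrictScalars K) X
          simp only [LinearMap.comp_apply, LinearMap.restrictScalars_apply] at h
          simp only [← h, slotSum_eq_zero _ X a hkl hne, X.map_eq_zero_of_eq a hkl hne, map_zero,
            sub_zero] })
    (fun δ δ' X => by
      ext a
      simp only [AlternatingMap.coe_mk, MultilinearMap.coe_mk, AlternatingMap.add_apply,
        Submodule.coe_add, LinearMap.add_apply, map_add, X.map_update_add, Finset.sum_add_distrib]
      abel)
    (fun c δ X => by
      ext a
      have h := fun i => (X.toMultilinearMap.restrictScalars K).map_update_smul a i c
      simp only [MultilinearMap.coe_restrictScalars, AlternatingMap.coe_multilinearMap] at h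
      simp only [AlternatingMap.coe_mk, MultilinearMap.coe_mk, AlternatingMap.smul_apply,
        Submodule.coe_smul, LinearMap.smul_apply, LinearMap.map_smul_of_tower, h, smul_sub,
        Finset.smul_sum])
    (fun δ X Y => by
      ext a
      simp only [AlternatingMap.coe_mk, MultilinearMap.coe_mk, AlternatingMap.add_apply, map_add,
        Finset.sum_add_distrib]
      abel)
    (fun c δ X => by
      ext a
      simp only [AlternatingMap.coe_mk, MultilinearMap.coe_mk, AlternatingMap.smul_apply, map_smul,
        LinearMap.map_smul_of_tower, smul_sub, Finset.smul_sum])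

lemma derAct_apply {p : ℕ} (δ : der P) (X : Form P p) (a : Fin p → A) :
    derAct j p δ X a = prB P ((δ : Module.End K L) (j.j (X a))) -
      ∑ i, X (Function.update a i (prA j ((δ : Module.End K L) (P.incl (a i))))) := rfl


/-- If the `K`-alternating map `T` is `R`-homogeneous in its first argument, it is `R`-linear in
every argument. -/
lemma map_update_smul_of_cons {n : ℕ} {N : Type u} [AddCommGroup N] [Module K N] [Module R N]
    (T : A [⋀^Fin (n + 1)]→ₗ[K] N)
    (h : ∀ (f : R) (x : A) (a : Fin n → A), T (Fin.cons (f • x) a : Fin (n + 1) → A) =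
      f • T (Fin.cons x a : Fin (n + 1) → A))
    (a : Fin (n + 1) → A) (m : Fin (n + 1)) (f : R) (x : A) :
    T (Function.update a m (f • x)) = f • T (Function.update a m x) := by
  have key : ∀ y : A, Function.update a m y =
      (Fin.cons y (fun i => a (Equiv.swap 0 m i.succ)) : Fin (n + 1) → A) ∘ Equiv.swap 0 m := by
    intro y
    funext i
    rw [Function.comp_apply]
    by_cases hi : i = m
    · subst hi; simp
    · rw [Function.update_of_ne hi]
      have h0 : Equiv.swap 0 m i ≠ 0 := fun h0 => hi (by
        have := congrArg (Equiv.swap 0 m) h0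
        simpa using this)
      obtain ⟨k, hk⟩ := Fin.exists_succ_eq.2 h0
      rw [← hk, Fin.cons_succ, hk, Equiv.swap_apply_self]
  rw [key, key, T.map_perm, T.map_perm, h, smul_comm]

/-- The flat Bott connection `∇_a b = pr_B [a, j b]`. -/
def bott (a : A) : P.B →ₗ[K] P.B :=
  (prB P).restrictScalars K ∘ₗ P.algL.bracket (P.incl a) ∘ₗ j.j.restrictScalars K

lemma bott_apply (a : A) (b : P.B) :
    bott j a b = prB P (P.algL.bracket (P.incl a) (j.j b)) := rfl

lemma leibniz_left (S : LieAlgebroidStr K R L) (f : R) (x y : L) :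
    S.bracket (f • x) y = f • S.bracket x y - S.anchor y f • x := by
  rw [S.skew, S.leibniz, S.skew y x, smul_neg, neg_add, neg_neg]
  abel

/-- An `R`-multilinear alternating map, regarded as a `K`-multilinear one. -/
def resK {p : ℕ} (X : Form P p) : A [⋀^Fin p]→ₗ[K] P.B :=
  { X.toMultilinearMap.restrictScalars K with map_eq_zero_of_eq' := X.map_eq_zero_of_eq' }

@[simp] lemma resK_apply {p : ℕ} (X : Form P p) (a : Fin p → A) : resK X a = X a := rfl

/-- `a ↦ 1/2 (𝓛_a X + ∇_a ∘ X)`, where `𝓛_a X = [ad_a, X]₂`. -/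
def preCE {p : ℕ} (X : Form P p) : A →ₗ[K] A [⋀^Fin p]→ₗ[K] P.B where
  toFun a := (2 : K)⁻¹ • (resK (derAct j p (ad P (P.incl a)) X) +
    (bott j a).compAlternatingMap (resK X))
  map_add' a b := by
    ext c
    simp only [map_add, LinearMap.add_apply, AlternatingMap.smul_apply, AlternatingMap.add_apply,
      resK_apply, LinearMap.compAlternatingMap_apply, bott_apply]
    simp only [smul_add]
    abel
  map_smul' t a := by
    ext c
    simp only [map_smul, LinearMap.smul_apply, AlternatingMap.smul_apply, AlternatingMap.add_apply,
      resK_apply, LinearMap.compAlternatingMap_apply, bott_apply,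
      LinearMap.map_smul_of_tower, RingHom.id_apply]
    rw [← smul_add, smul_comm]

lemma preCE_apply {p : ℕ} (X : Form P p) (a : A) (c : Fin p → A) :
    preCE j X a c = (2 : K)⁻¹ • (derAct j p (ad P (P.incl a)) X c + bott j a (X c)) := rfl

lemma derAct_ad_smul {p : ℕ} (X : Form P p) (f : R) (x : A) (c : Fin p → A) :
    derAct j p (ad P (P.incl (f • x))) X c = f • derAct j p (ad P (P.incl x)) X c +
      ∑ k, P.algL.anchor (P.incl (c k)) f • X (Function.update c k x) := by
  simp only [derAct_apply, ad_apply, map_smul, leibniz_left, map_sub, prB_incl, smul_zero, sub_zero,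
    prA_incl, X.map_update_sub, X.map_update_smul, Finset.sum_sub_distrib, smul_sub,
    Finset.smul_sum]
  abel

lemma bott_smul_left (f : R) (x : A) (b : P.B) : bott j (f • x) b = f • bott j x b := by
  simp [bott_apply, leibniz_left]

lemma bott_smul_right (f : R) (x : A) (b : P.B) :
    bott j x (f • b) = P.algL.anchor (P.incl x) f • b + f • bott j x b := by
  simp [bott_apply, P.algL.leibniz]

lemma preCE_smul {p : ℕ} (X : Form P p) (f : R) (x : A) (c : Fin p → A) :
    preCE j X (f • x) c = f • preCE j X x c +
      (2 : K)⁻¹ • ∑ k, P.algL.anchor (P.incl (c k)) f • X (Function.update c k x) := by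
  rw [preCE_apply, preCE_apply, derAct_ad_smul, bott_smul_left, smul_comm f, smul_add f,
    ← smul_add]
  congr 1
  abel

lemma preCE_cons_smul {p : ℕ} (X : Form P (p + 1)) (f : R) (x b : A) (c : Fin p → A) :
    preCE j X b (Fin.cons (f • x) c : Fin (p + 1) → A) =
      f • preCE j X b (Fin.cons x c : Fin (p + 1) → A) +
        (2 : K)⁻¹ • P.algL.anchor (P.incl b) f • X (Fin.cons x c : Fin (p + 1) → A) := by
  have hlin : ∀ Y : Form P (p + 1),
      Y (Fin.cons (f • x) c : Fin (p + 1) → A) = f • Y (Fin.cons x c : Fin (p + 1) → A) :=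
    fun Y => Y.toMultilinearMap.cons_smul c f x
  rw [preCE_apply, preCE_apply, hlin, hlin, bott_smul_right, smul_comm f, smul_add f, ← smul_add]
  congr 1
  abel

lemma preCE_cons {p : ℕ} (X : Form P p) (f : R) (x : A) (a : Fin p → A) :
    AlternatingMap.alternatizeUncurryFin (preCE j X) (Fin.cons (f • x) a : Fin (p + 1) → A) =
      f • AlternatingMap.alternatizeUncurryFin (preCE j X) (Fin.cons x a : Fin (p + 1) → A) := by
  cases p with
  | zero =>
    simp [AlternatingMap.alternatizeUncurryFin_apply, preCE_smul]
  | succ p =>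
    have hrem : ∀ (k : Fin (p + 1)) (y : A),
        k.succ.removeNth (Fin.cons y a : Fin (p + 2) → A) =
          (Fin.cons y (k.removeNth a) : Fin (p + 1) → A) := by
      intro k y
      funext i
      refine Fin.cases ?_ (fun i => ?_) i
      · simp [Fin.removeNth]
      · simp [Fin.removeNth, Fin.succ_succAbove_succ]
    have hupd : ∀ k : Fin (p + 1), X (Function.update a k x) =
        (-1 : ℤ) ^ (k : ℕ) • X (Fin.cons x (k.removeNth a) : Fin (p + 1) → A) := by
      intro k
      have := X.map_insertNth k x (k.removeNth a)
      rw [Fin.insertNth_removeNth] at this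
      simpa [Matrix.vecCons] using this
    have h0 : ∀ y : A, (Fin.removeNth 0 (Fin.cons y a : Fin (p + 2) → A)) = a := by
      intro y; funext i; simp [Fin.removeNth]
    rw [AlternatingMap.alternatizeUncurryFin_apply, AlternatingMap.alternatizeUncurryFin_apply,
      Fin.sum_univ_succ (n := p + 1), Fin.sum_univ_succ (n := p + 1)]
    simp only [Fin.cons_zero, Fin.cons_succ, hrem, h0, preCE_smul, preCE_cons_smul, hupd,
      Fin.val_zero, pow_zero, one_smul, Fin.val_succ]
    rw [smul_add, Finset.smul_sum, Finset.smul_sum, add_assoc, ← Finset.sum_add_distrib]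
    congr 1
    refine Finset.sum_congr rfl fun k _ => ?_
    rw [smul_add, pow_succ, mul_neg_one, neg_smul, neg_smul, neg_smul, smul_neg,
      smul_comm f ((-1 : ℤ) ^ (k : ℕ)),
      smul_comm (P.algL.anchor (P.incl (a k)) f) ((-1 : ℤ) ^ (k : ℕ)),
      smul_comm (2 : K)⁻¹ ((-1 : ℤ) ^ (k : ℕ))]
    abel

/-- The Chevalley-Eilenberg differential
`dX(a₀, …, aₚ) = ∑ᵢ (-1)ⁱ (∇_{aᵢ} X(…, âᵢ, …) - 1/2 ∑_{k ≠ i} X(…, âᵢ, …, [aᵢ, aₖ], …))`;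
each pair `i ≠ k` contributes twice to the double sum, whence the factor `1/2`. -/
def dCE (p : ℕ) : Form P p →ₗ[K] Form P (p + 1) where
  toFun X :=
    { toFun := AlternatingMap.alternatizeUncurryFin (preCE j X)
      map_update_add' := fun {dec} a k x y => by
        have e : dec = instDecidableEqFin (p + 1) := Subsingleton.elim _ _
        subst e
        exact (AlternatingMap.alternatizeUncurryFin (preCE j X)).map_update_add a k x y
      map_update_smul' := fun {dec} a k f x => by
        have e : dec = instDecidableEqFin (p + 1) := Subsingleton.elim _ _
        subst e
        exact map_update_smul_of_cons _ (preCE_cons j X) a k f x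
      map_eq_zero_of_eq' := (AlternatingMap.alternatizeUncurryFin (preCE j X)).map_eq_zero_of_eq' }
  map_add' X Y := by
    refine AlternatingMap.ext fun a => ?_
    simp only [AlternatingMap.coe_mk, MultilinearMap.coe_mk, AlternatingMap.add_apply,
      AlternatingMap.alternatizeUncurryFin_apply, preCE_apply, map_add, ← Finset.sum_add_distrib]
    refine Finset.sum_congr rfl fun i _ => ?_
    rw [← smul_add, ← smul_add]
    congr 2
    abel
  map_smul' c X := by
    refine AlternatingMap.ext fun a => ?_
    simp only [AlternatingMap.coe_mk, MultilinearMap.coe_mk, AlternatingMap.smul_apply,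
      AlternatingMap.alternatizeUncurryFin_apply, preCE_apply, map_smul, RingHom.id_apply,
      Finset.smul_sum]
    refine Finset.sum_congr rfl fun i _ => ?_
    rw [← smul_add, smul_comm c, smul_comm c]

lemma dCE_apply {p : ℕ} (X : Form P p) (a : Fin (p + 1) → A) :
    dCE j p X a = ∑ i : Fin (p + 1), (-1 : ℤ) ^ (i : ℕ) •
      (2 : K)⁻¹ • (derAct j p (ad P (P.incl (a i))) X (i.removeNth a) +
        bott j (a i) (X (i.removeNth a))) :=
  AlternatingMap.alternatizeUncurryFin_apply _ _

/-- A multilinear map in two groups of variables. -/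
def mkSum {p q : ℕ} {N : Type u} [AddCommGroup N] [Module R N]
    (g : (Fin p → A) → (Fin q → A) → N)
    (add_l : ∀ x y i u u', g (Function.update x i (u + u')) y =
      g (Function.update x i u) y + g (Function.update x i u') y)
    (smul_l : ∀ x y i (f : R) u, g (Function.update x i (f • u)) y =
      f • g (Function.update x i u) y)
    (add_r : ∀ x y i u u', g x (Function.update y i (u + u')) =
      g x (Function.update y i u) + g x (Function.update y i u'))
    (smul_r : ∀ x y i (f : R) u, g x (Function.update y i (f • u)) =
      f • g x (Function.update y i u)) :
    MultilinearMap R (fun _ : Fin p ⊕ Fin q => A) N where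
  toFun a := g (a ∘ Sum.inl) (a ∘ Sum.inr)
  map_update_add' := fun {dec} a k u u' => by
    have e : dec = instDecidableEqSum := Subsingleton.elim _ _
    subst e
    cases k with
    | inl k => simp only [Sum.update_inl_comp_inl, Sum.update_inl_comp_inr, add_l]
    | inr k => simp only [Sum.update_inr_comp_inl, Sum.update_inr_comp_inr, add_r]
  map_update_smul' := fun {dec} a k f u => by
    have e : dec = instDecidableEqSum := Subsingleton.elim _ _
    subst e
    cases k with
    | inl k => simp only [Sum.update_inl_comp_inl, Sum.update_inl_comp_inr, smul_l]
    | inr k => simp only [Sum.update_inr_comp_inl, Sum.update_inr_comp_inr, smul_r]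

section shSum

variable {N : Type u} [AddCommGroup N] [Module K N] [Module R N] [IsScalarTower K R N]

/-- The signed sum over `(p,q)`-shuffles of a multilinear map that is alternating in the first `p`
and in the last `q` variables, written as `1/(p! q!)` times the sum over all permutations. -/
def shSum {p q : ℕ} (G : MultilinearMap R (fun _ : Fin p ⊕ Fin q => A) N) :
    A [⋀^Fin (p + q)]→ₗ[R] N :=
  ((p.factorial * q.factorial : ℕ) : K)⁻¹ •
    (MultilinearMap.alternatization G).domDomCongr finSumFinEquiv

variable (K) in
lemma shSum_add {p q : ℕ} (G G' : MultilinearMap R (fun _ : Fin p ⊕ Fin q => A) N) :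
    shSum (K := K) (G + G') = shSum (K := K) G + shSum (K := K) G' := by
  refine AlternatingMap.ext fun a => ?_
  simp only [shSum, map_add, AlternatingMap.smul_apply, AlternatingMap.add_apply,
    AlternatingMap.domDomCongr_apply, smul_add]

lemma shSum_smul {p q : ℕ} (c : K) (G : MultilinearMap R (fun _ : Fin p ⊕ Fin q => A) N) :
    shSum (K := K) (c • G) = c • shSum (K := K) G := by
  refine AlternatingMap.ext fun a => ?_
  simp only [shSum, AlternatingMap.smul_apply, AlternatingMap.domDomCongr_apply,
    MultilinearMap.alternatization_apply, MultilinearMap.domDomCongr_apply,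
    _root_.smul_apply, Finset.smul_sum]
  refine Finset.sum_congr rfl fun σ _ => ?_
  rw [smul_comm c, smul_comm c (Equiv.Perm.sign σ)]

end shSum

/-- `X ↦ X` if `m = s`, and `0` otherwise. -/
def castF (m s : ℕ) : Form P m →ₗ[K] Form P s :=
  if h : m = s then (AlternatingMap.domDomCongrₗ K (finCongr h)).toLinearMap else 0

/-- `∑ᵢ X(x₁, …, pr_A [j b, xᵢ], …, xₚ)`. -/
def slotJ {p : ℕ} (X : Form P p) (b : P.B) (x : Fin p → A) : P.B :=
  ∑ i, X (Function.update x i (prA j (P.algL.bracket (j.j b) (P.incl (x i)))))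

lemma slotJ_add {p : ℕ} (X : Form P p) (b b' : P.B) (x : Fin p → A) :
    slotJ j X (b + b') x = slotJ j X b x + slotJ j X b' x := by
  simp only [slotJ, map_add, LinearMap.add_apply, X.map_update_add, Finset.sum_add_distrib]

lemma slotJ_smul {p : ℕ} (X : Form P p) (f : R) (b : P.B) (x : Fin p → A) :
    slotJ j X (f • b) x = f • slotJ j X b x := by
  simp only [slotJ, map_smul, leibniz_left, map_sub, prA_j, smul_zero, sub_zero,
    X.map_update_smul, Finset.smul_sum]

/-- `pr_B [j X(x), j Y(y)] - ∑ᵢ Y(y₁, …, pr_A [j X(x), yᵢ], …) + ∑ᵢ X(x₁, …, pr_A [j Y(y), xᵢ], …)`. -/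
def pairFun {p q : ℕ} (X : Form P p) (Y : Form P q) (x : Fin p → A) (y : Fin q → A) : P.B :=
  prB P (P.algL.bracket (j.j (X x)) (j.j (Y y))) - slotJ j Y (X x) y + slotJ j X (Y y) x

lemma pairFun_eq {p q : ℕ} (X : Form P p) (Y : Form P q) (x : Fin p → A) (y : Fin q → A) :
    pairFun j X Y x y = derAct j q (ad P (j.j (X x))) Y y + slotJ j X (Y y) x := rfl

lemma pairFun_symm {p q : ℕ} (X : Form P p) (Y : Form P q) (x : Fin p → A) (y : Fin q → A) :
    pairFun j X Y x y = -pairFun j Y X y x := by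
  rw [pairFun, pairFun, P.algL.skew, map_neg]
  abel

lemma pairFun_update_add {p q : ℕ} (X : Form P p) (Y : Form P q) (x : Fin p → A) (y : Fin q → A)
    (i : Fin q) (u u' : A) : pairFun j X Y x (Function.update y i (u + u')) =
      pairFun j X Y x (Function.update y i u) + pairFun j X Y x (Function.update y i u') := by
  rw [pairFun_eq, pairFun_eq, pairFun_eq, AlternatingMap.map_update_add, Y.map_update_add,
    slotJ_add]
  abel

lemma pairFun_update_smul {p q : ℕ} (X : Form P p) (Y : Form P q) (x : Fin p → A) (y : Fin q → A)
    (i : Fin q) (f : R) (u : A) : pairFun j X Y x (Function.update y i (f • u)) =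
      f • pairFun j X Y x (Function.update y i u) := by
  rw [pairFun_eq, pairFun_eq, AlternatingMap.map_update_smul, Y.map_update_smul, slotJ_smul,
    smul_add]

lemma pairFun_add {p q : ℕ} (X : Form P p) (Y Y' : Form P q) (x : Fin p → A) (y : Fin q → A) :
    pairFun j X (Y + Y') x y = pairFun j X Y x y + pairFun j X Y' x y := by
  simp only [pairFun_eq, map_add, AlternatingMap.add_apply, slotJ_add]
  abel

lemma slotJ_smulK {p : ℕ} (X : Form P p) (c : K) (b : P.B) (x : Fin p → A) :
    slotJ j X (c • b) x = c • slotJ j X b x := by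
  rw [← algebraMap_smul R c b, slotJ_smul, algebraMap_smul]

lemma pairFun_smul {p q : ℕ} (X : Form P p) (c : K) (Y : Form P q) (x : Fin p → A)
    (y : Fin q → A) : pairFun j X (c • Y) x y = c • pairFun j X Y x y := by
  simp only [pairFun_eq, map_smul, AlternatingMap.smul_apply, slotJ_smulK, smul_add]

/-- `[X, Y]₂`: the signed sum over shuffles of `pairFun`. -/
def formBr2 (p q : ℕ) : Form P p →ₗ[K] Form P q →ₗ[K] Form P (p + q) :=
  LinearMap.mk₂ K
    (fun X Y => shSum (K := K) (mkSum (pairFun j X Y)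
      (fun x y i u u' => by
        rw [pairFun_symm j X, pairFun_symm j X, pairFun_symm j X, pairFun_update_add, neg_add])
      (fun x y i f u => by
        rw [pairFun_symm j X, pairFun_symm j X, pairFun_update_smul, smul_neg])
      (pairFun_update_add j X Y) (pairFun_update_smul j X Y)))
    (fun X X' Y => by
      rw [← shSum_add]
      congr 1
      refine MultilinearMap.ext fun a => ?_
      change pairFun j (X + X') Y _ _ = pairFun j X Y _ _ + pairFun j X' Y _ _
      rw [pairFun_symm j _ Y, pairFun_symm j _ Y, pairFun_symm j _ Y, pairFun_add, neg_add])
    (fun c X Y => by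
      rw [← shSum_smul]
      congr 1
      refine MultilinearMap.ext fun a => ?_
      change pairFun j (c • X) Y _ _ = c • pairFun j X Y _ _
      rw [pairFun_symm j _ Y, pairFun_symm j _ Y, pairFun_smul, smul_neg])
    (fun X Y Y' => by
      rw [← shSum_add]
      congr 1
      exact MultilinearMap.ext fun a => pairFun_add j X Y Y' _ _)
    (fun c X Y => by
      rw [← shSum_smul]
      congr 1
      exact MultilinearMap.ext fun a => pairFun_smul j X c Y _ _)

lemma beta_smul_left (f : R) (b b' : P.B) :
    prA j (P.algL.bracket (j.j (f • b)) (j.j b')) = f • prA j (P.algL.bracket (j.j b) (j.j b')) := by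
  simp only [map_smul, leibniz_left, map_sub, prA_j, smul_zero, sub_zero]

lemma beta_smul_right (f : R) (b b' : P.B) :
    prA j (P.algL.bracket (j.j b) (j.j (f • b'))) = f • prA j (P.algL.bracket (j.j b) (j.j b')) := by
  simp only [map_smul, P.algL.leibniz, map_add, prA_j, smul_zero, zero_add]

/-- The `A`-valued form `β(X, Y)`: the signed sum over shuffles of `pr_A [j X(x), j Y(y)]`. -/
def wedgeA (p q : ℕ) : Form P p →ₗ[K] Form P q →ₗ[K] A [⋀^Fin (p + q)]→ₗ[R] A :=
  LinearMap.mk₂ K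
    (fun X Y => shSum (K := K) (mkSum
      (fun x y => prA j (P.algL.bracket (j.j (X x)) (j.j (Y y))))
      (fun x y i u u' => by simp only [AlternatingMap.map_update_add, map_add, LinearMap.add_apply])
      (fun x y i f u => by rw [AlternatingMap.map_update_smul, beta_smul_left])
      (fun x y i u u' => by simp only [AlternatingMap.map_update_add, map_add])
      (fun x y i f u => by rw [AlternatingMap.map_update_smul, beta_smul_right])))
    (fun X X' Y => by
      rw [← shSum_add]
      congr 1
      ext a
      change prA j (P.algL.bracket (j.j (X _ + X' _)) _) =
        prA j (P.algL.bracket (j.j (X _)) _) + prA j (P.algL.bracket (j.j (X' _)) _)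
      simp only [map_add, LinearMap.add_apply])
    (fun c X Y => by
      rw [← shSum_smul]
      congr 1
      ext a
      change prA j (P.algL.bracket (j.j (c • X _)) _) = c • prA j (P.algL.bracket (j.j (X _)) _)
      simp only [LinearMap.map_smul_of_tower, map_smul, LinearMap.smul_apply])
    (fun X Y Y' => by
      rw [← shSum_add]
      congr 1
      ext a
      change prA j (P.algL.bracket _ (j.j (Y _ + Y' _))) =
        prA j (P.algL.bracket _ (j.j (Y _))) + prA j (P.algL.bracket _ (j.j (Y' _)))
      simp only [map_add])
    (fun c X Y => by
      rw [← shSum_smul]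
      congr 1
      ext a
      change prA j (P.algL.bracket _ (j.j (c • Y _))) = c • prA j (P.algL.bracket _ (j.j (Y _)))
      simp only [LinearMap.map_smul_of_tower, map_smul])

lemma cons_update {n : ℕ} (u : A) (z : Fin n → A) (i : Fin n) (t : A) :
    (Fin.cons u (Function.update z i t) : Fin (n + 1) → A) =
      Function.update (Fin.cons u z : Fin (n + 1) → A) i.succ t := Fin.cons_update ..

lemma form_cons_add {n : ℕ} (Z : Form P (n + 1)) (u u' : A) (z : Fin n → A) :
    Z (Fin.cons (u + u') z : Fin (n + 1) → A) =
      Z (Fin.cons u z : Fin (n + 1) → A) + Z (Fin.cons u' z : Fin (n + 1) → A) :=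
  Z.toMultilinearMap.cons_add z u u'

lemma form_cons_smul {n : ℕ} (Z : Form P (n + 1)) (f : R) (u : A) (z : Fin n → A) :
    Z (Fin.cons (f • u) z : Fin (n + 1) → A) = f • Z (Fin.cons u z : Fin (n + 1) → A) :=
  Z.toMultilinearMap.cons_smul z f u

lemma form_cons_smulK {n : ℕ} (Z : Form P (n + 1)) (c : K) (u : A) (z : Fin n → A) :
    Z (Fin.cons (c • u) z : Fin (n + 1) → A) = c • Z (Fin.cons u z : Fin (n + 1) → A) :=
  (Z.toMultilinearMap.restrictScalars K).cons_smul z c u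

variable (P) in
/-- Insertion of the `A`-valued form `φ` into the first argument of the `B`-valued form `Z`: the
signed sum over shuffles of `Z(φ(x), z)`. -/
def insSucc (m r : ℕ) :
    (A [⋀^Fin m]→ₗ[R] A) →ₗ[K] Form P (r + 1) →ₗ[K] Form P (m + r) :=
  LinearMap.mk₂ K
    (fun φ Z => shSum (K := K) (mkSum
      (fun x z => Z (Fin.cons (φ x) z : Fin (r + 1) → A))
      (fun x y i u u' => by simp only [AlternatingMap.map_update_add, form_cons_add])
      (fun x y i f u => by simp only [AlternatingMap.map_update_smul, form_cons_smul])
      (fun x y i u u' => by simp only [cons_update, AlternatingMap.map_update_add])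
      (fun x y i f u => by simp only [cons_update, AlternatingMap.map_update_smul])))
    (fun φ φ' Z => by
      rw [← shSum_add]
      congr 1
      ext a
      exact form_cons_add ..)
    (fun c φ Z => by
      rw [← shSum_smul]
      congr 1
      ext a
      exact form_cons_smulK ..)
    (fun φ Z Z' => by
      rw [← shSum_add]
      congr 1)
    (fun c φ Z => by
      rw [← shSum_smul]
      congr 1)

variable (P) in
/-- The insertion of an `A`-valued `m`-form into a `B`-valued `r`-form, in degree `s = m + r - 1`;
it vanishes for `r = 0`. -/
def ins (m r s : ℕ) : (A [⋀^Fin m]→ₗ[R] A) →ₗ[K] Form P r →ₗ[K] Form P s :=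
  match r with
  | 0 => 0
  | r + 1 => LinearMap.compr₂ (insSucc P m r) (castF (m + r) s)


/-- `[X, Y, Z]₃` for forms of degrees `p`, `q`, `r`, with values in degree `s = p + q + r - 1`:
`± β(X, Y) ⌟ Z ± β(X, Z) ⌟ Y ± β(Y, Z) ⌟ X`. -/
def formBr3 (p q r s : ℕ) : Form P p →ₗ[K] Form P q →ₗ[K] Form P r →ₗ[K] Form P s :=
  (-1 : K) ^ (p + q + 1) • LinearMap.compr₂ (wedgeA j p q) (ins P (p + q) r s) +
  (-1 : K) ^ (q * r + p + r) •
    (LinearMap.lflip.toLinearMap ∘ₗ LinearMap.compr₂ (wedgeA j p r) (ins P (p + r) q s)) +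
  (-1 : K) ^ (p * (q + r) + q + r + 1) •
    (LinearMap.lflip.toLinearMap ∘ₗ LinearMap.compr₂ (wedgeA j q r) (ins P (q + r) p s)).flip

lemma formBr3_apply {p q r s : ℕ} (X : Form P p) (Y : Form P q) (Z : Form P r) :
    formBr3 j p q r s X Y Z =
      (-1 : K) ^ (p + q + 1) • ins P (p + q) r s (wedgeA j p q X Y) Z +
      (-1 : K) ^ (q * r + p + r) • ins P (p + r) q s (wedgeA j p r X Z) Y +
      (-1 : K) ^ (p * (q + r) + q + r + 1) • ins P (q + r) p s (wedgeA j q r Y Z) X := rfl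

/-- The `A`-valued form `pr_A ∘ δ ∘ j ∘ X`. -/
def derA (p : ℕ) : der P →ₗ[K] Form P p →ₗ[K] A [⋀^Fin p]→ₗ[R] A :=
  LinearMap.mk₂ K
    (fun δ X => LinearMap.compAlternatingMap
      { toFun := fun b => prA j ((δ : Module.End K L) (j.j b))
        map_add' := fun b b' => by simp only [map_add]
        map_smul' := fun f b => by
          obtain ⟨σ, h, -⟩ := δ.2.1
          simp [h] } X)
    (fun δ δ' X => by
      refine AlternatingMap.ext fun a => ?_
      change prA j ((δ + δ' : Module.End K L) _) = prA j _ + prA j _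
      rw [LinearMap.add_apply, map_add])
    (fun c δ X => by
      refine AlternatingMap.ext fun a => ?_
      change prA j ((c • (δ : Module.End K L)) _) = c • prA j _
      rw [LinearMap.smul_apply, LinearMap.map_smul_of_tower])
    (fun δ X X' => by
      refine AlternatingMap.ext fun a => ?_
      change prA j ((δ : Module.End K L) (j.j (X a + X' a))) = prA j _ + prA j _
      rw [map_add, map_add, map_add]
      rfl)
    (fun c δ X => by
      refine AlternatingMap.ext fun a => ?_
      change prA j ((δ : Module.End K L) (j.j (c • X a))) = c • prA j _
      rw [LinearMap.map_smul_of_tower, map_smul, LinearMap.map_smul_of_tower]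
      rfl)

/-- `[δ, X, Y]₃` for forms of degrees `p`, `q`, with values in degree `s = p + q - 1`. -/
def derBr3 (p q s : ℕ) : der P →ₗ[K] Form P p →ₗ[K] Form P q →ₗ[K] Form P s :=
  (-1 : K) ^ (p + 1) • LinearMap.compr₂ (derA j p) (ins P p q s) +
  (-1 : K) ^ (q * (p + 1)) •
    (LinearMap.lflip.toLinearMap ∘ₗ LinearMap.compr₂ (derA j q) (ins P q p s))

lemma derBr3_apply {p q s : ℕ} (δ : der P) (X : Form P p) (Y : Form P q) :
    derBr3 j p q s δ X Y = (-1 : K) ^ (p + 1) • ins P p q s (derA j p δ X) Y +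
      (-1 : K) ^ (q * (p + 1)) • ins P q p s (derA j q δ Y) X := rfl

variable (P)

/-- The commutator of derivations. -/
def derLie : der P →ₗ[K] der P →ₗ[K] der P :=
  LinearMap.mk₂ K
    (fun δ ε => ⟨(δ : Module.End K L) * ε - (ε : Module.End K L) * δ, by
      obtain ⟨⟨σ, h1, h2⟩, h3⟩ := δ.2
      obtain ⟨⟨τ, k1, k2⟩, k3⟩ := ε.2
      refine ⟨⟨⁅σ, τ⁆, fun f x => ?_, fun x => ?_⟩, fun x y => ?_⟩
      · simp only [LinearMap.sub_apply, Module.End.mul_apply, h1, k1, map_add,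
          Derivation.commutator_apply, sub_smul, smul_sub]
        abel
      · rw [lie_lie, k2, h2, h2, k2, LinearMap.sub_apply, Module.End.mul_apply,
          Module.End.mul_apply, map_sub]
      · simp only [LinearMap.sub_apply, Module.End.mul_apply, h3, k3, map_add, map_sub]
        abel⟩)
    (fun δ δ' ε => Subtype.ext (by
      simp only [Submodule.coe_add, add_mul, mul_add]; abel))
    (fun c δ ε => Subtype.ext (by
      simp only [Submodule.coe_smul, smul_mul_assoc, mul_smul_comm, smul_sub]))
    (fun δ ε ε' => Subtype.ext (by
      simp only [Submodule.coe_add, add_mul, mul_add]; abel))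
    (fun c δ ε => Subtype.ext (by
      simp only [Submodule.coe_smul, smul_mul_assoc, mul_smul_comm, smul_sub]))

lemma derLie_apply (δ ε : der P) (x : L) : (derLie P δ ε : Module.End K L) x =
    (δ : Module.End K L) ((ε : Module.End K L) x) -
      (ε : Module.End K L) ((δ : Module.End K L) x) := rfl

/-- The inner derivations, placed in degree `0`. -/
def hDer (p : ℕ) : Submodule K (der P) := if p = 0 then LinearMap.range (ad P) else ⊥

lemma derLie_mem {p q s : ℕ} (h : s = p + q) (δ : hDer P p) (ε : hDer P q) :
    derLie P δ ε ∈ hDer P s := by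
  subst h
  obtain ⟨δ, hδ⟩ := δ
  obtain ⟨ε, hε⟩ := ε
  by_cases hp : p = 0
  · by_cases hq : q = 0
    · subst hp hq
      simp only [hDer, if_true] at hδ hε
      obtain ⟨x, rfl⟩ := hδ
      obtain ⟨y, rfl⟩ := hε
      simp only [hDer, if_true]
      refine ⟨P.algL.bracket x y, Subtype.ext (LinearMap.ext fun z => ?_)⟩
      rw [derLie_apply, ad_apply, ad_apply, ad_apply, ad_apply, ad_apply, P.algL.jacobi x y z]
      abel
    · have : ε = 0 := by simpa [hDer, hq] using hε
      subst this
      simp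
  · have : δ = 0 := by simpa [hDer, hp] using hδ
    subst this
    simp

/-- The components of `𝔥₀`: in degree `0` it is `IDer(L) ⊕ Γ(B)`, in degree `p ≥ 1` it is
`Ω_A^p(B)`. -/
abbrev HV (p : ℕ) : Type u := hDer P p × Form P p

variable {P}

/-- `[δ + X]₁ = [δ]₁ + dX`. -/
def hBr1 (p s : ℕ) : HV P p →ₗ[K] HV P s :=
  LinearMap.inr K _ _ ∘ₗ
    (castF 1 s ∘ₗ derB1 ∘ₗ (hDer P p).subtype ∘ₗ LinearMap.fst K _ _ +
      castF (p + 1) s ∘ₗ dCE j p ∘ₗ LinearMap.snd K _ _)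

lemma hBr1_apply {p s : ℕ} (x : HV P p) :
    hBr1 j p s x = (0, castF 1 s (derB1 x.1) + castF (p + 1) s (dCE j p x.2)) := rfl

/-- `[δ + X, ε + Y]₂ = [δ, ε] + [δ, Y]₂ - [ε, X]₂ + [X, Y]₂`. -/
def hBr2 (p q s : ℕ) (h : s = p + q) : HV P p →ₗ[K] HV P q →ₗ[K] HV P s :=
  LinearMap.mk₂ K
    (fun x y => (⟨derLie P x.1 y.1, derLie_mem P h x.1 y.1⟩,
      castF q s (derAct j q x.1 y.2) - castF p s (derAct j p y.1 x.2) +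
        castF (p + q) s (formBr2 j p q x.2 y.2)))
    (fun x x' y => Prod.ext
      (Subtype.ext (by simp only [Prod.fst_add, Submodule.coe_add, map_add, LinearMap.add_apply]))
      (by
        simp only [Prod.fst_add, Prod.snd_add, Submodule.coe_add, map_add, LinearMap.add_apply]
        abel))
    (fun c x y => Prod.ext
      (Subtype.ext (by
        simp only [Prod.smul_fst, Submodule.coe_smul, map_smul, LinearMap.smul_apply]))
      (by
        simp only [Prod.smul_fst, Prod.smul_snd, Submodule.coe_smul, map_smul,
          LinearMap.smul_apply, smul_sub, smul_add]))
    (fun x y y' => Prod.ext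
      (Subtype.ext (by simp only [Prod.fst_add, Submodule.coe_add, map_add]))
      (by
        simp only [Prod.fst_add, Prod.snd_add, Submodule.coe_add, map_add, LinearMap.add_apply]
        abel))
    (fun c x y => Prod.ext
      (Subtype.ext (by simp only [Prod.smul_fst, Submodule.coe_smul, map_smul]))
      (by
        simp only [Prod.smul_fst, Prod.smul_snd, Submodule.coe_smul, map_smul,
          LinearMap.smul_apply, smul_sub, smul_add]))

lemma hBr2_apply {p q s : ℕ} (h : s = p + q) (x : HV P p) (y : HV P q) :
    hBr2 j p q s h x y = (⟨derLie P x.1 y.1, derLie_mem P h x.1 y.1⟩,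
      castF q s (derAct j q x.1 y.2) - castF p s (derAct j p y.1 x.2) +
        castF (p + q) s (formBr2 j p q x.2 y.2)) := rfl

/-- The `Ω_A(B)`-component of the ternary bracket. -/
def hBr3Fun {p q r : ℕ} (s : ℕ) (x : HV P p) (y : HV P q) (z : HV P r) : Form P s :=
  derBr3 j q r s x.1 y.2 z.2 - derBr3 j p r s y.1 x.2 z.2 + formBr3 j p q r s x.2 y.2 z.2 +
    derBr3 j p q s z.1 x.2 y.2

/-- `hBr3Fun` as a trilinear map. -/
def hBr3Aux (p q r s : ℕ) : HV P p →ₗ[K] HV P q →ₗ[K] HV P r →ₗ[K] Form P s :=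
  LinearMap.mk₂ K
    (fun x y => (derBr3 j q r s x.1 y.2 - derBr3 j p r s y.1 x.2 + formBr3 j p q r s x.2 y.2) ∘ₗ
        LinearMap.snd K _ _ +
      ((derBr3 j p q s).flip x.2).flip y.2 ∘ₗ (hDer P r).subtype ∘ₗ LinearMap.fst K _ _)
    (fun x x' y => LinearMap.ext fun z => by
      change hBr3Fun j s (x + x') y z = hBr3Fun j s x y z + hBr3Fun j s x' y z
      simp only [hBr3Fun, Prod.fst_add, Prod.snd_add, Submodule.coe_add, map_add,
        LinearMap.add_apply]
      abel)
    (fun c x y => LinearMap.ext fun z => by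
      change hBr3Fun j s (c • x) y z = c • hBr3Fun j s x y z
      simp only [hBr3Fun, Prod.smul_fst, Prod.smul_snd, Submodule.coe_smul, map_smul,
        LinearMap.smul_apply, smul_sub, smul_add])
    (fun x y y' => LinearMap.ext fun z => by
      change hBr3Fun j s x (y + y') z = hBr3Fun j s x y z + hBr3Fun j s x y' z
      simp only [hBr3Fun, Prod.fst_add, Prod.snd_add, Submodule.coe_add, map_add,
        LinearMap.add_apply]
      abel)
    (fun c x y => LinearMap.ext fun z => by
      change hBr3Fun j s x (c • y) z = c • hBr3Fun j s x y z
      simp only [hBr3Fun, Prod.smul_fst, Prod.smul_snd, Submodule.coe_smul, map_smul,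
        LinearMap.smul_apply, smul_sub, smul_add])

/-- `[δ + X, ε + Y, ζ + Z]₃ = [δ, Y, Z]₃ - [ε, X, Z]₃ + [ζ, X, Y]₃ + [X, Y, Z]₃`. -/
def hBr3 (p q r s : ℕ) : HV P p →ₗ[K] HV P q →ₗ[K] HV P r →ₗ[K] HV P s :=
  LinearMap.compr₂ (hBr3Aux j p q r s) (LinearMap.llcomp K _ _ _ (LinearMap.inr K _ _))

lemma hBr3_apply {p q r s : ℕ} (x : HV P p) (y : HV P q) (z : HV P r) :
    hBr3 j p q r s x y z = (0, hBr3Fun j s x y z) := rfl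

/-- The cubic `L∞`-algebra `𝔥₀ = IDer(L) ⊕ Ω_A^•(B)`. -/
def h0 : CubicBrackets.{w, u} K where
  V := HV P
  b1 p s _ := hBr1 j p s
  b2 := hBr2 j
  b3 p q r s _ := hBr3 j p q r s

end Brackets

/-! ### Lie pairs over smooth manifolds -/

section Geometry

variable (𝕜 : Type) [RCLike 𝕜] (n : ℕ) (M : Type u) [TopologicalSpace M]
  [ChartedSpace (EuclideanSpace ℝ (Fin n)) M]

/-- The algebra `C^∞(M, 𝕜)` of smooth `𝕜`-valued functions, for `𝕜 = ℝ` or `ℂ`. -/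
def smoothFun : Subalgebra 𝕜 (M → 𝕜) where
  carrier := {f | ContMDiff (𝓡 n) 𝓘(ℝ, 𝕜) ∞ f}
  mul_mem' {f g} hf hg := by
    have h : ContDiff ℝ ∞ fun p : 𝕜 × 𝕜 => p.1 * p.2 := contDiff_fst.mul contDiff_snd
    exact h.comp_contMDiff (ContMDiff.prodMk_space hf hg)
  add_mem' {f g} hf hg := ContMDiff.add hf hg
  algebraMap_mem' c := contMDiff_const

/-- `C^∞(M, 𝕜)` as a type. -/
def SmoothFun : Type u := smoothFun 𝕜 n M

instance : CommRing (SmoothFun 𝕜 n M) := (smoothFun 𝕜 n M).toCommRing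

instance : Algebra 𝕜 (SmoothFun 𝕜 n M) := (smoothFun 𝕜 n M).algebra

/-- A smooth `𝕜`-vector bundle of finite rank over `M`. -/
structure SmoothBundle where
  rank : ℕ
  fiber : M → Type u
  [topTotal : TopologicalSpace (TotalSpace (Fin rank → 𝕜) fiber)]
  [topFiber : ∀ x, TopologicalSpace (fiber x)]
  [addCommGroup : ∀ x, AddCommGroup (fiber x)]
  [module : ∀ x, Module 𝕜 (fiber x)]
  [realModule : ∀ x, Module ℝ (fiber x)]
  [tower : ∀ x, IsScalarTower ℝ 𝕜 (fiber x)]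
  [fiberBundle : FiberBundle (Fin rank → 𝕜) fiber]
  [vectorBundle : VectorBundle 𝕜 (Fin rank → 𝕜) fiber]
  [realVectorBundle : VectorBundle ℝ (Fin rank → 𝕜) fiber]
  [smooth : ContMDiffVectorBundle ∞ (Fin rank → 𝕜) fiber (𝓡 n)]

attribute [instance] SmoothBundle.topTotal SmoothBundle.topFiber SmoothBundle.addCommGroup
  SmoothBundle.module SmoothBundle.realModule SmoothBundle.tower SmoothBundle.fiberBundle
  SmoothBundle.vectorBundle SmoothBundle.realVectorBundle SmoothBundle.smooth

variable {𝕜 n M}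

namespace SmoothBundle

variable (E : SmoothBundle 𝕜 n M)

/-- The model fibre. -/
abbrev model : Type := Fin E.rank → 𝕜

/-- Smoothness of a section. -/
def IsSmooth (s : ∀ x, E.fiber x) : Prop :=
  ContMDiff (𝓡 n) ((𝓡 n).prod 𝓘(ℝ, E.model)) ∞ fun x => TotalSpace.mk' E.model x (s x)

lemma IsSmooth.smul {f : M → 𝕜} (hf : ContMDiff (𝓡 n) 𝓘(ℝ, 𝕜) ∞ f) {s : ∀ x, E.fiber x}
    (hs : E.IsSmooth s) : E.IsSmooth fun x => f x • s x := by
  intro x₀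
  have hs₀ := (contMDiffAt_section _).1 (hs x₀)
  refine (contMDiffAt_section _).2 ?_
  have h : ContDiff ℝ ∞ fun p : 𝕜 × E.model => p.1 • p.2 := contDiff_fst.smul contDiff_snd
  refine (h.comp_contMDiffAt ((hf x₀).prodMk_space hs₀)).congr_of_eventuallyEq ?_
  have hb := (trivializationAt E.model E.fiber x₀).open_baseSet.mem_nhds
    (mem_baseSet_trivializationAt E.model E.fiber x₀)
  filter_upwards [hb] with x hx
  exact ((trivializationAt E.model E.fiber x₀).linear 𝕜 hx).2 _ _

/-- The smooth sections, as a submodule of the module of all sections. -/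
def sections : Submodule (smoothFun 𝕜 n M) (∀ x, E.fiber x) where
  carrier := {s | E.IsSmooth s}
  add_mem' hs ht := ContMDiff.add_section hs ht
  zero_mem' := contMDiff_zeroSection ℝ E.fiber
  smul_mem' f _ hs := IsSmooth.smul E f.2 hs

/-- The `C^∞(M, 𝕜)`-module `Γ(E)` of smooth sections. -/
def Sec : Type u := E.sections

instance : AddCommGroup E.Sec := E.sections.addCommGroup

instance : Module (SmoothFun 𝕜 n M) E.Sec := E.sections.module

instance : Module 𝕜 E.Sec := Module.compHom E.Sec (algebraMap 𝕜 (SmoothFun 𝕜 n M))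

instance : IsScalarTower 𝕜 (SmoothFun 𝕜 n M) E.Sec :=
  IsScalarTower.of_algebraMap_smul fun _ _ => rfl

variable {E}

/-- The value of a section at a point. -/
def Sec.val (s : E.Sec) (x : M) : E.fiber x := (show E.sections from s).1 x

lemma Sec.isSmooth (s : E.Sec) : E.IsSmooth s.val := (show E.sections from s).2

@[ext] lemma Sec.ext {s t : E.Sec} (h : ∀ x, s.val x = t.val x) : s = t :=
  Subtype.ext (funext h)

lemma Sec.add_val (s t : E.Sec) (x : M) : (s + t).val x = s.val x + t.val x := rfl

lemma Sec.smul_val (f : smoothFun 𝕜 n M) (s : E.Sec) (x : M) :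
    ((show SmoothFun 𝕜 n M from f) • s).val x = f.1 x • s.val x := rfl

lemma Sec.const_smul_val (c : 𝕜) (s : E.Sec) (x : M) : (c • s).val x = c • s.val x := rfl

end SmoothBundle

/-- A smooth fibrewise injective morphism of vector bundles over `M`. -/
structure BundleIncl (A L : SmoothBundle 𝕜 n M) where
  toFun : ∀ x, A.fiber x →ₗ[𝕜] L.fiber x
  injective : ∀ x, Function.Injective (toFun x)
  smooth : ContMDiff ((𝓡 n).prod 𝓘(ℝ, A.model)) ((𝓡 n).prod 𝓘(ℝ, L.model)) ∞
    fun p : TotalSpace A.model A.fiber => TotalSpace.mk' L.model p.1 (toFun p.1 p.2)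

/-- The induced map on sections. -/
def BundleIncl.sec {A L : SmoothBundle 𝕜 n M} (i : BundleIncl A L) :
    A.Sec →ₗ[SmoothFun 𝕜 n M] L.Sec where
  toFun s := ⟨fun x => i.toFun x (s.val x), i.smooth.comp s.isSmooth⟩
  map_add' _ _ := SmoothBundle.Sec.ext fun x => map_add (i.toFun x) _ _
  map_smul' _ _ := SmoothBundle.Sec.ext fun x => map_smul (i.toFun x) _ _

lemma BundleIncl.sec_val {A L : SmoothBundle 𝕜 n M} (i : BundleIncl A L) (s : A.Sec) (x : M) :
    (i.sec s).val x = i.toFun x (s.val x) := rfl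

/-- A Lie pair `(L, A)`: a Lie algebroid `L` over `M` and a Lie subalgebroid `A`.  Vector fields
(with coefficients in `𝕜`) are derivations of `C^∞(M, 𝕜)`. -/
structure SmoothLiePair (A L : SmoothBundle 𝕜 n M) extends BundleIncl A L where
  algA : LieAlgebroidStr 𝕜 (SmoothFun 𝕜 n M) A.Sec
  algL : LieAlgebroidStr 𝕜 (SmoothFun 𝕜 n M) L.Sec
  sec_bracket : ∀ a b : A.Sec, toBundleIncl.sec (algA.bracket a b) =
    algL.bracket (toBundleIncl.sec a) (toBundleIncl.sec b)
  anchor_sec : ∀ a : A.Sec, algL.anchor (toBundleIncl.sec a) = algA.anchor a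

/-- The section modules of a Lie pair. -/
def SmoothLiePair.toLiePair {A L : SmoothBundle 𝕜 n M} (P : SmoothLiePair A L) :
    LiePair 𝕜 (SmoothFun 𝕜 n M) A.Sec L.Sec where
  algA := P.algA
  algL := P.algL
  incl := P.toBundleIncl.sec
  incl_injective _ _ h := SmoothBundle.Sec.ext fun x =>
    P.injective x (congrArg (fun s => SmoothBundle.Sec.val s x) h)
  incl_bracket := P.sec_bracket
  anchor_incl := P.anchor_sec

end Geometry

end LiePairDef

end

noncomputable section

namespace LiePairDef

/-! ### Finite-dimensionality of local Artinian algebras -/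

namespace ArtAlg

variable {K : Type w} [Field K]

/-! Everything passes through the image of `I` inside `L_v`. Since `𝔪` is nilpotent, a `v`-linear
endomorphism that is the identity modulo `𝔪` is bijective (`bijective_of_center`). For a deformation
`(I, λ)` this applies to `pr_A ∘ I` and to `λ`. Hence the image of `I` is the graph of a map `ξ :
A_v → B_v` with values in `𝔪 B_v`. Surjectivity of `λ` makes `ξ` linear over `R ⊗ v`, and since `𝔪`
is finite-dimensional such a map is an element of `Ω_A^1(B) ⊗ 𝔪` (`exists_hat_eq`,
`exists_isGraph`).

Expand the bracket of `a + ξ(a)` and `b + ξ(b)` in powers of `ξ`. The constant term has no `B`-part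
because `A` is a subalgebroid, and the terms of degrees one, two and three are those of the
Maurer-Cartan equation; the cubic one is `ξ(pr_A [jξ(a), jξ(b)])` up to sign. So the graph of `ξ` is
closed under the bracket exactly if `ξ` is Maurer-Cartan (`isMC_iff`). A closed graph inherits its
structure from `L_v`, which gives a deformation with `λ = id` (`mcInfDef`).

The image determines the deformation up to semistrict isomorphism. If `exp(ad_u)` maps the image of
`I'` into that of `I`, then `Π = I⁻¹ exp(ad_u) I'` and `μ = λ⁻¹ exp(ρ(u)) λ'` satisfy all conditions
on a morphism (`semistrictIso_of_forall_exists`). It remains to compare the action of `exp(ad_u)` on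
graphs with the gauge action. An element `δ + X` of degree zero enters the relevant brackets only
through the operator `δ + ad_{jX}`, which is inner, and every `ad_u` occurs (`exists_act_eq_brT`,
`exists_brT_eq_act`). If `D` denotes this operator and the flow `exp(tD)` carries the graph of `ξ`
to the graph of `y(t)`, then `y` solves the Riccati equation `y' = (p_B - y) D (p_A + y)`. The
recursion for the terms `e^k_ξ(b)` is the Taylor recursion of this equation for `y(t) = ξ - ∑ t^k/k!
e^k_ξ(b)`. Therefore `exp(D)` maps the graph of `ξ` to the graph of `e^b * ξ` (`IsRiccatiSeq.graph`,
`gauge_graph`). The series are finite because each application of `b` raises the `𝔪`-adic order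
(`hat_expTerm_mem_filt`).

Base change carries graphs to graphs, whence naturality. The `L∞`-identities of `𝔥₀` play no role,
and the argument takes place over an arbitrary commutative `K`-algebra `R` with `K` of
characteristic zero; the theorem is the case of smooth functions and sections. -/

instance finite (v : ArtAlg.{w, u} K) : Module.Finite K v := by
  -- An Artinian ring is finite over `K` as soon as its quotient by the Jacobson radical is. Here
  -- this quotient is the residue field, an image of `K`.
  have h : Module.Finite K (v ⧸ Ring.jacobson (v : Type u)) := by
    rw [← Ideal.jacobson_bot, IsLocalRing.jacobson_eq_maximalIdeal ⊥ bot_ne_top]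
    exact Module.Finite.of_surjective (Algebra.linearMap K (IsLocalRing.ResidueField v)) v.residue
  exact IsSemiprimaryRing.finite_of_isArtinian K (v : Type u) (v : Type u)

lemma exists_maximalIdeal_pow_eq_bot (v : ArtAlg.{w, u} K) :
    ∃ n, IsLocalRing.maximalIdeal (v : Type u) ^ n = ⊥ := by
  have h := IsArtinianRing.isNilpotent_jacobson_bot (R := (v : Type u))
  rwa [IsLocalRing.jacobson_eq_maximalIdeal ⊥ bot_ne_top] at h

end ArtAlg

/-! ### The `𝔪`-adic filtration -/

section Filtration

variable {K : Type w} [Field K] {v : ArtAlg.{w, u} K} {M N Q : Type u} [AddCommGroup M] [Module v M]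
  [AddCommGroup N] [Module v N] [AddCommGroup Q] [Module v Q]

/-- The submodule of those linear maps that take values in `𝔪 ^ k N`. -/
def filt (v : ArtAlg.{w, u} K) (M N : Type u) [AddCommGroup M] [Module v M] [AddCommGroup N]
    [Module v N] (k : ℕ) : Submodule v (M →ₗ[v] N) where
  carrier := {f | ∀ x, f x ∈ (IsLocalRing.maximalIdeal (v : Type u)) ^ k • (⊤ : Submodule v N)}
  add_mem' hf hg x := add_mem (hf x) (hg x)
  zero_mem' _ := zero_mem _
  smul_mem' c _ hf x := Submodule.smul_mem _ c (hf x)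

lemma mem_filt_zero (f : M →ₗ[v] N) : f ∈ filt v M N 0 := fun x => by simp

/-- By `v`-linearity `g` maps `𝔪 ^ l N` into `𝔪 ^ l g(N)`, so the orders add up. All nilpotency
statements below rest on this count. -/
lemma comp_mem_filt {k l : ℕ} {g : N →ₗ[v] Q} {f : M →ₗ[v] N} (hg : g ∈ filt v N Q k)
    (hf : f ∈ filt v M N l) : g ∘ₗ f ∈ filt v M Q (k + l) := fun x => by
  have h := Submodule.mem_map_of_mem (f := g) (hf x)
  rw [Submodule.map_smul''] at h
  rw [add_comm, pow_add, Submodule.mul_smul]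
  refine Submodule.smul_mono le_rfl ?_ h
  rintro _ ⟨y, -, rfl⟩
  exact hg y

lemma filt_antitone {k l : ℕ} (h : k ≤ l) : filt v M N l ≤ filt v M N k := fun _ hf x =>
  Submodule.smul_mono_left (Ideal.pow_le_pow_right h) (hf x)

variable (v) in
-- Any `n` with `𝔪 ^ n = 0` works for all modules at once, so one exponent serves for operators on
-- `v ⊗ L` and on `v ⊗ R` together.
lemma exists_filt_eq_zero : ∃ n, ∀ (M N : Type u) [AddCommGroup M] [Module v M] [AddCommGroup N]
    [Module v N], ∀ f ∈ filt v M N n, f = 0 := by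
  obtain ⟨n, hn⟩ := v.exists_maximalIdeal_pow_eq_bot
  refine ⟨n, fun M N _ _ _ _ f hf => LinearMap.ext fun x => ?_⟩
  have := hf x
  rw [hn] at this
  simpa using this

lemma pow_mem_filt {f : Module.End v M} (hf : f ∈ filt v M M 1) (k : ℕ) :
    f ^ k ∈ filt v M M k := by
  induction k with
  | zero => exact mem_filt_zero _
  | succ k ih => rw [pow_succ]; exact comp_mem_filt ih hf

lemma isNilpotent_of_mem_filt {f : Module.End v M} (hf : f ∈ filt v M M 1) : IsNilpotent f := by
  obtain ⟨n, hn⟩ := exists_filt_eq_zero v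
  exact ⟨n, hn _ _ _ (pow_mem_filt hf n)⟩

lemma isUnit_of_sub_one_mem_filt {f : Module.End v M} (hf : f - 1 ∈ filt v M M 1) : IsUnit f := by
  have := (isNilpotent_of_mem_filt hf).isUnit_one_add
  simpa using this

lemma bijective_of_sub_one_mem_filt {f : Module.End v M} (hf : f - 1 ∈ filt v M M 1) :
    Function.Bijective f :=
  (Module.End.isUnit_iff _).1 (isUnit_of_sub_one_mem_filt hf)

end Filtration

/-! ### Reduction modulo the maximal ideal -/

section Center

variable {K : Type w} [Field K] {v : ArtAlg.{w, u} K} {E F : Type u} [AddCommGroup E] [Module K E]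
  [AddCommGroup F] [Module K F]

lemma evT_smul (a : v) (x : v ⊗[K] E) : evT v E (a • x) = v.ev a • evT v E x := by
  induction x using TensorProduct.induction_on with
  | zero => simp
  | add x y hx hy => simp only [smul_add, map_add, hx, hy]
  | tmul b x => simp [TensorProduct.smul_tmul', mul_smul]

lemma evT_inclMax (x : v.maxIdeal ⊗[K] E) : evT v E (inclMax v E x) = 0 := by
  induction x using TensorProduct.induction_on with
  | zero => simp
  | add x y hx hy => simp only [map_add, hx, hy, add_zero]
  | tmul b x => simp [inclMax, (v.ev_eq_zero_iff _).2 b.2]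

lemma inclMax_smul_tmul (c : v.maxIdeal) (x : E) :
    inclMax v E (c ⊗ₜ x) = (c : v) • ((1 : v) ⊗ₜ[K] x) := by
  simp [inclMax, TensorProduct.smul_tmul']

/-- This is the splitting `v = 𝔪 ⊕ K`, tensored with `E`. -/
lemma exists_inclMax_add (x : v ⊗[K] E) :
    ∃ y : v.maxIdeal ⊗[K] E, inclMax v E y + 1 ⊗ₜ evT v E x = x := by
  induction x using TensorProduct.induction_on with
  | zero => exact ⟨0, by simp⟩
  | add x x' hx hx' =>
    obtain ⟨y, hy⟩ := hx
    obtain ⟨y', hy'⟩ := hx'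
    exact ⟨y + y', by
      conv_rhs => rw [← hy, ← hy']
      simp only [map_add, TensorProduct.tmul_add]; abel⟩
  | tmul a x =>
    have h : a - algebraMap K v (v.ev a) ∈ v.maxIdeal := by
      rw [← ArtAlg.ev_eq_zero_iff]; simp
    refine ⟨⟨_, h⟩ ⊗ₜ x, ?_⟩
    simp [inclMax, TensorProduct.sub_tmul, Algebra.algebraMap_eq_smul_one, TensorProduct.smul_tmul]

lemma exists_inclMax_of_evT_eq_zero {x : v ⊗[K] E} (h : evT v E x = 0) :
    ∃ y : v.maxIdeal ⊗[K] E, inclMax v E y = x := by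
  obtain ⟨y, hy⟩ := exists_inclMax_add x
  exact ⟨y, by simpa [h] using hy⟩

lemma inclMax_mem (x : v.maxIdeal ⊗[K] E) :
    inclMax v E x ∈ IsLocalRing.maximalIdeal (v : Type u) ^ 1 • (⊤ : Submodule v (v ⊗[K] E)) := by
  induction x using TensorProduct.induction_on with
  | zero => simp
  | add x y hx hy => rw [map_add]; exact add_mem hx hy
  | tmul c x =>
    rw [inclMax_smul_tmul, pow_one]
    exact Submodule.smul_mem_smul c.2 trivial

lemma mem_of_evT_eq_zero {x : v ⊗[K] E} (h : evT v E x = 0) :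
    x ∈ IsLocalRing.maximalIdeal (v : Type u) ^ 1 • (⊤ : Submodule v (v ⊗[K] E)) := by
  obtain ⟨y, rfl⟩ := exists_inclMax_of_evT_eq_zero h
  exact inclMax_mem y

lemma evT_eq_zero_of_mem {x : v ⊗[K] E}
    (h : x ∈ IsLocalRing.maximalIdeal (v : Type u) ^ 1 • (⊤ : Submodule v (v ⊗[K] E))) :
    evT v E x = 0 := by
  rw [pow_one] at h
  refine Submodule.smul_induction_on h (fun c hc y _ => ?_) fun x y hx hy => ?_
  · rw [evT_smul, (v.ev_eq_zero_iff c).2 hc, zero_smul]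
  · rw [map_add, hx, hy, add_zero]

/-- A linear map that vanishes on the center takes values in `𝔪 F`. -/
lemma mem_filt_one {f : v ⊗[K] E →ₗ[v] v ⊗[K] F} :
    f ∈ filt v (v ⊗[K] E) (v ⊗[K] F) 1 ↔ ∀ e, evT v F (f (1 ⊗ₜ e)) = 0 := by
  refine ⟨fun h e => evT_eq_zero_of_mem (h _), fun h x => ?_⟩
  induction x using tind with
  | one e => exact mem_of_evT_eq_zero (h e)
  | add x y hx hy => rw [map_add]; exact add_mem hx hy
  | smul a x hx => rw [map_smul]; exact Submodule.smul_mem _ a hx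

lemma evT_map_of_center {f : v ⊗[K] E →ₗ[v] v ⊗[K] F} {g : E →ₗ[K] F}
    (h : ∀ e, evT v F (f (1 ⊗ₜ e)) = g e) (x : v ⊗[K] E) : evT v F (f x) = g (evT v E x) := by
  induction x using tind with
  | one e => simp [h]
  | add x y hx hy => simp only [map_add, hx, hy]
  | smul a x hx => simp only [map_smul, evT_smul, hx]

lemma evT_baseChange (g : E →ₗ[K] F) (x : v ⊗[K] E) :
    evT v F (g.baseChange v x) = g (evT v E x) :=
  evT_map_of_center (fun e => by simp) x

/-- The difference `f - 1` takes values in `𝔪`, hence is nilpotent, and `f` is a unit. This replaces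
every inverse function argument below: for `λ`, for `pr_A ∘ I`, for `exp(ρ(u))` and for moved
graphs. -/
lemma bijective_of_center {f : Module.End v (v ⊗[K] E)} (h : ∀ e, evT v E (f (1 ⊗ₜ e)) = e) :
    Function.Bijective f :=
  bijective_of_sub_one_mem_filt (mem_filt_one.2 fun e => by simp [h])

end Center

/-! ### Exponentials of derivations -/

section Exp

variable {K : Type w} [Field K] [CharZero K] {v : ArtAlg.{w, u} K} {E F G : Type u}
  [AddCommGroup E] [Module K E] [AddCommGroup F] [Module K F] [AddCommGroup G] [Module K G]

lemma expSum_sub_one_mem_filt {T : Module.End v (v ⊗[K] E)} (hT : T ∈ filt v _ _ 1) {N : ℕ}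
    (hN : T ^ N = 0) : expSum T N - 1 ∈ filt v (v ⊗[K] E) (v ⊗[K] E) 1 := by
  cases N with
  | zero =>
    -- For `N = 0` the empty sum is not the exponential, but then `T ^ 0 = 0` says that the
    -- endomorphism ring is trivial.
    have : (1 : Module.End v (v ⊗[K] E)) = 0 := by simpa using hN
    rw [← mul_one (expSum T 0 - 1), this, mul_zero]
    exact zero_mem _
  | succ N =>
    rw [expSum, Finset.sum_range_succ']
    simp only [Nat.factorial_zero, Nat.cast_one, inv_one, map_one, pow_zero, one_smul]
    rw [add_sub_cancel_right (G := Module.End v (v ⊗[K] E))]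
    exact sum_mem fun k _ => Submodule.smul_mem _ _
      (filt_antitone (Nat.le_add_left 1 k) (pow_mem_filt hT (k + 1)))

/-- The Leibniz rule says that `β`, as a map on `M ⊗ N`, intertwines `T₁ ⊗ 1 + 1 ⊗ T₂` with `T₃`.
The two summands commute, so the exponential of their sum is `exp T₁ ⊗ exp T₂`. Applied to the
bracket, the module action, the anchor pairing and the product of functions, this makes the
exponential of an inner derivation an automorphism of all the structure. -/
lemma exp_bilin {V M N Q : Type u} [CommRing V] [AddCommGroup M] [Module V M] [AddCommGroup N]
    [Module V N] [AddCommGroup Q] [Module V Q] [Module ℚ M] [Module ℚ N] [Module ℚ Q]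
    (β : M →ₗ[V] N →ₗ[V] Q) {T₁ : Module.End V M} {T₂ : Module.End V N} {T₃ : Module.End V Q}
    (h : ∀ x y, T₃ (β x y) = β (T₁ x) y + β x (T₂ y)) (n₁ : IsNilpotent T₁) (n₂ : IsNilpotent T₂)
    (n₃ : IsNilpotent T₃) (x : M) (y : N) :
    IsNilpotent.exp T₃ (β x y) = β (IsNilpotent.exp T₁ x) (IsNilpotent.exp T₂ y) := by
  set DL : Module.End V (M ⊗[V] N) := T₁.rTensor N
  set DR : Module.End V (M ⊗[V] N) := T₂.lTensor M
  have nL : IsNilpotent DL := n₁.map (Module.End.rTensorAlgHom V M N)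
  have nR : IsNilpotent DR := n₂.map (Module.End.lTensorAlgHom V N M)
  have hc : Commute DL DR := TensorProduct.ext' fun x y => rfl
  have e₁ : IsNilpotent.exp DL = (IsNilpotent.exp T₁).rTensor N :=
    (n₁.map_exp (Module.End.rTensorAlgHom V M N)).symm
  have e₂ : IsNilpotent.exp DR = (IsNilpotent.exp T₂).lTensor M :=
    (n₂.map_exp (Module.End.lTensorAlgHom V N M)).symm
  have key : IsNilpotent.exp T₃ ∘ₗ TensorProduct.lift β =
      TensorProduct.lift β ∘ₗ IsNilpotent.exp (DL + DR) :=
    Module.End.commute_exp_left_of_commute (hc.isNilpotent_add nL nR) n₃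
      (TensorProduct.ext' fun x y => by simp [DL, DR, h])
  have := LinearMap.congr_fun key (x ⊗ₜ[V] y)
  simpa [IsNilpotent.exp_add_of_commute hc nL nR, e₁, e₂] using this

/-- The rational vector space underlying a module over a local Artinian algebra. -/
abbrev ratModule (v : ArtAlg.{w, u} K) (X : Type u) [AddCommGroup X] [Module v X] : Module ℚ X :=
  Module.compHom X ((algebraMap K v).comp (algebraMap ℚ K))

/-- The coefficients lie in `K` on the left and in `ℚ` on the right; both invert multiplication by
the natural number `k!`. -/
lemma expSum_eq_exp [Module ℚ (v ⊗[K] E)] {T : Module.End v (v ⊗[K] E)} {N : ℕ} (hT : T ^ N = 0) :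
    expSum T N = IsNilpotent.exp T := by
  rw [IsNilpotent.exp_eq_sum hT, expSum]
  refine Finset.sum_congr rfl fun k _ => LinearMap.ext fun x => ?_
  rw [LinearMap.smul_apply, LinearMap.smul_apply, algebraMap_smul]
  have h : (k.factorial : K) ≠ 0 := by exact_mod_cast k.factorial_ne_zero
  have h' : (k.factorial : ℚ) ≠ 0 := by exact_mod_cast k.factorial_ne_zero
  rw [inv_smul_eq_iff₀ h, Nat.cast_smul_eq_nsmul, ← Nat.cast_smul_eq_nsmul ℚ, smul_inv_smul₀ h']

lemma expSum_bilin (β : v ⊗[K] E →ₗ[v] v ⊗[K] F →ₗ[v] v ⊗[K] G) {T₁ : Module.End v (v ⊗[K] E)}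
    {T₂ : Module.End v (v ⊗[K] F)} {T₃ : Module.End v (v ⊗[K] G)}
    (h : ∀ x y, T₃ (β x y) = β (T₁ x) y + β x (T₂ y)) {N : ℕ} (h₁ : T₁ ^ N = 0) (h₂ : T₂ ^ N = 0)
    (h₃ : T₃ ^ N = 0) (x : v ⊗[K] E) (y : v ⊗[K] F) :
    expSum T₃ N (β x y) = β (expSum T₁ N x) (expSum T₂ N y) := by
  let _ : Module ℚ (v ⊗[K] E) := ratModule v _
  let _ : Module ℚ (v ⊗[K] F) := ratModule v _
  let _ : Module ℚ (v ⊗[K] G) := ratModule v _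
  rw [expSum_eq_exp h₁, expSum_eq_exp h₂, expSum_eq_exp h₃]
  exact exp_bilin β h ⟨N, h₁⟩ ⟨N, h₂⟩ ⟨N, h₃⟩ x y

end Exp

/-! ### The Riccati equation of a flow of graphs -/

section Riccati

open Polynomial

variable {K : Type w} [Field K] [CharZero K] {S : Type u} [Ring S]

/-- The polynomial with given coefficients up to order `N`. -/
def polyOf (a : ℕ → S) (N : ℕ) : S[X] := ∑ k ∈ Finset.range N, monomial k (a k)

lemma coeff_polyOf {a : ℕ → S} {N : ℕ} (h : ∀ k, N ≤ k → a k = 0) (k : ℕ) :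
    (polyOf a N).coeff k = a k := by
  rw [polyOf, finsetSum_coeff]
  simp only [coeff_monomial, Finset.sum_ite_eq', Finset.mem_range]
  split_ifs with hk
  · rfl
  · exact (h k (not_lt.1 hk)).symm

/-- Evaluation at the central element `1`. -/
def evalOne : S[X] →+* S := eval₂RingHom' (RingHom.id S) 1 fun a => Commute.one_right a

lemma evalOne_C (a : S) : evalOne (C a) = a := by simp [evalOne]

lemma evalOne_polyOf (a : ℕ → S) (N : ℕ) : evalOne (polyOf a N) = ∑ k ∈ Finset.range N, a k := by
  rw [polyOf, map_sum]
  exact Finset.sum_congr rfl fun k _ => by simp [evalOne]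

/-- Uniqueness for a linear differential equation: the coefficient of order `n + 1` of `Z`, times `n
+ 1`, is a combination of the lower ones. The ring `S` need not be commutative, but the polynomial
variable is central. -/
lemma eq_zero_of_derivative_eq_mul (K : Type w) [Field K] [CharZero K] [Algebra K S] {M Z : S[X]}
    (h : derivative Z = M * Z)
    (h0 : Z.coeff 0 = 0) : Z = 0 := by
  ext n
  rw [coeff_zero]
  induction n using Nat.strong_induction_on with
  | _ n ih =>
    cases n with
    | zero => exact h0
    | succ n =>
      have h1 := congrArg (fun p => coeff p n) h
      simp only [coeff_derivative, coeff_mul] at h1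
      rw [Finset.sum_eq_zero] at h1
      · have h2 : ((n : K) + 1) • Z.coeff (n + 1) = 0 := by
          rw [← h1, Algebra.smul_def, Algebra.commutes, map_add, map_natCast, map_one]
        exact (smul_eq_zero.1 h2).resolve_left (by exact_mod_cast n.succ_ne_zero)
      · intro ij hij
        rw [ih _ (by have := Finset.HasAntidiagonal.mem_antidiagonal.1 hij; omega), mul_zero]

variable [Algebra K S]

lemma factorial_succ_inv_smul (k : ℕ) (x : S) :
    ((k + 1).factorial : K)⁻¹ • x * ((k : S) + 1) = (k.factorial : K)⁻¹ • x := by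
  have h : (k : S) + 1 = algebraMap K S (k + 1) := by simp
  have h1 : ((k : K) + 1) ≠ 0 := by exact_mod_cast k.succ_ne_zero
  rw [h, ← Algebra.commutes, ← Algebra.smul_def, smul_smul, Nat.factorial_succ]
  push_cast
  rw [mul_inv, mul_inv_cancel_left₀ h1]

/-- The terms of the exponential series of the gauge action, as a sequence in a ring. -/
structure IsRiccatiSeq (K : Type w) [Field K] {S : Type u} [Ring S] [Algebra K S]
    (pA pB δ x : S) (e : ℕ → S) : Prop where
  zero : e 0 = 0
  succ : ∀ k, e (k + 1) = (if k = 0 then -((pB - x) * δ * (pA + x)) else 0) +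
    ((pB - x) * δ * e k - e k * δ * (pA + x)) +
    (2 : K)⁻¹ • ∑ i : Fin (k + 1), (k.choose i : K) • (e i * δ * e (k - i) + e (k - i) * δ * e i)

variable {pA pB δ x : S} {e : ℕ → S}

variable (K) in
-- The binomial sum of the gauge recursion is a Cauchy product of exponential generating series. The
-- factor `1/2` cancels against the symmetrization, as the reflection of the index range exchanges
-- the two summands.
lemma sum_choose_symm (a : ℕ → ℕ → S) (k : ℕ) :
    (k.factorial : K)⁻¹ • (2 : K)⁻¹ • ∑ i : Fin (k + 1), (k.choose i : K) •
      (a i (k - i) + a (k - i) i) =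
    ∑ ij ∈ Finset.HasAntidiagonal.antidiagonal k, (ij.1.factorial : K)⁻¹ • (ij.2.factorial : K)⁻¹ •
      a ij.1 ij.2 := by
  have h1 : ∑ i : Fin (k + 1), (k.choose i : K) • (a i (k - i) + a (k - i) i) =
      ∑ ij ∈ Finset.HasAntidiagonal.antidiagonal k,
        (k.choose ij.1 : K) • (a ij.1 ij.2 + a ij.2 ij.1) := by
    rw [Finset.Nat.sum_antidiagonal_eq_sum_range_succ_mk, Finset.sum_range]
  have h2 : ∑ ij ∈ Finset.HasAntidiagonal.antidiagonal k, (k.choose ij.1 : K) • a ij.2 ij.1 =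
      ∑ ij ∈ Finset.HasAntidiagonal.antidiagonal k, (k.choose ij.1 : K) • a ij.1 ij.2 := by
    rw [← Finset.Nat.sum_antidiagonal_swap]
    refine Finset.sum_congr rfl fun ij hij => ?_
    rw [Prod.fst_swap, Prod.snd_swap, Nat.choose_symm_of_eq_add
      (show k = ij.2 + ij.1 by have := Finset.HasAntidiagonal.mem_antidiagonal.1 hij; omega)]
  rw [h1]
  simp only [smul_add, Finset.sum_add_distrib]
  rw [h2, ← smul_add, ← two_smul K, smul_inv_smul₀ two_ne_zero,
    Finset.smul_sum]
  refine Finset.sum_congr rfl fun ij hij => ?_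
  have hk := Finset.HasAntidiagonal.mem_antidiagonal.1 hij
  rw [smul_smul, smul_smul]
  congr 1
  have hc : (k.choose ij.1 : K) * ij.1.factorial * ij.2.factorial = k.factorial := by
    have := Nat.choose_mul_factorial_mul_factorial (show ij.1 ≤ k by omega)
    rw [show k - ij.1 = ij.2 by omega] at this
    exact_mod_cast this
  have f1 : (k.factorial : K) ≠ 0 := by exact_mod_cast k.factorial_ne_zero
  have f2 : (ij.1.factorial : K) ≠ 0 := by exact_mod_cast ij.1.factorial_ne_zero
  have f3 : (ij.2.factorial : K) ≠ 0 := by exact_mod_cast ij.2.factorial_ne_zero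
  rw [inv_mul_eq_iff_eq_mul₀ f1, ← hc]
  field_simp

/-- The exponential of `δ` maps the graph of `x` to the graph of the sum of the gauge series. -/
lemma IsRiccatiSeq.graph (he : IsRiccatiSeq K pA pB δ x e) (hsum : pA + pB = 1)
    (hBA : pB * pA = 0) (hAB : pA * pB = 0) (hBx : pB * x = x) (hxA : x * pA = x) {N N' : ℕ}
    (hN : ∀ k, N ≤ k → e k = 0) (hN' : δ ^ N' = 0) :
    (pB - (x - ∑ k ∈ Finset.range N, (k.factorial : K)⁻¹ • e k)) *
      ((∑ k ∈ Finset.range N', (k.factorial : K)⁻¹ • δ ^ k) * (pA + x)) = 0 := by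
  -- With `t` the polynomial variable, `E` is the gauge series at time `t` and `T` is `exp(tδ)`. The
  -- curve of graphs is `y = x - E`.
  set E : S[X] := polyOf (fun k => (k.factorial : K)⁻¹ • e k) N with hE
  set T : S[X] := polyOf (fun k => (k.factorial : K)⁻¹ • δ ^ k) N' with hT
  have cE : ∀ k, E.coeff k = (k.factorial : K)⁻¹ • e k :=
    coeff_polyOf fun k hk => by rw [hN k hk, smul_zero]
  have cT : ∀ k, T.coeff k = (k.factorial : K)⁻¹ • δ ^ k :=
    coeff_polyOf fun k hk => by rw [pow_eq_zero_of_le hk hN', smul_zero]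
  have dT : derivative T = C δ * T := by
    ext k
    rw [coeff_derivative, coeff_C_mul, cT, cT, factorial_succ_inv_smul, pow_succ', mul_smul_comm]
  -- The Riccati equation `y' = (pB - y) δ (pA + y)` for `y = x - E`. Its parts of degree zero, one
  -- and two in `E` are the three summands of the recursion.
  have dE : derivative E = -((C pB - C x + E) * C δ * (C pA + C x - E)) := by
    have : -((C pB - C x + E) * C δ * (C pA + C x - E)) =
        C (-((pB - x) * δ * (pA + x))) + (C ((pB - x) * δ) * E - E * C (δ * (pA + x))) +
          E * (C δ * E) := by
      simp only [C_neg, C_mul, C_add, C_sub]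
      noncomm_ring
    rw [this]
    ext k
    rw [coeff_derivative, cE, factorial_succ_inv_smul, he.succ, coeff_add, coeff_add, coeff_sub,
      coeff_C_mul, coeff_mul_C, coeff_mul, smul_add, smul_add, sum_choose_symm K
        (fun i l => e i * δ * e l), coeff_C]
    congr 1
    · congr 1
      · split_ifs with h
        · subst h; simp
        · simp
      · rw [cE, smul_sub, mul_smul_comm, smul_mul_assoc, mul_assoc (e k)]
    · refine Finset.sum_congr rfl fun ij _ => ?_
      rw [coeff_C_mul, cE, cE, mul_smul_comm, mul_smul_comm, smul_mul_assoc, smul_comm, mul_assoc]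
  -- The defect `Z` measures how far the flow of the graph of `x` is from the graph of `y`. The
  -- Riccati equation and `1 - pA = pB` turn its derivative into `(pB - y) δ Z`.
  have hZ : (C pB - (C x - E)) * (T * C (pA + x)) = 0 := by
    refine eq_zero_of_derivative_eq_mul K (M := (C pB - (C x - E)) * C δ) ?_ ?_
    · have h1 : (1 : S[X]) = C pA + C pB := by rw [← C_1, ← hsum, C_add]
      have h2 : derivative ((C pB - (C x - E)) * (T * C (pA + x))) =
          (C pB - (C x - E)) * C δ * ((1 - C pA - C x + E) * (T * C (pA + x))) := by
        rw [derivative_mul, derivative_mul, derivative_sub, derivative_sub, derivative_C,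
          derivative_C, derivative_C, dT, dE, C_add]
        noncomm_ring
      rw [h2, show 1 - C pA - C x + E = C pB - (C x - E) by rw [h1]; abel, mul_assoc (C pB - _)]
    -- At time zero the defect is `(pB - x)(pA + x)`. It vanishes since `x` maps into the `B`-part,
    -- which it annihilates.
    · have hxx : x * x = 0 := by
        nth_rw 1 [← hxA]
        rw [← hBx, mul_assoc, ← mul_assoc pA, hAB, zero_mul, mul_zero]
      rw [mul_coeff_zero, mul_coeff_zero, coeff_C_zero, cT]
      simp only [coeff_sub, coeff_C_zero, cE, he.zero, smul_zero, sub_zero, Nat.factorial_zero,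
        Nat.cast_one, inv_one, pow_zero, one_smul, one_mul]
      rw [sub_mul, mul_add, mul_add, hBA, hBx, hxA, hxx]
      abel
  -- The time-one flow.
  have := congrArg evalOne hZ
  simpa only [map_mul, map_sub, evalOne_C, hE, hT, evalOne_polyOf, map_zero] using this

end Riccati

/-! ### The brackets of `𝔥₀` in low degrees -/

section Evaluation

variable {K : Type w} [Field K] [CharZero K] {R : Type u} [CommRing R] [Algebra K R]
  {A L : Type u} [AddCommGroup A] [Module K A] [Module R A] [IsScalarTower K R A]
  [AddCommGroup L] [Module K L] [Module R L] [IsScalarTower K R L]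
  {P : LiePair K R A L} (j : Splitting P)

lemma castF_apply {m s : ℕ} (h : m = s) (X : Form P m) (a : Fin s → A) :
    castF m s X a = X (a ∘ Fin.cast h) := by
  subst h
  simp [castF]

/-! ### Shuffle sums with at most two arguments -/

section shSum

variable {N : Type u} [AddCommGroup N] [Module K N] [Module R N] [IsScalarTower K R N]

lemma shSum_apply {p q : ℕ} (G : MultilinearMap R (fun _ : Fin p ⊕ Fin q => A) N)
    (a : Fin (p + q) → A) :
    shSum (K := K) G a = ((p.factorial * q.factorial : ℕ) : K)⁻¹ •
      ∑ σ : Equiv.Perm (Fin p ⊕ Fin q), Equiv.Perm.sign σ •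
        G fun k => a (finSumFinEquiv (σ k)) := by
  simp [shSum, MultilinearMap.alternatization_apply]

lemma shSum_zero_one (G : MultilinearMap R (fun _ : Fin 0 ⊕ Fin 1 => A) N)
    (a : Fin (0 + 1) → A) : shSum (K := K) G a = G fun _ => a 0 := by
  rw [shSum_apply, show (Finset.univ : Finset (Equiv.Perm (Fin 0 ⊕ Fin 1))) = {1} by decide]
  simp only [Finset.sum_singleton, Equiv.Perm.sign_one, one_smul, Nat.factorial, Nat.cast_one,
    mul_one, Nat.succ_eq_add_one, zero_add, inv_one]
  exact congrArg G (funext fun k => congrArg a (Subsingleton.elim (α := Fin 1) _ _))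

lemma shSum_one_zero (G : MultilinearMap R (fun _ : Fin 1 ⊕ Fin 0 => A) N)
    (a : Fin (1 + 0) → A) : shSum (K := K) G a = G fun _ => a 0 := by
  rw [shSum_apply, show (Finset.univ : Finset (Equiv.Perm (Fin 1 ⊕ Fin 0))) = {1} by decide]
  simp only [Finset.sum_singleton, Equiv.Perm.sign_one, one_smul, Nat.factorial, Nat.cast_one,
    mul_one, Nat.succ_eq_add_one, zero_add, inv_one]
  exact congrArg G (funext fun k => congrArg a (Subsingleton.elim (α := Fin 1) _ _))

lemma shSum_one_one (G : MultilinearMap R (fun _ : Fin 1 ⊕ Fin 1 => A) N)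
    (a : Fin (1 + 1) → A) : shSum (K := K) G a =
      G (Sum.elim (fun _ => a 0) fun _ => a 1) - G (Sum.elim (fun _ => a 1) fun _ => a 0) := by
  rw [shSum_apply, show (Finset.univ : Finset (Equiv.Perm (Fin 1 ⊕ Fin 1))) =
    {1, Equiv.swap (.inl 0) (.inr 0)} by decide, Finset.sum_pair (by decide)]
  simp only [Equiv.Perm.sign_one, one_smul, Nat.factorial, Nat.cast_one,
    mul_one, Nat.succ_eq_add_one, zero_add, inv_one]
  rw [Equiv.Perm.sign_swap (by decide), Units.neg_smul, one_smul, sub_eq_add_neg]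
  congr 2
  · funext k
    rcases k with k | k <;> fin_cases k <;> rfl
  · refine congrArg G (funext fun k => ?_)
    rcases k with k | k <;> fin_cases k <;> rfl

/-- `G` is not assumed alternating in its first group, so both permutations and the factor `1/2!`
remain; they cancel in `ins_two_one`. -/
lemma shSum_two_zero (G : MultilinearMap R (fun _ : Fin 2 ⊕ Fin 0 => A) N)
    (a : Fin (2 + 0) → A) : shSum (K := K) G a = (2 : K)⁻¹ •
      (G (Sum.elim ![a 0, a 1] Fin.elim0) - G (Sum.elim ![a 1, a 0] Fin.elim0)) := by
  rw [shSum_apply, show (Finset.univ : Finset (Equiv.Perm (Fin 2 ⊕ Fin 0))) =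
    {1, Equiv.swap (.inl 0) (.inl 1)} by decide, Finset.sum_pair (by decide)]
  simp only [Equiv.Perm.sign_one, one_smul, Nat.factorial, mul_one,
    Nat.succ_eq_add_one, zero_add, one_add_one_eq_two, Nat.cast_ofNat]
  rw [Equiv.Perm.sign_swap (by decide), Units.neg_smul, one_smul, sub_eq_add_neg]
  congr 3
  · funext k
    rcases k with k | k <;> fin_cases k <;> rfl
  · refine congrArg G (funext fun k => ?_)
    rcases k with k | k <;> fin_cases k <;> rfl

end shSum

/-- A form of degree one, as a linear map. -/
def form1 (P : LiePair K R A L) : Form P 1 →ₗ[K] A →ₗ[R] P.B where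
  toFun X := (AlternatingMap.ofSubsingleton R A P.B (0 : Fin 1)).symm X
  map_add' _ _ := rfl
  map_smul' _ _ := rfl

lemma apply_eq_form1 (X : Form P 1) (a : Fin 1 → A) : X a = form1 P X (a 0) := by
  change X a = X fun _ => a 0
  exact congrArg X (funext fun k => congrArg a (Subsingleton.elim _ _))

/-- The value of a form of degree zero. -/
def form0 (P : LiePair K R A L) : Form P 0 →ₗ[K] P.B where
  toFun X := X ![]
  map_add' _ _ := rfl
  map_smul' _ _ := rfl

lemma apply_eq_form0 (X : Form P 0) (a : Fin 0 → A) : X a = form0 P X :=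
  congrArg X (Subsingleton.elim _ _)

lemma formBr2_zero_one (X : Form P 0) (Y : Form P 1) (a : Fin (0 + 1) → A) :
    formBr2 j 0 1 X Y a = prB P (P.algL.bracket (j.j (form0 P X)) (j.j (form1 P Y (a 0)))) -
      form1 P Y (prA j (P.algL.bracket (j.j (form0 P X)) (P.incl (a 0)))) := by
  refine (shSum_zero_one _ _).trans ?_
  change pairFun j X Y _ _ = _
  simp [pairFun, slotJ, apply_eq_form0, apply_eq_form1]

lemma formBr2_one_zero (X : Form P 1) (Y : Form P 0) (a : Fin (1 + 0) → A) :
    formBr2 j 1 0 X Y a = -(prB P (P.algL.bracket (j.j (form0 P Y)) (j.j (form1 P X (a 0)))) -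
      form1 P X (prA j (P.algL.bracket (j.j (form0 P Y)) (P.incl (a 0))))) := by
  refine (shSum_one_zero _ _).trans ?_
  change pairFun j X Y _ _ = _
  rw [pairFun_symm]
  simp [pairFun, slotJ, apply_eq_form0, apply_eq_form1]

lemma formBr2_one_one (X Y : Form P 1) (a : Fin (1 + 1) → A) :
    formBr2 j 1 1 X Y a =
      (prB P (P.algL.bracket (j.j (form1 P X (a 0))) (j.j (form1 P Y (a 1)))) -
        form1 P Y (prA j (P.algL.bracket (j.j (form1 P X (a 0))) (P.incl (a 1)))) +
        form1 P X (prA j (P.algL.bracket (j.j (form1 P Y (a 1))) (P.incl (a 0))))) -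
      (prB P (P.algL.bracket (j.j (form1 P X (a 1))) (j.j (form1 P Y (a 0)))) -
        form1 P Y (prA j (P.algL.bracket (j.j (form1 P X (a 1))) (P.incl (a 0)))) +
        form1 P X (prA j (P.algL.bracket (j.j (form1 P Y (a 0))) (P.incl (a 1))))) := by
  refine (shSum_one_one _ _).trans ?_
  change pairFun j X Y _ _ - pairFun j X Y _ _ = _
  simp [pairFun, slotJ, apply_eq_form1]

lemma wedgeA_zero_one (X : Form P 0) (Y : Form P 1) (a : Fin (0 + 1) → A) :
    wedgeA j 0 1 X Y a =
      prA j (P.algL.bracket (j.j (form0 P X)) (j.j (form1 P Y (a 0)))) := by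
  refine (shSum_zero_one _ _).trans ?_
  change prA j (P.algL.bracket (j.j (X _)) (j.j (Y _))) = _
  simp [apply_eq_form0, apply_eq_form1]

lemma wedgeA_one_zero (X : Form P 1) (Y : Form P 0) (a : Fin (1 + 0) → A) :
    wedgeA j 1 0 X Y a =
      -prA j (P.algL.bracket (j.j (form0 P Y)) (j.j (form1 P X (a 0)))) := by
  refine (shSum_one_zero _ _).trans ?_
  change prA j (P.algL.bracket (j.j (X _)) (j.j (Y _))) = _
  rw [P.algL.skew]
  simp [apply_eq_form0, apply_eq_form1]

lemma wedgeA_one_one (X Y : Form P 1) (a : Fin (1 + 1) → A) :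
    wedgeA j 1 1 X Y a =
      prA j (P.algL.bracket (j.j (form1 P X (a 0))) (j.j (form1 P Y (a 1)))) -
      prA j (P.algL.bracket (j.j (form1 P X (a 1))) (j.j (form1 P Y (a 0)))) := by
  refine (shSum_one_one _ _).trans ?_
  change prA j (P.algL.bracket (j.j (X _)) (j.j (Y _))) -
    prA j (P.algL.bracket (j.j (X _)) (j.j (Y _))) = _
  simp [apply_eq_form1]

lemma ins_one_one (φ : A [⋀^Fin 1]→ₗ[R] A) (Z : Form P 1) (a : Fin 1 → A) :
    ins P 1 1 1 φ Z a = form1 P Z (φ a) := by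
  change castF (1 + 0) 1 (insSucc P 1 0 φ Z) a = _
  rw [castF_apply rfl]
  refine (shSum_one_zero _ _).trans ?_
  change Z (Fin.cons (φ _) _) = _
  rw [apply_eq_form1, Fin.cons_zero]
  congr 2
  exact funext fun k => congrArg a (Subsingleton.elim _ _)

lemma ins_two_one (φ : A [⋀^Fin 2]→ₗ[R] A) (Z : Form P 1) (a : Fin 2 → A) :
    ins P 2 1 2 φ Z a = form1 P Z (φ a) := by
  change castF (2 + 0) 2 (insSucc P 2 0 φ Z) a = _
  rw [castF_apply rfl]
  refine (shSum_two_zero _ _).trans ?_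
  change (2 : K)⁻¹ • (Z (Fin.cons (φ ![a 0, a 1]) _) - Z (Fin.cons (φ ![a 1, a 0]) _)) = _
  rw [apply_eq_form1, apply_eq_form1, Fin.cons_zero, Fin.cons_zero]
  have h1 : ![a 0, a 1] = a := by ext i; fin_cases i <;> rfl
  have h2 : ![a 1, a 0] = a ∘ Equiv.swap 0 1 := by ext i; fin_cases i <;> rfl
  rw [h2, h1, φ.map_swap _ (by decide), map_neg, sub_neg_eq_add, ← two_smul K,
    inv_smul_smul₀ two_ne_zero]

lemma derA_apply {p : ℕ} (δ : der P) (X : Form P p) (a : Fin p → A) :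
    derA j p δ X a = prA j ((δ : Module.End K L) (j.j (X a))) := rfl

/-- The operator on `Γ(L)` through which an element of degree zero acts. -/
def derOp : HV P 0 →ₗ[K] Module.End K L :=
  (der P).subtype ∘ₗ (hDer P 0).subtype ∘ₗ LinearMap.fst K _ _ +
    P.algL.bracket ∘ₗ j.j.restrictScalars K ∘ₗ form0 P ∘ₗ LinearMap.snd K _ _

lemma derOp_apply (b : HV P 0) (x : L) : derOp j b x =
    ((b.1 : der P) : Module.End K L) x + P.algL.bracket (j.j (form0 P b.2)) x := rfl

lemma hDer_one_eq_zero (δ : hDer P 1) : (δ : der P) = 0 := by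
  simpa [hDer] using δ.2

/-- In degree zero the Lie derivative and the Bott connection coincide, which absorbs the factor
`1/2`. Written with `j X` as the first argument of the bracket, the result has the same shape as
`[δ]₁` for `δ = ad_{jX}`. -/
lemma dCE_zero_apply (X : Form P 0) (a : Fin (0 + 1) → A) :
    dCE j 0 X a = -prB P (P.algL.bracket (j.j (form0 P X)) (P.incl (a 0))) := by
  refine (dCE_apply j X a).trans ((Fin.sum_univ_one _).trans ?_)
  rw [Fin.val_zero, pow_zero, one_smul, derAct_apply, apply_eq_form0, Fin.sum_univ_zero, sub_zero,
    bott_apply, ad_apply, ← two_smul K, inv_smul_smul₀ two_ne_zero, P.algL.skew, map_neg]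

/-- The first of several formulas showing that `b = δ + X` enters only through the operator `δ +
ad_{jX}`. The axioms of graded skew-symmetry are not part of `CubicBrackets`, so every order of
arguments that occurs in the twisted brackets is evaluated separately. -/
lemma form1_hBr1 (b : HV P 0) (a : A) :
    form1 P (hBr1 j 0 1 b).2 a = -prB P (derOp j b (P.incl a)) := by
  change castF 1 1 (derB1 b.1) (fun _ => a) + castF (0 + 1) 1 (dCE j 0 b.2) (fun _ => a) = _
  rw [castF_apply rfl, castF_apply rfl, dCE_zero_apply, derOp_apply, map_add, neg_add]
  rfl

lemma form1_hBr2_zero_one (b : HV P 0) (x : HV P 1) (a : A) :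
    form1 P (hBr2 j 0 1 1 rfl b x).2 a = prB P (derOp j b (j.j (form1 P x.2 a))) -
      form1 P x.2 (prA j (derOp j b (P.incl a))) := by
  change castF 1 1 (derAct j 1 b.1 x.2) (fun _ => a) - castF 0 1 (derAct j 0 x.1 b.2) (fun _ => a) +
    castF (0 + 1) 1 (formBr2 j 0 1 b.2 x.2) (fun _ => a) = _
  rw [castF_apply rfl, castF_apply rfl, formBr2_zero_one, hDer_one_eq_zero]
  simp [derAct_apply, apply_eq_form1, derOp_apply]
  abel

lemma form1_hBr2_one_zero (b : HV P 0) (x : HV P 1) (a : A) :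
    form1 P (hBr2 j 1 0 1 rfl x b).2 a = -(prB P (derOp j b (j.j (form1 P x.2 a))) -
      form1 P x.2 (prA j (derOp j b (P.incl a)))) := by
  change castF 0 1 (derAct j 0 x.1 b.2) (fun _ => a) - castF 1 1 (derAct j 1 b.1 x.2) (fun _ => a) +
    castF (1 + 0) 1 (formBr2 j 1 0 x.2 b.2) (fun _ => a) = _
  rw [castF_apply rfl, castF_apply rfl, formBr2_one_zero, hDer_one_eq_zero]
  simp [derAct_apply, apply_eq_form1, derOp_apply]
  abel

lemma ins_derA (δ : der P) (X Y : Form P 1) (a : A) :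
    ins P 1 1 1 (derA j 1 δ X) Y (fun _ => a) =
      form1 P Y (prA j ((δ : Module.End K L) (j.j (form1 P X a)))) := by
  rw [ins_one_one, derA_apply, apply_eq_form1]

lemma derBr3_one_one (δ : der P) (X Y : Form P 1) (a : A) :
    derBr3 j 1 1 1 δ X Y (fun _ => a) =
      form1 P Y (prA j ((δ : Module.End K L) (j.j (form1 P X a)))) +
      form1 P X (prA j ((δ : Module.End K L) (j.j (form1 P Y a)))) := by
  simp [derBr3_apply, ins_derA]

lemma ins_wedgeA_zero_one (X : Form P 0) (Y Z : Form P 1) (a : A) :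
    ins P (0 + 1) 1 1 (wedgeA j 0 1 X Y) Z (fun _ => a) =
      form1 P Z (prA j (P.algL.bracket (j.j (form0 P X)) (j.j (form1 P Y a)))) :=
  (ins_one_one (wedgeA j 0 1 X Y) Z fun _ => a).trans
    (congrArg (form1 P Z) (wedgeA_zero_one j X Y fun _ => a))

lemma ins_wedgeA_one_zero (X : Form P 1) (Y : Form P 0) (Z : Form P 1) (a : A) :
    ins P (1 + 0) 1 1 (wedgeA j 1 0 X Y) Z (fun _ => a) =
      -form1 P Z (prA j (P.algL.bracket (j.j (form0 P Y)) (j.j (form1 P X a)))) :=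
  (ins_one_one (wedgeA j 1 0 X Y) Z fun _ => a).trans
    ((congrArg (form1 P Z) (wedgeA_one_zero j X Y fun _ => a)).trans (map_neg _ _))

lemma ins_wedgeA_one_one (X Y Z : Form P 1) (a : Fin 2 → A) :
    ins P (1 + 1) 1 2 (wedgeA j 1 1 X Y) Z a =
      form1 P Z (prA j (P.algL.bracket (j.j (form1 P X (a 0))) (j.j (form1 P Y (a 1))))) -
      form1 P Z (prA j (P.algL.bracket (j.j (form1 P X (a 1))) (j.j (form1 P Y (a 0))))) :=
  (ins_two_one (wedgeA j 1 1 X Y) Z a).trans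
    ((congrArg (form1 P Z) (wedgeA_one_one j X Y a)).trans (map_sub _ _ _))

lemma ins_zero {m s : ℕ} (φ : A [⋀^Fin m]→ₗ[R] A) (Z : Form P 0) : ins P m 0 s φ Z = 0 := rfl

/-- The derivation part of `b` contributes through `derBr3` and its section through two terms of
`formBr3`; the remaining insertion goes into a form of degree zero and vanishes. The components of
`x` and `y` in `IDer(L)` are zero, as they have degree one. -/
lemma form1_hBr3_zero_one_one (b : HV P 0) (x y : HV P 1) (a : A) :
    form1 P (hBr3 j 0 1 1 1 b x y).2 a =
      form1 P y.2 (prA j (derOp j b (j.j (form1 P x.2 a)))) +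
      form1 P x.2 (prA j (derOp j b (j.j (form1 P y.2 a)))) := by
  change (derBr3 j 1 1 1 b.1 x.2 y.2 - derBr3 j 0 1 1 x.1 b.2 y.2 +
    formBr3 j 0 1 1 1 b.2 x.2 y.2 + derBr3 j 0 1 1 y.1 b.2 x.2) (fun _ => a) = _
  rw [hDer_one_eq_zero, hDer_one_eq_zero, formBr3_apply]
  simp only [map_zero, LinearMap.zero_apply, sub_zero, add_zero, AlternatingMap.add_apply,
    AlternatingMap.smul_apply, smul_zero, ins_zero, derBr3_one_one, ins_wedgeA_zero_one,
    derOp_apply, map_add]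
  norm_num
  abel

lemma form1_hBr3_one_zero_one (b : HV P 0) (x y : HV P 1) (a : A) :
    form1 P (hBr3 j 1 0 1 1 x b y).2 a =
      -(form1 P y.2 (prA j (derOp j b (j.j (form1 P x.2 a)))) +
      form1 P x.2 (prA j (derOp j b (j.j (form1 P y.2 a))))) := by
  change (derBr3 j 0 1 1 x.1 b.2 y.2 - derBr3 j 1 1 1 b.1 x.2 y.2 +
    formBr3 j 1 0 1 1 x.2 b.2 y.2 + derBr3 j 1 0 1 y.1 x.2 b.2) (fun _ => a) = _
  rw [hDer_one_eq_zero, hDer_one_eq_zero, formBr3_apply]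
  simp only [map_zero, LinearMap.zero_apply, zero_sub, add_zero, AlternatingMap.add_apply,
    AlternatingMap.neg_apply, AlternatingMap.smul_apply, smul_zero, ins_zero, derBr3_one_one,
    ins_wedgeA_zero_one, ins_wedgeA_one_zero, derOp_apply, map_add]
  norm_num
  abel

lemma form1_hBr3_one_one_zero (b : HV P 0) (x y : HV P 1) (a : A) :
    form1 P (hBr3 j 1 1 0 1 x y b).2 a =
      form1 P y.2 (prA j (derOp j b (j.j (form1 P x.2 a)))) +
      form1 P x.2 (prA j (derOp j b (j.j (form1 P y.2 a)))) := by
  change (derBr3 j 1 0 1 x.1 y.2 b.2 - derBr3 j 1 0 1 y.1 x.2 b.2 +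
    formBr3 j 1 1 0 1 x.2 y.2 b.2 + derBr3 j 1 1 1 b.1 x.2 y.2) (fun _ => a) = _
  rw [hDer_one_eq_zero, hDer_one_eq_zero, formBr3_apply]
  simp only [map_zero, LinearMap.zero_apply, sub_zero, zero_add, AlternatingMap.add_apply,
    AlternatingMap.smul_apply, smul_zero, ins_zero, derBr3_one_one,
    ins_wedgeA_one_zero, derOp_apply, map_add]
  norm_num
  abel

/-! ### The terms of the Maurer-Cartan equation -/

lemma hBr1_one_two (x : HV P 1) (a : Fin 2 → A) :
    (hBr1 j 1 2 x).2 a =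
      prB P (P.algL.bracket (P.incl (a 0)) (j.j (form1 P x.2 (a 1)))) -
      prB P (P.algL.bracket (P.incl (a 1)) (j.j (form1 P x.2 (a 0)))) -
      form1 P x.2 (prA j (P.algL.bracket (P.incl (a 0)) (P.incl (a 1)))) := by
  change castF 1 2 (derB1 x.1) a + castF (1 + 1) 2 (dCE j 1 x.2) a = _
  -- `[δ]₁` lives in degree one only; `castF` is zero between different degrees.
  have h : castF 1 2 (derB1 (x.1 : der P)) = (0 : Form P 2) := by simp [castF]
  rw [h, castF_apply rfl, dCE_apply]
  refine (zero_add _).trans ((Fin.sum_univ_two _).trans ?_)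
  have hs : P.algL.bracket (P.incl (a 1)) (P.incl (a 0)) =
      -P.algL.bracket (P.incl (a 0)) (P.incl (a 1)) := P.algL.skew _ _
  simp [derAct_apply, apply_eq_form1, bott_apply, Fin.removeNth]
  rw [hs, show Fin.tail a 0 = a 1 from rfl, map_neg, map_neg]
  module

lemma hBr2_one_one_two (x y : HV P 1) (a : Fin 2 → A) :
    (hBr2 j 1 1 2 rfl x y).2 a =
      (prB P (P.algL.bracket (j.j (form1 P x.2 (a 0))) (j.j (form1 P y.2 (a 1)))) -
        form1 P y.2 (prA j (P.algL.bracket (j.j (form1 P x.2 (a 0))) (P.incl (a 1)))) +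
        form1 P x.2 (prA j (P.algL.bracket (j.j (form1 P y.2 (a 1))) (P.incl (a 0))))) -
      (prB P (P.algL.bracket (j.j (form1 P x.2 (a 1))) (j.j (form1 P y.2 (a 0)))) -
        form1 P y.2 (prA j (P.algL.bracket (j.j (form1 P x.2 (a 1))) (P.incl (a 0)))) +
        form1 P x.2 (prA j (P.algL.bracket (j.j (form1 P y.2 (a 0))) (P.incl (a 1))))) := by
  change (castF 1 2 (derAct j 1 x.1 y.2) - castF 1 2 (derAct j 1 y.1 x.2) +
    castF (1 + 1) 2 (formBr2 j 1 1 x.2 y.2)) a = _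
  have h : ∀ X : Form P 1, castF 1 2 X = (0 : Form P 2) := fun X => by simp [castF]
  rw [h, h, sub_zero, zero_add, castF_apply rfl, formBr2_one_one]
  rfl

lemma hBr3_one_one_one_two (x y z : HV P 1) (a : Fin 2 → A) :
    (hBr3 j 1 1 1 2 x y z).2 a =
      -((form1 P z.2 (prA j (P.algL.bracket (j.j (form1 P x.2 (a 0))) (j.j (form1 P y.2 (a 1))))) -
      form1 P z.2 (prA j (P.algL.bracket (j.j (form1 P x.2 (a 1))) (j.j (form1 P y.2 (a 0)))))) +
      (form1 P y.2 (prA j (P.algL.bracket (j.j (form1 P x.2 (a 0))) (j.j (form1 P z.2 (a 1))))) -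
      form1 P y.2 (prA j (P.algL.bracket (j.j (form1 P x.2 (a 1))) (j.j (form1 P z.2 (a 0)))))) +
      (form1 P x.2 (prA j (P.algL.bracket (j.j (form1 P y.2 (a 0))) (j.j (form1 P z.2 (a 1))))) -
      form1 P x.2 (prA j (P.algL.bracket (j.j (form1 P y.2 (a 1))) (j.j (form1 P z.2 (a 0))))))) := by
  change (derBr3 j 1 1 2 x.1 y.2 z.2 - derBr3 j 1 1 2 y.1 x.2 z.2 +
    formBr3 j 1 1 1 2 x.2 y.2 z.2 + derBr3 j 1 1 2 z.1 x.2 y.2) a = _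
  rw [hDer_one_eq_zero, hDer_one_eq_zero, hDer_one_eq_zero, formBr3_apply]
  simp only [map_zero, LinearMap.zero_apply, sub_zero, zero_add, add_zero, AlternatingMap.add_apply,
    AlternatingMap.smul_apply, ins_wedgeA_one_one]
  norm_num
  abel

end Evaluation

/-! ### Extension of scalars of bundle maps -/

section BaseR

variable {K : Type w} [Field K] {R : Type u} [CommRing R] [Algebra K R] (v : ArtAlg.{w, u} K)
  {E F : Type u} [AddCommGroup E] [Module K E] [Module R E] [IsScalarTower K R E]
  [AddCommGroup F] [Module K F] [Module R F] [IsScalarTower K R F]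

/-- The `v`-linear extension of an `R`-linear map. -/
def baseR (f : E →ₗ[R] F) : v ⊗[K] E →ₗ[v] v ⊗[K] F := (f.restrictScalars K).baseChange v

@[simp] lemma baseR_tmul (f : E →ₗ[R] F) (a : v) (x : E) : baseR v f (a ⊗ₜ x) = a ⊗ₜ[K] f x := rfl

@[simp] lemma smulT_tmul (a b : v) (r : R) (x : E) :
    smulT R v E (a ⊗ₜ r) (b ⊗ₜ x) = (a * b) ⊗ₜ[K] (r • x) := by simp [smulT]

lemma baseR_smulT (f : E →ₗ[R] F) (r : v ⊗[K] R) (x : v ⊗[K] E) :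
    baseR v f (smulT R v E r x) = smulT R v F r (baseR v f x) := by
  induction r using tind with
  | one r =>
    induction x using tind with
    | one x => simp
    | add x y hx hy => simp only [map_add, hx, hy]
    | smul a x hx => simp only [map_smul, hx]
  | add x y hx hy => simp only [map_add, LinearMap.add_apply, hx, hy]
  | smul a x hx => simp only [map_smul, LinearMap.smul_apply, hx]

lemma evT_baseR (f : E →ₗ[R] F) (x : v ⊗[K] E) : evT v F (baseR v f x) = f (evT v E x) :=
  evT_baseChange _ x

end BaseR

/-! ### Detecting zero in tensor products with the maximal ideal -/

section InclMax

variable {K : Type w} [Field K] {v : ArtAlg.{w, u} K}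

lemma inclMax_injective (E : Type u) [AddCommGroup E] [Module K E] :
    Function.Injective (inclMax v E) :=
  Module.Flat.rTensor_preserves_injective_linearMap _ (Submodule.subtype_injective _)

/-- An element of `V ⊗ 𝔪` is determined by its values under a separating family of linear maps. -/
lemma eq_zero_of_rTensor_eq_zero {V W ι : Type u} [AddCommMonoid V] [Module K V] [AddCommMonoid W]
    [Module K W] (f : ι → V →ₗ[K] W) (hf : ∀ x, (∀ i, f i x = 0) → x = 0)
    (t : V ⊗[K] v.maxIdeal) (h : ∀ i, (f i).rTensor v.maxIdeal t = 0) : t = 0 := by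
  -- A basis of `𝔪` turns a tensor into a finitely supported family in `V`, on which `f i ⊗ id` acts
  -- coordinatewise.
  let b := Module.Free.chooseBasis K v.maxIdeal
  have h1 : ∀ i k, f i (TensorProduct.equivFinsuppOfBasisRight b t k) =
      TensorProduct.equivFinsuppOfBasisRight b ((f i).rTensor v.maxIdeal t) k := by
    clear h
    intro i k
    induction t using TensorProduct.induction_on with
    | zero => simp
    | tmul x c => simp
    | add x y hx hy => simp only [map_add, Finsupp.add_apply, hx, hy]
  refine (TensorProduct.equivFinsuppOfBasisRight (M := V) b).injective ?_
  rw [map_zero]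
  ext k
  refine hf _ fun i => ?_
  rw [h1, h]
  simp

lemma eq_zero_of_inclMax_comm_eq_zero {W : Type u} [AddCommGroup W] [Module K W]
    {t : W ⊗[K] v.maxIdeal} (h : inclMax v W (TensorProduct.comm K W v.maxIdeal t) = 0) : t = 0 :=
  (TensorProduct.comm K W v.maxIdeal).injective
    (inclMax_injective W (by rw [h, map_zero, map_zero]))

end InclMax

/-! ### Elements of `𝔥₀ ⊗ 𝔪` as operators -/

section Operators

variable {K : Type w} [Field K] [CharZero K] {R : Type u} [CommRing R] [Algebra K R]
  {A L : Type u} [AddCommGroup A] [Module K A] [Module R A] [IsScalarTower K R A]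
  [AddCommGroup L] [Module K L] [Module R L] [IsScalarTower K R L]
  {P : LiePair K R A L} (j : Splitting P) (v : ArtAlg.{w, u} K)

/-- The extension of the inclusion `A → L`. -/
abbrev inclT (P : LiePair K R A L) (v : ArtAlg.{w, u} K) : v ⊗[K] A →ₗ[v] v ⊗[K] L :=
  baseR v P.incl

/-- The extension of the projection `L → B`. -/
abbrev prBT (P : LiePair K R A L) (v : ArtAlg.{w, u} K) : v ⊗[K] L →ₗ[v] v ⊗[K] P.B :=
  baseR v (prB P)

/-- The extension of the projection `L → A`. -/
abbrev prAT : v ⊗[K] L →ₗ[v] v ⊗[K] A := baseR v (prA j)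

/-- The extension of the splitting `B → L`. -/
abbrev jT : v ⊗[K] P.B →ₗ[v] v ⊗[K] L := baseR v j.j

/-- The bracket of the Cartesian extension of `L`. -/
abbrev brT (P : LiePair K R A L) (v : ArtAlg.{w, u} K) :
    v ⊗[K] L →ₗ[v] v ⊗[K] L →ₗ[v] v ⊗[K] L := (P.algL.cartesian v).bracket

@[simp] lemma brT_tmul (a b : v) (x y : L) :
    brT P v (a ⊗ₜ x) (b ⊗ₜ y) = (a * b) ⊗ₜ[K] P.algL.bracket x y := ext₂_tmul v _ a b x y

@[simp] lemma prAT_inclT (x : v ⊗[K] A) : prAT j v (inclT P v x) = x := by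
  induction x using tind with
  | one x => simp
  | add x y hx hy => simp only [map_add, hx, hy]
  | smul a x hx => simp only [map_smul, hx]

@[simp] lemma prBT_inclT (x : v ⊗[K] A) : prBT P v (inclT P v x) = 0 := by
  induction x using tind with
  | one x => simp
  | add x y hx hy => simp only [map_add, hx, hy, add_zero]
  | smul a x hx => simp only [map_smul, hx, smul_zero]

@[simp] lemma prAT_jT (x : v ⊗[K] P.B) : prAT j v (jT j v x) = 0 := by
  induction x using tind with
  | one x => simp
  | add x y hx hy => simp only [map_add, hx, hy, add_zero]
  | smul a x hx => simp only [map_smul, hx, smul_zero]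

@[simp] lemma prBT_jT (x : v ⊗[K] P.B) : prBT P v (jT j v x) = x := by
  induction x using tind with
  | one x => simp
  | add x y hx hy => simp only [map_add, hx, hy]
  | smul a x hx => simp only [map_smul, hx]

lemma inclT_add_jT (x : v ⊗[K] L) : inclT P v (prAT j v x) + jT j v (prBT P v x) = x := by
  induction x using tind with
  | one x => simp [incl_prA, ← TensorProduct.tmul_add]
  | add x y hx hy => conv_rhs => rw [← hx, ← hy]
                     simp only [map_add]; abel
  | smul a x hx => conv_rhs => rw [← hx]
                   simp only [map_smul, smul_add]

/-- A pure tensor in `𝔥₀ ⊗ 𝔪`. -/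
def tm {v : ArtAlg.{w, u} K} {p : ℕ} (x : HV P p) (c : v.maxIdeal) : ((h0 j).tensor v).V p :=
  (x ⊗ₜ[K] c : HV P p ⊗[K] v.maxIdeal)

lemma h0_induction {v : ArtAlg.{w, u} K} {p : ℕ} {C : ((h0 j).tensor v).V p → Prop} (zero : C 0)
    (tm : ∀ (x : HV P p) (c : v.maxIdeal), C (tm j x c))
    (add : ∀ x y, C x → C y → C (x + y)) (x : ((h0 j).tensor v).V p) : C x :=
  TensorProduct.induction_on x zero tm add

section

variable {j v}

lemma b1_tm {p s : ℕ} (h : s = p + 1) (x : HV P p) (c : v.maxIdeal) :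
    ((h0 j).tensor v).b1 p s h (tm j x c) = tm j (hBr1 j p s x) c := rfl

lemma b2_tm {p q s : ℕ} (h : s = p + q) (x : HV P p) (y : HV P q) (c d : v.maxIdeal) :
    ((h0 j).tensor v).b2 p q s h (tm j x c) (tm j y d) =
      tm j (hBr2 j p q s h x y) (v.mulMax c d) := rfl

lemma b3_tm {p q r s : ℕ} (h : s + 1 = p + q + r) (x : HV P p) (y : HV P q) (z : HV P r)
    (c d e : v.maxIdeal) : ((h0 j).tensor v).b3 p q r s h (tm j x c) (tm j y d) (tm j z e) =
      tm j (hBr3 j p q r s x y z) (v.mulMax (v.mulMax c d) e) := rfl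

end

/-- The value of the `Ω_A(B)`-component. -/
def evForm {p : ℕ} (a : Fin p → A) : HV P p →ₗ[K] P.B where
  toFun x := x.2 a
  map_add' _ _ := rfl
  map_smul' _ _ := rfl

/-- The `v`-linear map `A_v → B_v` given by an element of degree `1` of `𝔥₀ ⊗ 𝔪`. -/
def hat : ((h0 j).tensor v).V 1 →ₗ[K] v ⊗[K] A →ₗ[v] v ⊗[K] P.B :=
  (TensorProduct.lift (LinearMap.mk₂ K (fun (x : HV P 1) (c : v.maxIdeal) =>
      (c : v) • baseR v (form1 P x.2))
    (fun x y c => by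
      rw [← smul_add]; congr 1; ext a; simp [TensorProduct.tmul_add])
    (fun t x c => by
      ext a
      simp only [Prod.smul_snd, map_smul]
      simp [TensorProduct.tmul_smul, smul_comm t (c : v)])
    (fun x c d => by rw [Submodule.coe_add, add_smul])
    (fun t x c => by rw [Submodule.coe_smul, smul_assoc])) :
    HV P 1 ⊗[K] v.maxIdeal →ₗ[K] v ⊗[K] A →ₗ[v] v ⊗[K] P.B)

lemma hat_tm (x : HV P 1) (c : v.maxIdeal) :
    hat j v (tm j x c) = (c : v) • baseR v (form1 P x.2) := rfl

lemma hat_tm_one (x : HV P 1) (c : v.maxIdeal) (a : A) :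
    hat j v (tm j x c) (1 ⊗ₜ a) = (c : v) • (1 ⊗ₜ form1 P x.2 a) := rfl

/-- The operator on `L_v` given by an element of degree `0` of `𝔥₀ ⊗ 𝔪`. -/
def act : ((h0 j).tensor v).V 0 →ₗ[K] Module.End v (v ⊗[K] L) :=
  (TensorProduct.lift (LinearMap.mk₂ K (fun (x : HV P 0) (c : v.maxIdeal) =>
      (c : v) • (derOp j x).baseChange v)
    (fun x y c => by rw [map_add, LinearMap.baseChange_add, smul_add])
    (fun t x c => by rw [map_smul, LinearMap.baseChange_smul, smul_comm])
    (fun x c d => by rw [Submodule.coe_add, add_smul])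
    (fun t x c => by rw [Submodule.coe_smul, smul_assoc])) :
    HV P 0 ⊗[K] v.maxIdeal →ₗ[K] Module.End v (v ⊗[K] L))

lemma act_tm (b : HV P 0) (c : v.maxIdeal) :
    act j v (tm j b c) = (c : v) • (derOp j b).baseChange v := rfl

/-- The values of an element of degree `2` of `𝔥₀ ⊗ 𝔪`. -/
def ev2 (a : Fin 2 → A) : ((h0 j).tensor v).V 2 →ₗ[K] v ⊗[K] P.B :=
  (inclMax v P.B ∘ₗ (TensorProduct.comm K P.B v.maxIdeal).toLinearMap ∘ₗ
    LinearMap.rTensor v.maxIdeal (evForm a) : HV P 2 ⊗[K] v.maxIdeal →ₗ[K] v ⊗[K] P.B)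

lemma ev2_tm (a : Fin 2 → A) (x : HV P 2) (c : v.maxIdeal) :
    ev2 j v a (tm j x c) = (c : v) • ((1 : v) ⊗ₜ[K] x.2 a) := inclMax_smul_tmul c (x.2 a)

variable {v}

lemma hDer_eq_zero {p : ℕ} (hp : p ≠ 0) (δ : hDer P p) : δ = 0 :=
  Subtype.ext (by simpa [hDer, hp] using δ.2)

lemma eq_zero_of_evForm_eq_zero {p : ℕ} (hp : p ≠ 0) (x : HV P p)
    (h : ∀ a : Fin p → A, evForm a x = 0) : x = 0 :=
  Prod.ext (hDer_eq_zero hp x.1) (AlternatingMap.ext h)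

lemma eq_zero_of_evForm {p : ℕ} (hp : p ≠ 0) (t : HV P p ⊗[K] v.maxIdeal)
    (h : ∀ a : Fin p → A, inclMax v P.B
      (TensorProduct.comm K P.B v.maxIdeal ((evForm a).rTensor v.maxIdeal t)) = 0) : t = 0 :=
  eq_zero_of_rTensor_eq_zero (V := HV P p) (W := P.B) (ι := Fin p → A) evForm
    (eq_zero_of_evForm_eq_zero hp) t fun a => eq_zero_of_inclMax_comm_eq_zero (h a)

lemma ev2_injective {x : ((h0 j).tensor v).V 2} (h : ∀ a, ev2 j v a x = 0) : x = 0 :=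
  eq_zero_of_evForm two_ne_zero _ h

/-- In degree one there is no `IDer(L)`-component, so the values on `1 ⊗ a` determine the element.
This turns equality of graphs into equality in `𝔥₀ ⊗ 𝔪`. -/
lemma hat_injective : Function.Injective (hat j v) := by
  refine (injective_iff_map_eq_zero _).2 fun x hx => ?_
  refine eq_zero_of_evForm one_ne_zero _ fun a => ?_
  have h : ∀ y : ((h0 j).tensor v).V 1, inclMax v P.B (TensorProduct.comm K P.B v.maxIdeal
      (LinearMap.rTensor v.maxIdeal (evForm a) y)) = hat j v y (1 ⊗ₜ a 0) := by
    intro y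
    induction y using h0_induction with
    | zero =>
      rw [map_zero, LinearMap.zero_apply]
      exact (congrArg _ (map_zero _)).trans (map_zero _)
    | tm x c =>
      rw [hat_tm_one, ← apply_eq_form1]
      exact inclMax_smul_tmul c _
    | add x y hx hy =>
      rw [map_add, LinearMap.add_apply, ← hx, ← hy, ← map_add, ← map_add]
      exact congrArg _ (congrArg _ (map_add _ _ _))
  exact (h x).trans (by rw [hx, LinearMap.zero_apply])

lemma hat_smulT (x : ((h0 j).tensor v).V 1) (r : v ⊗[K] R) (a : v ⊗[K] A) :
    hat j v x (smulT R v A r a) = smulT R v P.B r (hat j v x a) := by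
  induction x using h0_induction with
  | zero => simp only [map_zero, LinearMap.zero_apply]
  | tm x c => rw [hat_tm, LinearMap.smul_apply, LinearMap.smul_apply, baseR_smulT, map_smul]
  | add x y hx hy => simp only [map_add, LinearMap.add_apply, hx, hy]

lemma hat_mem_filt (x : ((h0 j).tensor v).V 1) : hat j v x ∈ filt v _ _ 1 := by
  refine mem_filt_one.2 fun a => ?_
  induction x using h0_induction with
  | zero => simp
  | tm x c => rw [hat_tm_one, evT_smul, (v.ev_eq_zero_iff _).2 c.2, zero_smul]
  | add x y hx hy => rw [map_add, LinearMap.add_apply, map_add, hx, hy, add_zero]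

lemma act_mem_filt (b : ((h0 j).tensor v).V 0) : act j v b ∈ filt v _ _ 1 := by
  refine mem_filt_one.2 fun a => ?_
  induction b using h0_induction with
  | zero => simp
  | tm x c => rw [act_tm, LinearMap.smul_apply, evT_smul, (v.ev_eq_zero_iff _).2 c.2, zero_smul]
  | add x y hx hy => rw [map_add, LinearMap.add_apply, map_add, hx, hy, add_zero]

/-- Write `f(1 ⊗ a) = ∑ bᵢ ⊗ gᵢ(a)` in a basis `bᵢ` of `𝔪`. Since `R` acts on the second tensor
factor alone, every `gᵢ` is `R`-linear, and `∑ gᵢ ⊗ bᵢ` is the required element. The sum is finite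
because `v` is finite over `K`. -/
lemma exists_hat_eq (f : v ⊗[K] A →ₗ[v] v ⊗[K] P.B)
    (hR : ∀ (r : R) (a : A), f (1 ⊗ₜ (r • a)) = smulT R v P.B (1 ⊗ₜ r) (f (1 ⊗ₜ a)))
    (h0' : ∀ a, evT v P.B (f (1 ⊗ₜ a)) = 0) : ∃ x, hat j v x = f := by
  let b := Module.finBasis K v.maxIdeal
  -- A `K`-linear retraction `v → 𝔪` extends the coordinate functions of `𝔪` to all of `v`, so that
  -- `κ i` is defined on `v ⊗ B`.
  obtain ⟨ret, hret⟩ := v.maxIdeal.subtype.exists_leftInverse_of_injective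
    (Submodule.ker_subtype _)
  let κ (i) : v ⊗[K] P.B →ₗ[K] P.B :=
    (TensorProduct.lid K P.B).toLinearMap ∘ₗ (b.coord i ∘ₗ ret).rTensor P.B
  have κ_tmul : ∀ i (c : v) (y : P.B), κ i (c ⊗ₜ y) = b.coord i (ret c) • y := fun i c y => rfl
  have κR : ∀ i (r : R) (y : v ⊗[K] P.B), κ i (smulT R v P.B (1 ⊗ₜ r) y) = r • κ i y := by
    intro i r y
    induction y using TensorProduct.induction_on with
    | zero => simp
    | tmul c y => rw [smulT_tmul, one_mul, κ_tmul, κ_tmul, smul_comm]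
    | add x y hx hy => simp only [map_add, smul_add, hx, hy]
  have κsum : ∀ y : v.maxIdeal ⊗[K] P.B,
      ∑ i, (b i : v) ⊗ₜ[K] κ i (inclMax v P.B y) = inclMax v P.B y := by
    intro y
    induction y using TensorProduct.induction_on with
    | zero => simp
    | add x y hx hy => simp only [map_add, TensorProduct.tmul_add, Finset.sum_add_distrib, hx, hy]
    | tmul c y =>
      have h1 : ret (c : v) = c := LinearMap.congr_fun hret c
      have h2 : inclMax v P.B (c ⊗ₜ y) = (c : v) ⊗ₜ y := rfl
      simp only [h2, κ_tmul, h1, ← TensorProduct.smul_tmul, ← TensorProduct.sum_tmul]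
      congr 1
      have := congrArg v.maxIdeal.subtype (b.sum_repr c)
      rw [map_sum] at this
      exact this
  let g (i) : A →ₗ[R] P.B :=
    { toFun := fun a => κ i (f (1 ⊗ₜ a))
      map_add' := fun a a' => by rw [TensorProduct.tmul_add, map_add, map_add]
      map_smul' := fun r a => by rw [hR, κR]; rfl }
  let t : HV P 1 ⊗[K] v.maxIdeal :=
    ∑ i, ((0, AlternatingMap.ofSubsingleton R A P.B (0 : Fin 1) (g i)) : HV P 1) ⊗ₜ[K] b i
  refine ⟨t, ?_⟩
  have ht : hat j v t = ∑ i, (b i : v) • baseR v (g i) :=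
    (map_sum (hat j v) _ _).trans (Finset.sum_congr rfl fun i _ => rfl)
  rw [ht]
  refine TensorProduct.AlgebraTensorModule.curry_injective (LinearMap.ext_ring ?_)
  refine LinearMap.ext fun a => ?_
  obtain ⟨y, hy⟩ := exists_inclMax_of_evT_eq_zero (h0' a)
  have := κsum y
  rw [hy] at this
  change (∑ i, (b i : v) • baseR v (g i)) (1 ⊗ₜ a) = f (1 ⊗ₜ a)
  conv_rhs => rw [← this]
  rw [LinearMap.sum_apply]
  refine Finset.sum_congr rfl fun i _ => ?_
  rw [LinearMap.smul_apply, baseR_tmul, TensorProduct.smul_tmul', smul_eq_mul, mul_one]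
  rfl

end Operators

section Gauge

variable {K : Type w} [Field K] [CharZero K] {R : Type u} [CommRing R] [Algebra K R]
  {A L : Type u} [AddCommGroup A] [Module K A] [Module R A] [IsScalarTower K R A]
  [AddCommGroup L] [Module K L] [Module R L] [IsScalarTower K R L]
  {P : LiePair K R A L} {j : Splitting P} {v : ArtAlg.{w, u} K}

/-! ### The brackets of `𝔥₀ ⊗ 𝔪` in terms of operators -/

/-- This and the next formulas reduce by multilinearity to pure tensors, where they are the
evaluations of the brackets of `𝔥₀`; the coefficients in `𝔪` multiply commutatively. -/
lemma hat_b1 (b : ((h0 j).tensor v).V 0) (z : v ⊗[K] A) :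
    hat j v (((h0 j).tensor v).b1 0 1 rfl b) z = -prBT P v (act j v b (inclT P v z)) := by
  induction z using tind with
  | one a =>
    induction b using h0_induction with
    | zero => simp
    | tm b c => simp [b1_tm, hat_tm, act_tm, form1_hBr1, TensorProduct.tmul_neg]
    | add x y hx hy => simp only [map_add, LinearMap.add_apply, hx, hy, neg_add]
  | add x y hx hy => simp only [map_add, hx, hy, neg_add]
  | smul a x hx => simp only [map_smul, hx, smul_neg]

lemma hat_b2_zero_one (b : ((h0 j).tensor v).V 0) (x : ((h0 j).tensor v).V 1) (z : v ⊗[K] A) :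
    hat j v (((h0 j).tensor v).b2 0 1 1 rfl b x) z =
      prBT P v (act j v b (jT j v (hat j v x z))) -
        hat j v x (prAT j v (act j v b (inclT P v z))) := by
  induction z using tind with
  | one a =>
    induction b using h0_induction with
    | zero => simp
    | tm b c =>
      induction x using h0_induction with
      | zero => simp
      | tm x d =>
        simp [b2_tm, hat_tm, act_tm, form1_hBr2_zero_one, TensorProduct.tmul_sub,
          TensorProduct.smul_tmul', mul_comm, smul_sub]
      | add x y hx hy => simp only [map_add, LinearMap.add_apply, hx, hy]; abel
    | add x y hx hy => simp only [map_add, LinearMap.add_apply, hx, hy]; abel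
  | add x y hx hy => simp only [map_add, hx, hy]; abel
  | smul a x hx => simp only [map_smul, hx, smul_sub]

lemma hat_b2_one_zero (b : ((h0 j).tensor v).V 0) (x : ((h0 j).tensor v).V 1) (z : v ⊗[K] A) :
    hat j v (((h0 j).tensor v).b2 1 0 1 rfl x b) z =
      -(prBT P v (act j v b (jT j v (hat j v x z))) -
        hat j v x (prAT j v (act j v b (inclT P v z)))) := by
  induction z using tind with
  | one a =>
    induction b using h0_induction with
    | zero => simp
    | tm b c =>
      induction x using h0_induction with
      | zero => simp
      | tm x d =>
        simp [b2_tm, hat_tm, act_tm, form1_hBr2_one_zero, TensorProduct.tmul_sub,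
          TensorProduct.smul_tmul', mul_comm, smul_sub]
      | add x y hx hy => simp only [map_add, LinearMap.add_apply, hx, hy]; abel
    | add x y hx hy => simp only [map_add, LinearMap.add_apply, hx, hy]; abel
  | add x y hx hy => simp only [map_add, hx, hy]; abel
  | smul a x hx => simp only [map_smul, hx, smul_sub, smul_neg]

lemma hat_b3_zero_one_one (b : ((h0 j).tensor v).V 0) (x y : ((h0 j).tensor v).V 1)
    (z : v ⊗[K] A) :
    hat j v (((h0 j).tensor v).b3 0 1 1 1 rfl b x y) z =
      hat j v y (prAT j v (act j v b (jT j v (hat j v x z)))) +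
        hat j v x (prAT j v (act j v b (jT j v (hat j v y z)))) := by
  induction z using tind with
  | one a =>
    induction b using h0_induction with
    | zero => simp
    | tm b c =>
      induction x using h0_induction with
      | zero => simp
      | tm x d =>
        induction y using h0_induction with
        | zero => simp
        | tm y e =>
          simp [b3_tm, hat_tm, act_tm, form1_hBr3_zero_one_one, TensorProduct.tmul_add,
            TensorProduct.smul_tmul', mul_comm, mul_left_comm]
        | add x y hx hy => simp only [map_add, LinearMap.add_apply, hx, hy]; abel
      | add x y hx hy => simp only [map_add, LinearMap.add_apply, hx, hy]; abel
    | add x y hx hy => simp only [map_add, LinearMap.add_apply, hx, hy]; abel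
  | add x y hx hy => simp only [map_add, hx, hy]; abel
  | smul a x hx => simp only [map_smul, hx, smul_add]

lemma hat_b3_one_zero_one (b : ((h0 j).tensor v).V 0) (x y : ((h0 j).tensor v).V 1)
    (z : v ⊗[K] A) :
    hat j v (((h0 j).tensor v).b3 1 0 1 1 rfl x b y) z =
      -(hat j v y (prAT j v (act j v b (jT j v (hat j v x z)))) +
        hat j v x (prAT j v (act j v b (jT j v (hat j v y z))))) := by
  induction z using tind with
  | one a =>
    induction b using h0_induction with
    | zero => simp
    | tm b c =>
      induction x using h0_induction with
      | zero => simp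
      | tm x d =>
        induction y using h0_induction with
        | zero => simp
        | tm y e =>
          simp [b3_tm, hat_tm, act_tm, form1_hBr3_one_zero_one, TensorProduct.tmul_add,
            TensorProduct.tmul_neg, TensorProduct.smul_tmul', mul_comm, mul_left_comm]
        | add x y hx hy => simp only [map_add, LinearMap.add_apply, hx, hy]; abel
      | add x y hx hy => simp only [map_add, LinearMap.add_apply, hx, hy]; abel
    | add x y hx hy => simp only [map_add, LinearMap.add_apply, hx, hy]; abel
  | add x y hx hy => simp only [map_add, hx, hy]; abel
  | smul a x hx => simp only [map_smul, hx, smul_add, smul_neg]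

lemma hat_b3_one_one_zero (b : ((h0 j).tensor v).V 0) (x y : ((h0 j).tensor v).V 1)
    (z : v ⊗[K] A) :
    hat j v (((h0 j).tensor v).b3 1 1 0 1 rfl x y b) z =
      hat j v y (prAT j v (act j v b (jT j v (hat j v x z)))) +
        hat j v x (prAT j v (act j v b (jT j v (hat j v y z)))) := by
  induction z using tind with
  | one a =>
    induction b using h0_induction with
    | zero => simp
    | tm b c =>
      induction x using h0_induction with
      | zero => simp
      | tm x d =>
        induction y using h0_induction with
        | zero => simp
        | tm y e =>
          simp [b3_tm, hat_tm, act_tm, form1_hBr3_one_one_zero, TensorProduct.tmul_add,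
            TensorProduct.smul_tmul', mul_comm, mul_left_comm]
        | add x y hx hy => simp only [map_add, LinearMap.add_apply, hx, hy]; abel
      | add x y hx hy => simp only [map_add, LinearMap.add_apply, hx, hy]; abel
    | add x y hx hy => simp only [map_add, LinearMap.add_apply, hx, hy]; abel
  | add x y hx hy => simp only [map_add, hx, hy]; abel
  | smul a x hx => simp only [map_smul, hx, smul_add]

variable (a : Fin 2 → A)

lemma ev2_b1 (x : ((h0 j).tensor v).V 1) :
    ev2 j v a (((h0 j).tensor v).b1 1 2 rfl x) =
      prBT P v (brT P v (inclT P v (1 ⊗ₜ a 0)) (jT j v (hat j v x (1 ⊗ₜ a 1)))) -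
      prBT P v (brT P v (inclT P v (1 ⊗ₜ a 1)) (jT j v (hat j v x (1 ⊗ₜ a 0)))) -
      hat j v x (prAT j v (brT P v (inclT P v (1 ⊗ₜ a 0)) (inclT P v (1 ⊗ₜ a 1)))) := by
  induction x using h0_induction with
  | zero => simp
  | tm x c => simp [b1_tm, hat_tm, ev2_tm, hBr1_one_two, TensorProduct.tmul_sub, smul_sub]
  | add x y hx hy => simp only [map_add, LinearMap.add_apply, hx, hy]; abel

lemma ev2_b2 (x y : ((h0 j).tensor v).V 1) :
    ev2 j v a (((h0 j).tensor v).b2 1 1 2 rfl x y) =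
      (prBT P v (brT P v (jT j v (hat j v x (1 ⊗ₜ a 0))) (jT j v (hat j v y (1 ⊗ₜ a 1)))) -
        hat j v y (prAT j v (brT P v (jT j v (hat j v x (1 ⊗ₜ a 0))) (inclT P v (1 ⊗ₜ a 1)))) +
        hat j v x (prAT j v (brT P v (jT j v (hat j v y (1 ⊗ₜ a 1))) (inclT P v (1 ⊗ₜ a 0))))) -
      (prBT P v (brT P v (jT j v (hat j v x (1 ⊗ₜ a 1))) (jT j v (hat j v y (1 ⊗ₜ a 0)))) -
        hat j v y (prAT j v (brT P v (jT j v (hat j v x (1 ⊗ₜ a 1))) (inclT P v (1 ⊗ₜ a 0)))) +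
        hat j v x (prAT j v (brT P v (jT j v (hat j v y (1 ⊗ₜ a 0))) (inclT P v (1 ⊗ₜ a 1))))) := by
  induction x using h0_induction with
  | zero => simp
  | tm x c =>
    induction y using h0_induction with
    | zero => simp
    | tm y d =>
      simp [b2_tm, hat_tm, ev2_tm, hBr2_one_one_two, TensorProduct.tmul_sub, TensorProduct.tmul_add,
        TensorProduct.smul_tmul', mul_comm, smul_sub, smul_add]
    | add x y hx hy => simp only [map_add, LinearMap.add_apply, hx, hy]; abel
  | add x y hx hy => simp only [map_add, LinearMap.add_apply, hx, hy]; abel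

lemma ev2_b3 (x y z : ((h0 j).tensor v).V 1) :
    ev2 j v a (((h0 j).tensor v).b3 1 1 1 2 rfl x y z) =
      -((hat j v z (prAT j v (brT P v (jT j v (hat j v x (1 ⊗ₜ a 0)))
          (jT j v (hat j v y (1 ⊗ₜ a 1))))) -
        hat j v z (prAT j v (brT P v (jT j v (hat j v x (1 ⊗ₜ a 1)))
          (jT j v (hat j v y (1 ⊗ₜ a 0)))))) +
      (hat j v y (prAT j v (brT P v (jT j v (hat j v x (1 ⊗ₜ a 0)))
          (jT j v (hat j v z (1 ⊗ₜ a 1))))) -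
        hat j v y (prAT j v (brT P v (jT j v (hat j v x (1 ⊗ₜ a 1)))
          (jT j v (hat j v z (1 ⊗ₜ a 0)))))) +
      (hat j v x (prAT j v (brT P v (jT j v (hat j v y (1 ⊗ₜ a 0)))
          (jT j v (hat j v z (1 ⊗ₜ a 1))))) -
        hat j v x (prAT j v (brT P v (jT j v (hat j v y (1 ⊗ₜ a 1)))
          (jT j v (hat j v z (1 ⊗ₜ a 0))))))) := by
  induction x using h0_induction with
  | zero => simp
  | tm x c =>
    induction y using h0_induction with
    | zero => simp
    | tm y d =>
      induction z using h0_induction with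
      | zero => simp
      | tm z e =>
        simp [b3_tm, hat_tm, ev2_tm, hBr3_one_one_one_two, TensorProduct.tmul_sub,
          TensorProduct.tmul_add, TensorProduct.smul_tmul', mul_comm, mul_left_comm, smul_sub]
      | add x y hx hy => simp only [map_add, LinearMap.add_apply, hx, hy]; abel
    | add x y hx hy => simp only [map_add, LinearMap.add_apply, hx, hy]; abel
  | add x y hx hy => simp only [map_add, LinearMap.add_apply, hx, hy]; abel

end Gauge

section Gauge

variable {K : Type w} [Field K] [CharZero K] {R : Type u} [CommRing R] [Algebra K R]
  {A L : Type u} [AddCommGroup A] [Module K A] [Module R A] [IsScalarTower K R A]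
  [AddCommGroup L] [Module K L] [Module R L] [IsScalarTower K R L]
  {P : LiePair K R A L} (j : Splitting P) {v : ArtAlg.{w, u} K}

/-! ### Maurer-Cartan elements and graphs -/

/-- The map `a ↦ a + ξ(a)` from `A_v` to `L_v`, whose range is the graph of `ξ`. -/
def emb (ξ : ((h0 j).tensor v).V 1) : v ⊗[K] A →ₗ[v] v ⊗[K] L :=
  inclT P v + jT j v ∘ₗ hat j v ξ

variable {j}

lemma emb_apply (ξ : ((h0 j).tensor v).V 1) (a : v ⊗[K] A) :
    emb j ξ a = inclT P v a + jT j v (hat j v ξ a) := rfl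

@[simp] lemma prAT_emb (ξ : ((h0 j).tensor v).V 1) (a : v ⊗[K] A) :
    prAT j v (emb j ξ a) = a := by
  rw [emb_apply, map_add, prAT_inclT, prAT_jT, add_zero]

@[simp] lemma prBT_emb (ξ : ((h0 j).tensor v).V 1) (a : v ⊗[K] A) :
    prBT P v (emb j ξ a) = hat j v ξ a := by
  rw [emb_apply, map_add, prBT_inclT, prBT_jT, zero_add]

lemma emb_injective (ξ : ((h0 j).tensor v).V 1) : Function.Injective (emb j ξ) :=
  Function.LeftInverse.injective (prAT_emb ξ)

/-- The criterion for `x` to lie on the graph of `ξ`; the point of `A_v` below it is then `pr_A x`.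
-/
lemma emb_prAT {ξ : ((h0 j).tensor v).V 1} {x : v ⊗[K] L}
    (h : prBT P v x = hat j v ξ (prAT j v x)) : emb j ξ (prAT j v x) = x := by
  rw [emb_apply, ← h, inclT_add_jT]

lemma evT_hat (ξ : ((h0 j).tensor v).V 1) (a : v ⊗[K] A) : evT v P.B (hat j v ξ a) = 0 :=
  evT_eq_zero_of_mem (hat_mem_filt j ξ a)

lemma evT_emb (ξ : ((h0 j).tensor v).V 1) (a : v ⊗[K] A) :
    evT v L (emb j ξ a) = P.incl (evT v A a) := by
  rw [emb_apply, map_add, evT_baseR, evT_baseR, evT_hat, map_zero, add_zero]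

lemma emb_smulT (ξ : ((h0 j).tensor v).V 1) (r : v ⊗[K] R) (a : v ⊗[K] A) :
    emb j ξ (smulT R v A r a) = smulT R v L r (emb j ξ a) := by
  rw [emb_apply, emb_apply, baseR_smulT, hat_smulT, baseR_smulT, map_add]

lemma prBT_brT_inclT (a b : v ⊗[K] A) : prBT P v (brT P v (inclT P v a) (inclT P v b)) = 0 := by
  induction a using tind with
  | one a =>
    induction b using tind with
    | one b => simp [← P.incl_bracket]
    | add x y hx hy => simp only [map_add, hx, hy, add_zero]
    | smul c x hx => simp only [map_smul, hx, smul_zero]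
  | add x y hx hy => simp only [map_add, LinearMap.add_apply, hx, hy, add_zero]
  | smul c x hx => simp only [map_smul, LinearMap.smul_apply, hx, smul_zero]

/-- Expand the bracket of two points of the graph by powers of `ξ`. The constant term drops out as
`A` is a subalgebroid. Skew-symmetry of the bracket of `L` gathers equal terms: two at a time in the
quadratic part and six at a time in the cubic part, which matches the coefficients `1/2` and `1/6`.
-/
lemma ev2_mc (a : Fin 2 → A) (ξ : ((h0 j).tensor v).V 1) :
    ev2 j v a (((h0 j).tensor v).b1 1 2 rfl ξ +
        (2 : K)⁻¹ • ((h0 j).tensor v).b2 1 1 2 rfl ξ ξ +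
        (6 : K)⁻¹ • ((h0 j).tensor v).b3 1 1 1 2 rfl ξ ξ ξ) =
      prBT P v (brT P v (emb j ξ (1 ⊗ₜ a 0)) (emb j ξ (1 ⊗ₜ a 1))) -
        hat j v ξ (prAT j v (brT P v (emb j ξ (1 ⊗ₜ a 0)) (emb j ξ (1 ⊗ₜ a 1)))) := by
  rw [map_add, map_add, map_smul, map_smul, ev2_b1, ev2_b2, ev2_b3, emb_apply, emb_apply]
  have hs := (P.algL.cartesian v).skew
  rw [hs (jT j v (hat j v ξ (1 ⊗ₜ a 1))) (inclT P v (1 ⊗ₜ a 0)),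
    hs (jT j v (hat j v ξ (1 ⊗ₜ a 1))) (jT j v (hat j v ξ (1 ⊗ₜ a 0))),
    hs (inclT P v (1 ⊗ₜ a 1)) (jT j v (hat j v ξ (1 ⊗ₜ a 0)))]
  simp only [map_add, LinearMap.add_apply, map_neg, prBT_brT_inclT]
  module

lemma isMC_iff (ξ : ((h0 j).tensor v).V 1) :
    ((h0 j).tensor v).IsMC ξ ↔ ∀ a b : v ⊗[K] A,
      prBT P v (brT P v (emb j ξ a) (emb j ξ b)) =
        hat j v ξ (prAT j v (brT P v (emb j ξ a) (emb j ξ b))) := by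
  constructor
  · intro h a b
    induction a using tind with
    | one a =>
      induction b using tind with
      | one b =>
        have := ev2_mc (j := j) ![a, b] ξ
        rw [show _ + _ + _ = _ from h, map_zero] at this
        exact (sub_eq_zero.1 this.symm)
      | add x y hx hy => simp only [map_add, hx, hy]
      | smul c x hx => simp only [map_smul, hx]
    | add x y hx hy => simp only [map_add, LinearMap.add_apply, hx, hy]
    | smul c x hx => simp only [map_smul, LinearMap.smul_apply, hx]
  · intro h
    refine ev2_injective j fun a => ?_
    rw [ev2_mc, h, sub_self]

/-! ### The gauge action and the flow of graphs -/

/-- Twisting by `ξ` replaces the inclusion `i` by `i + jξ` and the projection `pr_B` by `pr_B - ξ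
pr_A`. Up to sign the result is the initial velocity of the graph of `ξ` under the flow of `b`. -/
lemma hat_twist1 (ξ : ((h0 j).tensor v).V 1) (b : ((h0 j).tensor v).V 0) (z : v ⊗[K] A) :
    hat j v (((h0 j).tensor v).twist1 ξ b) z =
      -(prBT P v (act j v b (emb j ξ z)) - hat j v ξ (prAT j v (act j v b (emb j ξ z)))) := by
  rw [CubicBrackets.twist1, map_add, map_add, map_smul, LinearMap.add_apply, LinearMap.add_apply,
    LinearMap.smul_apply, hat_b1, hat_b2_one_zero, hat_b3_one_one_zero, emb_apply]
  simp only [map_add]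
  module

lemma hat_twist2 (ξ : ((h0 j).tensor v).V 1) (b : ((h0 j).tensor v).V 0)
    (x : ((h0 j).tensor v).V 1) (z : v ⊗[K] A) :
    hat j v (((h0 j).tensor v).twist2 ξ b x) z =
      prBT P v (act j v b (jT j v (hat j v x z))) -
        hat j v ξ (prAT j v (act j v b (jT j v (hat j v x z)))) -
        hat j v x (prAT j v (act j v b (emb j ξ z))) := by
  rw [CubicBrackets.twist2, map_add, LinearMap.add_apply, hat_b2_zero_one, hat_b3_one_zero_one,
    emb_apply]
  simp only [map_add]
  abel

lemma hat_twist3 (ξ : ((h0 j).tensor v).V 1) (b : ((h0 j).tensor v).V 0)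
    (x y : ((h0 j).tensor v).V 1) (z : v ⊗[K] A) :
    hat j v (((h0 j).tensor v).twist3 ξ b x y) z =
      hat j v x (prAT j v (act j v b (jT j v (hat j v y z)))) +
        hat j v y (prAT j v (act j v b (jT j v (hat j v x z)))) := by
  rw [CubicBrackets.twist3, hat_b3_zero_one_one, add_comm]

/-- Each step of the recursion applies `b` exactly once, and `b` has order one. In the ternary terms
the orders of the two earlier terms add up to `k`. -/
lemma hat_expTerm_mem_filt (ξ : ((h0 j).tensor v).V 1) (b : ((h0 j).tensor v).V 0) (k : ℕ) :
    hat j v (((h0 j).tensor v).expTerm ξ b k) ∈ filt v _ _ k := by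
  induction k using Nat.strong_induction_on with
  | _ k ih =>
    cases k with
    | zero => exact mem_filt_zero _
    | succ k =>
      have hcomp : ∀ {p q : ℕ} {f g : v ⊗[K] A →ₗ[v] v ⊗[K] P.B}, f ∈ filt v _ _ p →
          g ∈ filt v _ _ q →
          f ∘ₗ prAT j v ∘ₗ act j v b ∘ₗ jT j v ∘ₗ g ∈ filt v _ _ (p + (0 + (1 + (0 + q)))) :=
        fun hf hg => comp_mem_filt hf (comp_mem_filt (mem_filt_zero _)
          (comp_mem_filt (act_mem_filt j b) (comp_mem_filt (mem_filt_zero _) hg)))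
      have h3 : ∀ p q, p + q = k → p < k + 1 → q < k + 1 → hat j v (((h0 j).tensor v).twist3 ξ b
          (((h0 j).tensor v).expTerm ξ b p) (((h0 j).tensor v).expTerm ξ b q)) ∈
            filt v _ _ (k + 1) := by
        intro p q hpq hp hq
        have : hat j v (((h0 j).tensor v).twist3 ξ b
          (((h0 j).tensor v).expTerm ξ b p) (((h0 j).tensor v).expTerm ξ b q)) =
            hat j v (((h0 j).tensor v).expTerm ξ b p) ∘ₗ prAT j v ∘ₗ act j v b ∘ₗ jT j v ∘ₗ
              hat j v (((h0 j).tensor v).expTerm ξ b q) +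
            hat j v (((h0 j).tensor v).expTerm ξ b q) ∘ₗ prAT j v ∘ₗ act j v b ∘ₗ jT j v ∘ₗ
              hat j v (((h0 j).tensor v).expTerm ξ b p) := LinearMap.ext fun z => hat_twist3 ..
        rw [this]
        exact add_mem (filt_antitone (by omega) (hcomp (ih p hp) (ih q hq)))
          (filt_antitone (by omega) (hcomp (ih q hq) (ih p hp)))
      have h2 : hat j v (((h0 j).tensor v).twist2 ξ b (((h0 j).tensor v).expTerm ξ b k)) ∈
          filt v _ _ (k + 1) := by
        have : hat j v (((h0 j).tensor v).twist2 ξ b (((h0 j).tensor v).expTerm ξ b k)) =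
            prBT P v ∘ₗ act j v b ∘ₗ jT j v ∘ₗ hat j v (((h0 j).tensor v).expTerm ξ b k) -
            hat j v ξ ∘ₗ prAT j v ∘ₗ act j v b ∘ₗ jT j v ∘ₗ
              hat j v (((h0 j).tensor v).expTerm ξ b k) -
            hat j v (((h0 j).tensor v).expTerm ξ b k) ∘ₗ prAT j v ∘ₗ act j v b ∘ₗ emb j ξ :=
          LinearMap.ext fun z => hat_twist2 ..
        rw [this]
        have hk := ih k (Nat.lt_succ_self k)
        refine Submodule.sub_mem _ (Submodule.sub_mem _ ?_
          (filt_antitone (by omega) (hcomp (hat_mem_filt j ξ) hk))) ?_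
        · exact filt_antitone (show k + 1 ≤ 0 + (1 + (0 + k)) by omega)
            (comp_mem_filt (mem_filt_zero _)
              (comp_mem_filt (act_mem_filt j b) (comp_mem_filt (mem_filt_zero _) hk)))
        · exact filt_antitone (show k + 1 ≤ k + (0 + (1 + 0)) by omega)
            (comp_mem_filt hk (comp_mem_filt (mem_filt_zero _)
              (comp_mem_filt (act_mem_filt j b) (mem_filt_zero _))))
      rw [CubicBrackets.expTerm]
      simp only [map_add, map_smul, map_sum]
      have hK : ∀ (c : K) {f : v ⊗[K] A →ₗ[v] v ⊗[K] P.B}, f ∈ filt v _ _ (k + 1) →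
          c • f ∈ filt v _ _ (k + 1) := fun c f hf => by
        rw [← algebraMap_smul v c f]
        exact Submodule.smul_mem _ _ hf
      refine add_mem (add_mem ?_ h2) (hK _ (sum_mem fun i _ => hK _ ?_))
      · split_ifs with h
        · subst h
          exact hat_mem_filt j _
        · rw [map_zero]; exact zero_mem _
      · exact h3 _ _ (by have := i.2; omega) i.2 (by omega)

lemma exists_expTerm_eq_zero (ξ : ((h0 j).tensor v).V 1) (b : ((h0 j).tensor v).V 0) :
    ∃ N, ∀ k, N ≤ k → ((h0 j).tensor v).expTerm ξ b k = 0 := by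
  obtain ⟨N, hN⟩ := exists_filt_eq_zero v
  refine ⟨N, fun k hk => hat_injective j ?_⟩
  rw [map_zero]
  exact hN _ _ _ (filt_antitone hk (hat_expTerm_mem_filt ξ b k))

variable (j v) in
/-- An element of degree one, as an endomorphism of `L_v`. -/
def toEnd : ((h0 j).tensor v).V 1 →ₗ[K] Module.End v (v ⊗[K] L) where
  toFun x := jT j v ∘ₗ hat j v x ∘ₗ prAT j v
  map_add' x y := by rw [map_add, LinearMap.add_comp, LinearMap.comp_add]
  map_smul' c x := by
    rw [map_smul, RingHom.id_apply, LinearMap.smul_comp]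
    exact LinearMap.ext fun z => (jT j v).map_smul_of_tower c (hat j v x (prAT j v z))

lemma toEnd_apply (x : ((h0 j).tensor v).V 1) (z : v ⊗[K] L) :
    toEnd j v x z = jT j v (hat j v x (prAT j v z)) := rfl

/-- In the ring of endomorphisms of `L_v`, with `i pr_A` and `j pr_B` as complementary projections,
the three twisted brackets are the constant, linear and quadratic parts of the Riccati equation. -/
lemma isRiccatiSeq_expTerm (ξ : ((h0 j).tensor v).V 1) (b : ((h0 j).tensor v).V 0) :
    IsRiccatiSeq K (inclT P v ∘ₗ prAT j v : Module.End v (v ⊗[K] L)) (jT j v ∘ₗ prBT P v)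
      (act j v b) (toEnd j v ξ) fun k => toEnd j v (((h0 j).tensor v).expTerm ξ b k) where
  zero := by simp [CubicBrackets.expTerm]
  succ k := by
    have hemb : ∀ z, emb j ξ (prAT j v z) = inclT P v (prAT j v z) + toEnd j v ξ z := fun z => rfl
    rw [CubicBrackets.expTerm]
    simp only [map_add, map_smul, map_sum]
    congr 1
    · congr 1
      · split_ifs with h
        · refine LinearMap.ext fun z => ?_
          rw [toEnd_apply, hat_twist1, hemb]
          simp [toEnd_apply, Module.End.mul_apply]
        · rw [map_zero]
      · refine LinearMap.ext fun z => ?_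
        rw [toEnd_apply, hat_twist2, hemb]
        simp [toEnd_apply, Module.End.mul_apply]
    · congr 1
      refine Finset.sum_congr rfl fun i _ => congrArg _ (LinearMap.ext fun z => ?_)
      rw [toEnd_apply, hat_twist3]
      simp [toEnd_apply, Module.End.mul_apply]

/-- The gauge action of `b` moves the graph of `ξ` by the flow of `b`. -/
lemma gauge_graph {ξ η : ((h0 j).tensor v).V 1} {b : ((h0 j).tensor v).V 0} {N N' : ℕ}
    (hN : ∀ k, N ≤ k → ((h0 j).tensor v).expTerm ξ b k = 0) (hN' : act j v b ^ N' = 0)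
    (hη : η = ξ - ∑ k ∈ Finset.range N,
      (k.factorial : K)⁻¹ • ((h0 j).tensor v).expTerm ξ b k) (a : v ⊗[K] A) :
    prBT P v (expSum (act j v b) N' (emb j ξ a)) =
      hat j v η (prAT j v (expSum (act j v b) N' (emb j ξ a))) := by
  have h := (isRiccatiSeq_expTerm ξ b).graph
    (LinearMap.ext fun z => inclT_add_jT j v z)
    (LinearMap.ext fun z => by simp [Module.End.mul_apply])
    (LinearMap.ext fun z => by simp [Module.End.mul_apply])
    (LinearMap.ext fun z => by simp [Module.End.mul_apply, toEnd_apply])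
    (LinearMap.ext fun z => by simp [Module.End.mul_apply, toEnd_apply])
    (N := N) (fun k hk => by rw [hN k hk, map_zero]) hN'
  have hη' : toEnd j v ξ - ∑ k ∈ Finset.range N,
      (k.factorial : K)⁻¹ • toEnd j v (((h0 j).tensor v).expTerm ξ b k) = toEnd j v η := by
    rw [hη, map_sub, map_sum]
    simp only [map_smul]
  have hexp : ∑ k ∈ Finset.range N', (k.factorial : K)⁻¹ • act j v b ^ k =
      expSum (act j v b) N' :=
    Finset.sum_congr rfl fun k _ => (algebraMap_smul v _ _).symm
  rw [hη', hexp] at h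
  -- At `i(a)` the factor `p_A + x` becomes the point `a + ξ(a)` of the graph, and `pr_B` undoes `j`
  -- on the left.
  have h1 := congrArg (prBT P v) (LinearMap.congr_fun h (inclT P v a))
  have h2 : (inclT P v ∘ₗ prAT j v + toEnd j v ξ : Module.End v (v ⊗[K] L)) (inclT P v a) =
      emb j ξ a := by
    simp [toEnd_apply, emb_apply]
  rw [Module.End.mul_apply, Module.End.mul_apply, h2, LinearMap.sub_apply, LinearMap.comp_apply,
    toEnd_apply, map_sub, prBT_jT, prBT_jT, LinearMap.zero_apply, map_zero, sub_eq_zero] at h1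
  exact h1

lemma hom_ext_one {E F : Type u} [AddCommGroup E] [Module K E] [AddCommGroup F] [Module K F]
    {f g : v ⊗[K] E →ₗ[v] v ⊗[K] F} (h : ∀ e, f (1 ⊗ₜ e) = g (1 ⊗ₜ e)) : f = g :=
  LinearMap.ext fun z => by
    induction z using tind with
    | one a => exact h a
    | add x y hx hy => rw [map_add, map_add, hx, hy]
    | smul c x hx => rw [map_smul, map_smul, hx]

/-- The element `ad_y + X` acts as `ad_{y + jX}`: the summand `Γ(B)` in degree zero adds no
operators beyond the inner derivations. -/
lemma exists_act_eq_brT (b : ((h0 j).tensor v).V 0) :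
    ∃ u : v.maxIdeal ⊗[K] L, act j v b = brT P v (inclMax v L u) := by
  induction b using h0_induction with
  | zero => exact ⟨0, by simp⟩
  | tm b c =>
    obtain ⟨y, hy⟩ : ∃ y, ad P y = b.1 := b.1.2
    refine ⟨c ⊗ₜ (y + j.j (form0 P b.2)), ?_⟩
    refine hom_ext_one fun x => ?_
    rw [act_tm, inclMax_smul_tmul, map_smul, LinearMap.smul_apply, LinearMap.smul_apply, brT_tmul,
      LinearMap.baseChange_tmul, derOp_apply, ← hy, ad_apply, map_add, LinearMap.add_apply, mul_one]
  | add x y hx hy =>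
    obtain ⟨u, hu⟩ := hx
    obtain ⟨u', hu'⟩ := hy
    exact ⟨u + u', by rw [map_add, map_add, map_add, hu, hu']⟩

variable (j) in
-- Take `ad_u` in `IDer(L) ⊗ 𝔪`, with vanishing component in `Γ(B) ⊗ 𝔪`.
lemma exists_brT_eq_act (u : v.maxIdeal ⊗[K] L) :
    ∃ b : ((h0 j).tensor v).V 0, act j v b = brT P v (inclMax v L u) := by
  induction u using TensorProduct.induction_on with
  | zero => exact ⟨0, by simp⟩
  | tmul c y =>
    refine ⟨tm j (⟨ad P y, by simp [hDer]⟩, 0) c, ?_⟩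
    refine hom_ext_one fun x => ?_
    rw [act_tm, inclMax_smul_tmul, map_smul, LinearMap.smul_apply, LinearMap.smul_apply, brT_tmul,
      LinearMap.baseChange_tmul, derOp_apply, ad_apply, map_zero, map_zero, map_zero,
      LinearMap.zero_apply, add_zero, mul_one]
  | add x y hx hy =>
    obtain ⟨b, hb⟩ := hx
    obtain ⟨b', hb'⟩ := hy
    exact ⟨b + b', by rw [map_add, map_add, map_add, hb, hb']⟩

end Gauge

section InnerAut

variable {K : Type w} [Field K] [CharZero K] {R : Type u} [CommRing R] [Algebra K R]
  {A L : Type u} [AddCommGroup A] [Module K A] [Module R A] [IsScalarTower K R A]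
  [AddCommGroup L] [Module K L] [Module R L] [IsScalarTower K R L]
  (P : LiePair K R A L) (v : ArtAlg.{w, u} K)

/-! ### Small inner automorphisms -/

/-- The anchor of the Cartesian extension of `L`. -/
abbrev ancT : v ⊗[K] L →ₗ[v] v ⊗[K] Derivation K R R := (P.algL.cartesian v).anchor

variable {P v}

@[simp] lemma pair_tmul (a b : v) (D : Derivation K R R) (f : R) :
    pair R v (a ⊗ₜ D) (b ⊗ₜ f) = (a * b) ⊗ₜ[K] D f := ext₂_tmul v _ a b D f

@[simp] lemma ancT_tmul (a : v) (x : L) : ancT P v (a ⊗ₜ x) = a ⊗ₜ[K] P.algL.anchor x := rfl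

lemma evT_brT (x y : v ⊗[K] L) :
    evT v L (brT P v x y) = P.algL.bracket (evT v L x) (evT v L y) := by
  induction x using tind with
  | one x =>
    induction y using tind with
    | one y => rw [brT_tmul]; simp
    | add x y hx hy => simp only [map_add, hx, hy]
    | smul c x hx => simp only [map_smul, evT_smul, hx]
  | add x y hx hy => simp only [map_add, LinearMap.add_apply, hx, hy]
  | smul c x hx => simp only [map_smul, LinearMap.smul_apply, evT_smul, hx]

lemma evT_ancT (x : v ⊗[K] L) :
    evT v (Derivation K R R) (ancT P v x) = P.algL.anchor (evT v L x) :=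
  evT_baseChange (P.algL.anchor.restrictScalars K) x

lemma evT_pair (D : v ⊗[K] Derivation K R R) (f : v ⊗[K] R) :
    evT v R (pair R v D f) = (evT v (Derivation K R R) D) (evT v R f) := by
  induction D using tind with
  | one x =>
    induction f using tind with
    | one y => simp
    | add x y hx hy => simp only [map_add, hx, hy]
    | smul c x hx => simp only [map_smul, evT_smul, hx, Derivation.map_smul]
  | add x y hx hy => simp only [map_add, LinearMap.add_apply, hx, hy, Derivation.add_apply]
  | smul c x hx => simp only [map_smul, LinearMap.smul_apply, evT_smul, hx, Derivation.smul_apply]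

lemma pair_mul (D : v ⊗[K] Derivation K R R) (f g : v ⊗[K] R) :
    pair R v D (f * g) = pair R v D f * g + f * pair R v D g := by
  induction D using tind with
  | one D =>
    induction f using tind with
    | one f =>
      induction g using tind with
      | one g => simp [TensorProduct.tmul_add, add_comm, mul_comm]
      | add x y hx hy => simp only [mul_add, map_add, hx, hy]; abel
      | smul c x hx => simp only [mul_smul_comm, map_smul, hx, smul_add]
    | add x y hx hy => simp only [add_mul, map_add, hx, hy]; abel
    | smul c x hx => simp only [smul_mul_assoc, map_smul, hx, smul_add]
  | add x y hx hy => simp only [map_add, LinearMap.add_apply, add_mul, mul_add, hx, hy]; abel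
  | smul c x hx =>
    simp only [map_smul, LinearMap.smul_apply, smul_mul_assoc, mul_smul_comm, hx, smul_add]

/-- The anchor is a morphism of Lie algebras. This is the Leibniz rule from which compatibility of
`exp(ad_u)` and `exp(ρ(u))` with the anchor follows. -/
lemma pair_ancT_brT (x y : v ⊗[K] L) (f : v ⊗[K] R) :
    pair R v (ancT P v (brT P v x y)) f =
      pair R v (ancT P v x) (pair R v (ancT P v y) f) -
        pair R v (ancT P v y) (pair R v (ancT P v x) f) := by
  induction x using tind with
  | one x =>
    induction y using tind with
    | one y =>
      induction f using tind with
      | one f =>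
        rw [brT_tmul]
        simp [P.algL.anchor_bracket, Derivation.commutator_apply, TensorProduct.tmul_sub]
      | add x y hx hy => simp only [map_add, hx, hy]; abel
      | smul c x hx => simp only [map_smul, hx, smul_sub]
    | add x y hx hy => simp only [map_add, LinearMap.add_apply, hx, hy]; abel
    | smul c x hx => simp only [map_smul, LinearMap.smul_apply, hx, smul_sub]
  | add x y hx hy => simp only [map_add, LinearMap.add_apply, hx, hy]; abel
  | smul c x hx => simp only [map_smul, LinearMap.smul_apply, hx, smul_sub]

lemma brT_inclMax_mem_filt (u : v.maxIdeal ⊗[K] L) :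
    brT P v (inclMax v L u) ∈ filt v _ _ 1 :=
  mem_filt_one.2 fun e => by rw [evT_brT, evT_inclMax, map_zero, LinearMap.zero_apply]

lemma pair_inclMax_mem_filt (u : v.maxIdeal ⊗[K] L) :
    pair R v (ancT P v (inclMax v L u)) ∈ filt v _ _ 1 :=
  mem_filt_one.2 fun e => by
    rw [evT_pair, evT_ancT, evT_inclMax, map_zero, Derivation.zero_apply]

variable (P) in
lemma exists_pow_eq_zero (u : v.maxIdeal ⊗[K] L) :
    ∃ N, brT P v (inclMax v L u) ^ N = 0 ∧
      pair R v (ancT P v (inclMax v L u)) ^ N = 0 := by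
  obtain ⟨N, hN⟩ := exists_filt_eq_zero v
  exact ⟨N, hN _ _ _ (pow_mem_filt (brT_inclMax_mem_filt u) N),
    hN _ _ _ (pow_mem_filt (pair_inclMax_mem_filt u) N)⟩

variable (P v) in
lemma isSmallInnerAut_one : IsSmallInnerAut P v 1 1 :=
  ⟨0, 1, by simp, by simp, by simp [expSum], by simp [expSum]⟩

namespace IsSmallInnerAut

variable {Φ : Module.End v (v ⊗[K] L)} {φ : Module.End v (v ⊗[K] R)}

lemma evT_left (h : IsSmallInnerAut P v Φ φ) (x : v ⊗[K] L) : evT v L (Φ x) = evT v L x := by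
  obtain ⟨u, N, h1, -, rfl, -⟩ := h
  have := evT_eq_zero_of_mem (expSum_sub_one_mem_filt (brT_inclMax_mem_filt u) h1 x)
  rwa [LinearMap.sub_apply, map_sub, sub_eq_zero] at this

lemma evT_right (h : IsSmallInnerAut P v Φ φ) (f : v ⊗[K] R) : evT v R (φ f) = evT v R f := by
  obtain ⟨u, N, -, h2, -, rfl⟩ := h
  have := evT_eq_zero_of_mem (expSum_sub_one_mem_filt (pair_inclMax_mem_filt u) h2 f)
  rwa [LinearMap.sub_apply, map_sub, sub_eq_zero] at this

lemma map_brT (h : IsSmallInnerAut P v Φ φ) (x y : v ⊗[K] L) :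
    Φ (brT P v x y) = brT P v (Φ x) (Φ y) := by
  obtain ⟨u, N, h1, -, rfl, -⟩ := h
  exact expSum_bilin (brT P v) ((P.algL.cartesian v).jacobi _) h1 h1 h1 x y

lemma map_smulT (h : IsSmallInnerAut P v Φ φ) (f : v ⊗[K] R) (x : v ⊗[K] L) :
    Φ (smulT R v L f x) = smulT R v L (φ f) (Φ x) := by
  obtain ⟨u, N, h1, h2, rfl, rfl⟩ := h
  exact expSum_bilin (smulT R v L) ((P.algL.cartesian v).leibniz _) h2 h1 h1 f x

lemma map_pair (h : IsSmallInnerAut P v Φ φ) (x : v ⊗[K] L) (f : v ⊗[K] R) :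
    φ (pair R v (ancT P v x) f) = pair R v (ancT P v (Φ x)) (φ f) := by
  obtain ⟨u, N, h1, h2, rfl, rfl⟩ := h
  exact expSum_bilin (pair R v ∘ₗ ancT P v)
    (fun x y => by
      rw [LinearMap.comp_apply, LinearMap.comp_apply, pair_ancT_brT, sub_add_cancel]) h1 h2 h2 x f

lemma map_mul (h : IsSmallInnerAut P v Φ φ) (f g : v ⊗[K] R) : φ (f * g) = φ f * φ g := by
  obtain ⟨u, N, -, h2, -, rfl⟩ := h
  exact expSum_bilin (LinearMap.mul v (v ⊗[K] R)) (fun f g => pair_mul _ f g) h2 h2 h2 f g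

/-- Multiplicativity and surjectivity suffice: if `φ(y) = 1`, then `φ(1) = φ(1) φ(y) = φ(y) = 1`. -/
lemma map_one (h : IsSmallInnerAut P v Φ φ) : φ 1 = 1 := by
  obtain ⟨y, hy⟩ := (bijective_of_center (f := φ) fun e => by rw [h.evT_right]; simp).2 1
  have := h.map_mul 1 y
  rwa [one_mul, hy, mul_one, eq_comm] at this

/-- The automorphism `exp(ρ(u))` of the `v`-algebra of functions. -/
def algHom (h : IsSmallInnerAut P v Φ φ) : v ⊗[K] R →ₐ[v] v ⊗[K] R :=
  AlgHom.ofLinearMap φ h.map_one h.map_mul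

end IsSmallInnerAut

end InnerAut

section Deformation

variable {K : Type w} [Field K] [CharZero K] {R : Type u} [CommRing R] [Algebra K R]
  {A L : Type u} [AddCommGroup A] [Module K A] [Module R A] [IsScalarTower K R A]
  [AddCommGroup L] [Module K L] [Module R L] [IsScalarTower K R L]
  {P : LiePair K R A L} (j : Splitting P) {v : ArtAlg.{w, u} K}

/-! ### The deformation of a Maurer-Cartan element -/

/-- The bracket on `A_v` induced by the graph of `ξ`. -/
def mcBracket (ξ : ((h0 j).tensor v).V 1) : v ⊗[K] A →ₗ[v] v ⊗[K] A →ₗ[v] v ⊗[K] A :=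
  ((brT P v).compl₁₂ (emb j ξ) (emb j ξ)).compr₂ (prAT j v)

variable {j}

/-- The graph is closed under the bracket, so nothing is lost in the projection to `A_v`. -/
lemma emb_mcBracket {ξ : ((h0 j).tensor v).V 1} (hξ : ((h0 j).tensor v).IsMC ξ)
    (x y : v ⊗[K] A) : emb j ξ (mcBracket j ξ x y) = brT P v (emb j ξ x) (emb j ξ y) :=
  emb_prAT ((isMC_iff ξ).1 hξ x y)

/-- The infinitesimal deformation whose image is the graph of `ξ`. -/
def mcInfDef (ξ : ((h0 j).tensor v).V 1) (hξ : ((h0 j).tensor v).IsMC ξ) : InfDef P v where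
  str :=
    -- The axioms are verified after the injective map `emb j ξ`, where they become those of `L_v`.
    { bracket := mcBracket j ξ
      anchor := ancT P v ∘ₗ emb j ξ
      anchor_smul := fun f x => by
        rw [LinearMap.comp_apply, emb_smulT, (P.algL.cartesian v).anchor_smul,
          LinearMap.comp_apply]
      skew := fun x y => emb_injective ξ (by
        rw [map_neg, emb_mcBracket hξ, emb_mcBracket hξ, (P.algL.cartesian v).skew])
      jacobi := fun x y z => emb_injective ξ (by
        simp only [map_add, emb_mcBracket hξ]
        exact (P.algL.cartesian v).jacobi _ _ _)
      leibniz := fun x f y => emb_injective ξ (by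
        simp only [map_add, emb_mcBracket hξ, emb_smulT]
        exact (P.algL.cartesian v).leibniz _ _ _) }
  I := emb j ξ
  -- The map `ξ` is linear over `R ⊗ v`, so no change of the functions is needed.
  lam := AlgHom.id v _
  center_bracket a b := P.incl_injective (by
    change P.incl (evT v A (mcBracket j ξ _ _)) = _
    rw [← evT_emb ξ, emb_mcBracket hξ, evT_brT, evT_emb, evT_emb, P.incl_bracket]
    simp)
  center_anchor a := by
    change evT v _ (ancT P v (emb j ξ _)) = _
    rw [evT_ancT, evT_emb, P.anchor_incl]
    simp
  isMor :=
    { map_bracket := emb_mcBracket hξ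
      base_small := fun f => by simp
      map_smul := emb_smulT ξ
      map_anchor := fun _ _ => rfl }
  center_I a := by rw [evT_emb]; simp

/-! ### The image of an infinitesimal deformation -/

lemma InfDef.evT_I (D : InfDef P v) (a : v ⊗[K] A) : evT v L (D.I a) = P.incl (evT v A a) :=
  evT_map_of_center (g := P.incl.restrictScalars K) D.center_I a

lemma InfDef.lam_bijective (D : InfDef P v) : Function.Bijective D.lam :=
  bijective_of_center (f := D.lam.toLinearMap) D.isMor.base_small

variable (j) in
-- Modulo `𝔪` this is `pr_A ∘ i = id`. It makes the image of `D` a graph over `A_v`.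
lemma InfDef.prAT_I_bijective (D : InfDef P v) :
    Function.Bijective (prAT j v ∘ₗ D.I : Module.End v (v ⊗[K] A)) :=
  bijective_of_center fun a => by
    rw [LinearMap.comp_apply, evT_baseR, D.center_I, prA_incl]

lemma InfDef.I_injective (j : Splitting P) (D : InfDef P v) : Function.Injective D.I :=
  Function.Injective.of_comp (f := prAT j v) (D.prAT_I_bijective j).1

/-- The image of the deformation `D` is contained in the graph of `ξ`. -/
def IsGraph (D : InfDef P v) (ξ : ((h0 j).tensor v).V 1) : Prop :=
  ∀ a, prBT P v (D.I a) = hat j v ξ (prAT j v (D.I a))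

lemma isGraph_mcInfDef (ξ : ((h0 j).tensor v).V 1) (hξ : ((h0 j).tensor v).IsMC ξ) :
    IsGraph (mcInfDef ξ hξ) ξ := fun a => by
  change prBT P v (emb j ξ a) = hat j v ξ (prAT j v (emb j ξ a))
  rw [prBT_emb, prAT_emb]

/-- Containment of the image in the graph is already equality: `pr_A ∘ I` is onto, and `pr_A` is
injective on the graph. -/
lemma IsGraph.exists_eq {D : InfDef P v} {ξ : ((h0 j).tensor v).V 1} (h : IsGraph D ξ)
    {z : v ⊗[K] L} (hz : prBT P v z = hat j v ξ (prAT j v z)) : ∃ a, D.I a = z := by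
  obtain ⟨a, ha⟩ := (D.prAT_I_bijective j).2 (prAT j v z)
  refine ⟨a, ?_⟩
  rw [← emb_prAT hz, ← ha]
  exact (emb_prAT (h a)).symm

lemma IsGraph.exists_eq_emb {D : InfDef P v} {ξ : ((h0 j).tensor v).V 1} (h : IsGraph D ξ)
    (x : v ⊗[K] A) : ∃ a, D.I a = emb j ξ x :=
  h.exists_eq (by rw [prBT_emb, prAT_emb])

variable (j) in
lemma exists_isGraph (D : InfDef P v) :
    ∃ ξ : ((h0 j).tensor v).V 1, ((h0 j).tensor v).IsMC ξ ∧ IsGraph D ξ := by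
  let e := LinearEquiv.ofBijective _ (D.prAT_I_bijective j)
  have he : ∀ a, prAT j v (D.I (e.symm a)) = a := e.apply_symm_apply
  -- The graph map is `pr_B I (pr_A I)⁻¹`. It commutes with `r` although `I` is only `λ`-semilinear:
  -- writing `r = λ(s)`, multiplication by `r` on the image corresponds to multiplication by `s` on
  -- the source.
  obtain ⟨ξ, hξ⟩ := exists_hat_eq j (prBT P v ∘ₗ D.I ∘ₗ e.symm.toLinearMap) (fun r a => by
    obtain ⟨s, hs⟩ := D.lam_bijective.2 (1 ⊗ₜ r)
    have h1 : e.symm (1 ⊗ₜ (r • a)) = smulT R v A s (e.symm (1 ⊗ₜ a)) := by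
      rw [LinearEquiv.symm_apply_eq]
      change _ = prAT j v (D.I _)
      rw [D.isMor.map_smul, hs, baseR_smulT, he, smulT_tmul, mul_one]
    change prBT P v (D.I (e.symm _)) = smulT R v _ _ (prBT P v (D.I (e.symm _)))
    rw [h1, D.isMor.map_smul, hs, baseR_smulT]) (fun a => by
    change evT v _ (prBT P v (D.I (e.symm _))) = 0
    rw [evT_baseR, D.evT_I, prB_incl])
  have hg : IsGraph D ξ := fun a => by
    rw [hξ]
    change _ = prBT P v (D.I (e.symm (e a)))
    rw [e.symm_apply_apply]
  -- The graph is the whole image of `I`, which is closed under the bracket because `I` preserves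
  -- brackets.
  refine ⟨ξ, (isMC_iff ξ).2 fun a b => ?_, hg⟩
  obtain ⟨a, ha⟩ := hg.exists_eq_emb a
  obtain ⟨b, hb⟩ := hg.exists_eq_emb b
  rw [← ha, ← hb, ← D.isMor.map_bracket]
  exact hg _

/-! ### Semistrict isomorphisms and gauge equivalence -/

/-- Injectivity of `I` and bijectivity of `λ` allow `Π = I⁻¹ Φ I'` and `μ = λ⁻¹ φ λ'`. Each
condition on a morphism holds after applying `I` or `λ`, since `I`, `I'` and the inner automorphism
respect the structure. -/
lemma semistrictIso_of_forall_exists (j : Splitting P) {D D' : InfDef P v}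
    {Φ : Module.End v (v ⊗[K] L)} {φ : Module.End v (v ⊗[K] R)} (h : IsSmallInnerAut P v Φ φ)
    (hD : ∀ a, ∃ b, D.I b = Φ (D'.I a)) : SemistrictIso D D' := by
  let e := LinearEquiv.ofInjective D.I (D.I_injective j)
  let l := AlgEquiv.ofBijective D.lam D.lam_bijective
  let Pi : v ⊗[K] A →ₗ[v] v ⊗[K] A :=
    e.symm.toLinearMap ∘ₗ (Φ ∘ₗ D'.I).codRestrict (LinearMap.range D.I) hD
  let mu : v ⊗[K] R →ₐ[v] v ⊗[K] R := (l.symm.toAlgHom.comp h.algHom).comp D'.lam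
  have hPi : ∀ a, D.I (Pi a) = Φ (D'.I a) := fun a => by
    have := congrArg Subtype.val (e.apply_symm_apply
      ((Φ ∘ₗ D'.I).codRestrict (LinearMap.range D.I) hD a))
    exact this
  have hmu : ∀ f, D.lam (mu f) = φ (D'.lam f) := fun f => l.apply_symm_apply (φ (D'.lam f))
  refine ⟨Φ, φ, Pi, mu, h, ⟨fun x y => D.I_injective j ?_, fun f => ?_,
    fun f x => D.I_injective j ?_, fun x f => D.lam_bijective.1 ?_⟩,
    fun a => (hPi a).symm, fun f => (hmu f).symm⟩
  · rw [hPi, D'.isMor.map_bracket, h.map_brT, D.isMor.map_bracket, hPi, hPi]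
  · have h1 : ∀ g, evT v R (D.lam g) = evT v R g :=
      evT_map_of_center (f := D.lam.toLinearMap) (g := LinearMap.id) D.isMor.base_small
    rw [← h1, hmu, h.evT_right, D'.isMor.base_small]
  · rw [hPi, D'.isMor.map_smul, h.map_smulT, D.isMor.map_smul, hPi, hmu]
  · rw [hmu, D'.isMor.map_anchor, h.map_pair, D.isMor.map_anchor, hPi, hmu]

/-- Two deformations with the same image differ by a reparametrization only, so the inner
automorphism is the identity. -/
lemma IsGraph.semistrictIso {D D' : InfDef P v} {ξ : ((h0 j).tensor v).V 1} (h : IsGraph D ξ)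
    (h' : IsGraph D' ξ) : SemistrictIso D D' :=
  semistrictIso_of_forall_exists j (isSmallInnerAut_one P v) fun a => h.exists_eq (h' a)

lemma IsGraph.semistrictIso_of_gaugeEquiv {D D' : InfDef P v} {ξ η : ((h0 j).tensor v).V 1}
    (h : IsGraph D η) (h' : IsGraph D' ξ) (hg : ((h0 j).tensor v).GaugeEquiv ξ η) :
    SemistrictIso D D' := by
  obtain ⟨b, N, hN, hη⟩ := hg
  obtain ⟨u, hu⟩ := exists_act_eq_brT b
  obtain ⟨N', h1, h2⟩ := exists_pow_eq_zero P u
  refine semistrictIso_of_forall_exists j ⟨u, N', h1, h2, rfl, rfl⟩ fun a => h.exists_eq ?_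
  -- The point of the graph of `ξ` above `pr_A I'(a)` is `I'(a)` itself.
  have := gauge_graph hN (hu ▸ h1) hη (prAT j v (D'.I a))
  rwa [emb_prAT (h' a), hu] at this

/-- The inner automorphism carries the graph of `ξ` into the graph of `η` by assumption, and into
the graph of `e^b * ξ` by the flow computation. The moved graph projects onto `A_v`, so both maps
agree everywhere. -/
lemma IsGraph.gaugeEquiv {D D' : InfDef P v} {ξ η : ((h0 j).tensor v).V 1}
    (h : IsGraph D η) (h' : IsGraph D' ξ) (hs : SemistrictIso D D') :
    ((h0 j).tensor v).GaugeEquiv ξ η := by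
  obtain ⟨Φ, φ, Pi, -, hΦ, -, hPi, -⟩ := hs
  have hcenter : ∀ a : A, evT v A ((prAT j v ∘ₗ Φ ∘ₗ emb j ξ) (1 ⊗ₜ a)) = a := fun a => by
    rw [LinearMap.comp_apply, LinearMap.comp_apply, evT_baseR, hΦ.evT_left, evT_emb]
    simp
  obtain ⟨u, N', h1, h2, rfl, rfl⟩ := hΦ
  obtain ⟨b, hb⟩ := exists_brT_eq_act j u
  obtain ⟨N, hN⟩ := exists_expTerm_eq_zero ξ b
  refine ⟨b, N, hN, hat_injective j (LinearMap.ext fun z => ?_)⟩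
  -- Every `z` in `A_v` is the `A`-component of the image under `Φ` of some point `a + ξ(a)`.
  obtain ⟨a, rfl⟩ := (bijective_of_center hcenter).2 z
  have h3 := gauge_graph hN (hb.symm ▸ h1) rfl a
  rw [hb] at h3
  obtain ⟨c, hc⟩ := h'.exists_eq_emb a
  have h4 := h (Pi c)
  rw [← hPi, hc] at h4
  exact h4.symm.trans h3

/-! ### Naturality -/

lemma pushT_baseR {E F : Type u} [AddCommGroup E] [Module K E] [Module R E] [IsScalarTower K R E]
    [AddCommGroup F] [Module K F] [Module R F] [IsScalarTower K R F] {v' : ArtAlg.{w, u} K}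
    (ϑ : v ⟶ v') (f : E →ₗ[R] F) (x : v ⊗[K] E) :
    pushT ϑ F (baseR v f x) = baseR v' f (pushT ϑ E x) := by
  induction x using tind with
  | one x => simp
  | add x y hx hy => simp only [map_add, hx, hy]
  | smul c x hx => simp only [map_smul, pushT_smul, hx]

lemma hat_tensorMap {v' : ArtAlg.{w, u} K} (ϑ : v ⟶ v') (ξ : ((h0 j).tensor v).V 1)
    (a : v ⊗[K] A) :
    hat j v' ((h0 j).tensorMap ϑ 1 ξ) (pushT ϑ A a) = pushT ϑ P.B (hat j v ξ a) := by
  induction ξ using h0_induction with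
  | zero => simp only [map_zero, LinearMap.zero_apply]
  | tm x c =>
    rw [hat_tm, LinearMap.smul_apply, pushT_smul, pushT_baseR]
    rfl
  | add x y hx hy => simp only [map_add, LinearMap.add_apply, hx, hy]

/-- The graph relation is an identity of linear maps, hence stable under base change. Naturality
follows, as a class depends on the graph alone. -/
lemma IsGraph.push {v' : ArtAlg.{w, u} K} (ϑ : v ⟶ v') {D : InfDef P v}
    {ξ : ((h0 j).tensor v).V 1} (h : IsGraph D ξ) :
    IsGraph (D.push ϑ) ((h0 j).tensorMap ϑ 1 ξ) := fun a => by
  induction a using pind ϑ with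
  | push a =>
    rw [InfDef.push, pushHom_pushT, ← pushT_baseR, ← pushT_baseR, hat_tensorMap, h]
  | add x y hx hy => simp only [map_add, hx, hy]
  | smul c x hx => simp only [map_smul, hx]

/-- Gauge classes of Maurer-Cartan elements correspond to semistrict isomorphism classes. -/
def quotEquiv (j : Splitting P) (v : ArtAlg.{w, u} K) :
    (CubicBrackets.defFunctor (h0 j)).obj v ≃ (sDef P).obj v where
  toFun := Quot.lift (fun ξ => Quot.mk _ (mcInfDef ξ.1 ξ.2)) fun ξ η h =>
    -- The two relations point in opposite directions: `Φ` maps the second deformation to the first,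
    -- whereas the gauge action maps `ξ` to `η`.
    (Quot.sound ((isGraph_mcInfDef η.1 η.2).semistrictIso_of_gaugeEquiv
      (isGraph_mcInfDef ξ.1 ξ.2) h)).symm
  invFun := Quot.lift (fun D => Quot.mk _ ⟨_, (exists_isGraph j D).choose_spec.1⟩) fun D D' h =>
    (Quot.sound (r := fun ξ η : ((h0 j).tensor v).MC => ((h0 j).tensor v).GaugeEquiv ξ.1 η.1)
      (a := ⟨_, (exists_isGraph j D').choose_spec.1⟩) (b := ⟨_, (exists_isGraph j D).choose_spec.1⟩)
      ((exists_isGraph j D).choose_spec.2.gaugeEquiv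
        (exists_isGraph j D').choose_spec.2 h)).symm
  left_inv x := by
    obtain ⟨ξ, rfl⟩ := Quot.exists_rep x
    -- The chosen element has the same deformation on its graph, which is semistrict isomorphic to
    -- itself; this yields a gauge equivalence.
    exact Quot.sound ((isGraph_mcInfDef ξ.1 ξ.2).gaugeEquiv
      (exists_isGraph j (mcInfDef ξ.1 ξ.2)).choose_spec.2
      ((isGraph_mcInfDef ξ.1 ξ.2).semistrictIso (isGraph_mcInfDef ξ.1 ξ.2)))
  right_inv x := by
    obtain ⟨D, rfl⟩ := Quot.exists_rep x
    exact Quot.sound ((isGraph_mcInfDef _ (exists_isGraph j D).choose_spec.1).semistrictIso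
      (exists_isGraph j D).choose_spec.2)

/-- The theorem for Lie pairs of modules over a commutative algebra. -/
def defIsoSDef (j : Splitting P) : CubicBrackets.defFunctor (h0 j) ≅ sDef P :=
  NatIso.ofComponents (fun v => (quotEquiv j v).toIso) fun {v v'} ϑ => by
    ext x
    obtain ⟨ξ, rfl⟩ := Quot.exists_rep x
    -- The deformation of the pushed element and the base change of the deformation of `ξ` have the
    -- same graph.
    exact Quot.sound ((isGraph_mcInfDef _ _).semistrictIso
      ((isGraph_mcInfDef ξ.1 ξ.2).push ϑ))

end Deformation

end LiePairDef

end

theorem mainTheorem2 {𝕜 : Type} [RCLike 𝕜] {n : ℕ} {M : Type u} [TopologicalSpace M] [T2Space M]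
    [SecondCountableTopology M] [ChartedSpace (EuclideanSpace ℝ (Fin n)) M]
    [IsManifold (𝓡 n) ∞ M] {A L : LiePairDef.SmoothBundle 𝕜 n M}
    (P : LiePairDef.SmoothLiePair A L) (j : LiePairDef.Splitting P.toLiePair) :
    Nonempty (LiePairDef.CubicBrackets.defFunctor (LiePairDef.h0 j) ≅
      LiePairDef.sDef P.toLiePair) :=
  ⟨LiePairDef.defIsoSDef j⟩
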